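/- Let $(Z,\mathfrak Z)$ be a measurable space with a $\sigma$-finite measure $\nu$, and let $\eta$ be an (almost surely proper) Poisson point process on $Z$ with intensity $\nu$, defined on a probability space $(\Omega,\mathfrak O,\mathbb P)$. Write $\mathfrak W=\sigma(\eta)$, and let $I_2(f)$ denote the double Poisson (Wiener--Itô) integral of $f\in L^2(\nu^2)$: for $f\in L^1(\nu^2)\cap L^2(\nu^2)$, $$I_2(f)=\int f\,d\eta^{(2)}-\iint f(x,y)\,\eta(dx)\,\nu(dy)-\iint f(x,y)\,\nu(dx)\,\eta(dy)+\int f\,d\nu^2,$$ where $\eta^{(2)}=\sum_{i\neq j}\delta_{(x_i,x_j)}$ if $\eta=\sum_i\delta_{x_i}$, and $I_2$ is extended to $L^2(\nu^2)$ by $L^2$-continuity. For functions $f,g$ of two variables and $h$ of one variable write $$(f\star_1^1 g)(x,y)=\int f(z,x)g(z,y)\,\nu(dz),\quad (f\star_2^1 g)(x)=\int f(z,x)g(z,x)\,\nu(dz),\quad (f\star_1^1 h)(x)=\int f(z,x)h(z)\,\nu(dz).$$ Suppose that $\Omega$ also carries a Poisson process $N$ on $\mathbb R_+$ with Lebesgue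 intensity, independent of $\eta$. For a $\mathfrak W$-measurable random variable $M\ge 0$, let $\mathbf{Po}(M)$ denote the (compensated) Poisson mixture $N([0,M])-M$. A sequence $(F_n)$ converges stably to $F_\infty$ if $(F_n,Y)\to(F_\infty,Y)$ in law for every $Y\in L^\infty(\mathfrak W)$. **Theorem.** Let $F_n=I_2(g_n)$, $n\in\mathbb N$, where $g_n\in L^2(\nu^2)$ is symmetric. Suppose that there are $\hat g_n\in L^2(\nu^2)$ such that the symmetrization of $\hat g_n$ is $g_n$ for every $n$, a function $g_{2,\infty}\in L^2(\nu^2)$ and a number $g_{0,\infty}\in\mathbb R$ such that, as $n\to\infty$, - (KS) $g_n\star_1^1\hat g_n\to g_{2,\infty}$ in $L^2(\nu^2)$ and $\nu^2(g_n\hat g_n)\to g_{0,\infty}$; - (KW) $\hat g_n\star_1^1 h\to 0$ in $L^2(\nu)$ for every $h\in L^2(\nu)$; - (KR$_\star$) $g_n\star_2^1 g_n\to 0$ in $L^2(\nu)$; - (KP$_4$) $\nu^2\big(g_n^2(g_n-\tfrac12)^2\big)\to 0$. Assume that $M=2\big(I_2(g_{2,\infty})+g_{0,\infty}\big)\ge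 0$ almost surely. Then $F_n$ converges stably to $\mathbf{Po}(M)$. -/

import Mathlib

open MeasureTheory ProbabilityTheory Filter Topology
open scoped ENNReal NNReal

namespace PoissonMixture

/-- A measure is proper if it is a finite or countable sum of Dirac masses. -/
def IsProper {Z : Type*} [MeasurableSpace Z] (m : Measure Z) : Prop :=
  ∃ (I : Set ℕ) (x : I → Z), m = Measure.sum fun i => Measure.dirac (x i)

open Classical in
/-- The second factorial power `m⁽²⁾ = ∑_{i ≠ j} δ_{(x i, x j)}` of a proper measure
`m = ∑ i, δ_{x i}` (and `0` if `m` is not proper). -/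
noncomputable def factorialSq {Z : Type*} [MeasurableSpace Z] (m : Measure Z) :
    Measure (Z × Z) :=
  if h : IsProper m then
    Measure.sum fun p : {p : h.choose × h.choose // p.1 ≠ p.2} =>
      Measure.dirac (h.choose_spec.choose p.1.1, h.choose_spec.choose p.1.2)
  else 0

/-- `η` is a Poisson point process with intensity `ν`. The `σ`-algebra on `Measure Z` is the one
generated by the evaluations `m ↦ m B`, `B` measurable. -/
structure IsPoissonProcess {Ω Z : Type*} [MeasurableSpace Ω] [MeasurableSpace Z]
    (η : Ω → Measure Z) (ν : Measure Z) (P : Measure Ω) : Prop where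
  measurable : Measurable η
  proper : ∀ᵐ ω ∂P, IsProper (η ω)
  indep : ∀ (n : ℕ) (B : Fin n → Set Z), (∀ i, MeasurableSet (B i)) →
    Pairwise (fun i j => Disjoint (B i) (B j)) → iIndepFun (fun i ω => η ω (B i)) P
  law : ∀ B : Set Z, MeasurableSet B → ν B < ∞ →
    P.map (fun ω => η ω B) = (poissonMeasure (ν B).toNNReal).map (fun k : ℕ => (k : ℝ≥0∞))

/-- The `σ`-algebra generated by the point process `η`. -/
abbrev sigmaAlgebra {Ω Z : Type*} [MeasurableSpace Z] (η : Ω → Measure Z) : MeasurableSpace Ω :=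
  MeasurableSpace.comap η inferInstance

/-- The double integral of `f` against the compensated measure `m - ν` off the diagonal:
`∫ f dm⁽²⁾ - ∫∫ f(x,y) ν(dy) m(dx) - ∫∫ f(x,y) ν(dx) m(dy) + ∫∫ f dν²`. -/
noncomputable def pathIntegral₂ {Z : Type*} [MeasurableSpace Z] (ν m : Measure Z)
    (f : Z × Z → ℝ) : ℝ :=
  (∫ p, f p ∂(factorialSq m)) - (∫ x, ∫ y, f (x, y) ∂ν ∂m) - (∫ y, ∫ x, f (x, y) ∂ν ∂m)
    + ∫ p, f p ∂(ν.prod ν)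

/-- `F` is the double Poisson integral of `f ∈ L²(ν²)`: it is the `L²(P)`-limit of the pathwise
integrals of some functions in `L¹(ν²) ∩ L²(ν²)` converging to `f` in `L²(ν²)`. -/
def IsPoissonIntegral₂ {Ω Z : Type*} [MeasurableSpace Ω] [MeasurableSpace Z] (P : Measure Ω)
    (ν : Measure Z) (η : Ω → Measure Z) (f : Z × Z → ℝ) (F : Ω → ℝ) : Prop :=
  MemLp F 2 P ∧ ∃ φ : ℕ → Z × Z → ℝ,
    (∀ k, Measurable (φ k) ∧ MemLp (φ k) 1 (ν.prod ν) ∧ MemLp (φ k) 2 (ν.prod ν)) ∧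
    Tendsto (fun k => eLpNorm (fun p => φ k p - f p) 2 (ν.prod ν)) atTop (𝓝 0) ∧
    Tendsto (fun k => eLpNorm (fun ω => pathIntegral₂ ν (η ω) (φ k) - F ω) 2 P) atTop (𝓝 0)

open Classical in
/-- The double Poisson (Wiener-Itô) integral `I₂(f)`, `f ∈ L²(ν²)`, as a random variable
defined up to almost sure equality. -/
noncomputable def poissonIntegral₂ {Ω Z : Type*} [MeasurableSpace Ω] [MeasurableSpace Z]
    (P : Measure Ω) (ν : Measure Z) (η : Ω → Measure Z) (f : Z × Z → ℝ) : Ω → ℝ :=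
  if h : ∃ F, IsPoissonIntegral₂ P ν η f F then h.choose else 0

/-- The contraction `(f ⋆₁¹ g)(x, y) = ∫ f(z, x) g(z, y) ν(dz)` of two functions of
two variables. -/
noncomputable def star₁₁ {Z : Type*} [MeasurableSpace Z] (ν : Measure Z) (f g : Z × Z → ℝ) :
    Z × Z → ℝ :=
  fun p => ∫ z, f (z, p.1) * g (z, p.2) ∂ν

/-- The contraction `(f ⋆₁¹ h)(x) = ∫ f(z, x) h(z) ν(dz)` of a function of two variables with a
function of one variable. -/
noncomputable def star₁₁' {Z : Type*} [MeasurableSpace Z] (ν : Measure Z) (f : Z × Z → ℝ)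
    (h : Z → ℝ) : Z → ℝ :=
  fun x => ∫ z, f (z, x) * h z ∂ν

/-- The contraction `(f ⋆₂¹ g)(x) = ∫ f(z, x) g(z, x) ν(dz)`. -/
noncomputable def star₂₁ {Z : Type*} [MeasurableSpace Z] (ν : Measure Z) (f g : Z × Z → ℝ) :
    Z → ℝ :=
  fun x => ∫ z, f (z, x) * g (z, x) ∂ν

/-- The compensated Poisson mixture `N([0, M]) - M`; its law is `Po(M)` when `N` is a Poisson
process on `ℝ₊` with Lebesgue intensity that is independent of the randomness of `M`. -/
noncomputable def poissonMixture {Ω : Type*} (N : Ω → Measure ℝ) (M : Ω → ℝ) : Ω → ℝ :=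
  fun ω => (N ω (Set.Icc 0 (M ω))).toReal - M ω

/-- Stable convergence of `F n` to `F∞` with respect to the `σ`-algebra `W`: for all
`Y ∈ L^∞(W)`, the pair `(F n, Y)` converges in law to `(F∞, Y)`. -/
def StablyTendsto {Ω : Type*} (W : MeasurableSpace Ω) [MeasurableSpace Ω] (P : Measure Ω)
    [IsProbabilityMeasure P] (F : ℕ → Ω → ℝ) (Finf : Ω → ℝ) : Prop :=
  ∀ Y : Ω → ℝ, Measurable[W] Y → MemLp Y ∞ P →
    TendstoInDistribution (fun n ω => (F n ω, Y ω)) atTop (fun ω => (Finf ω, Y ω))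
      (fun _ => P) P

end PoissonMixture

namespace PoissonMixture

/-! The mixture is degenerate: the hypotheses force `g₂ = 0` almost everywhere, so `M` is the
constant `2 * g₀`. The integral of `star₁₁ ν (g n) (g' n)` over a rectangle `S × T` of finite
measure is the scalar product of the sections `∫_S g n (·, x) ν(dx)` and `∫_T g' n (·, y) ν(dy)`. By
Cauchy-Schwarz and (KR⋆) the first tends to zero in `L²(ν)`. So does the second, being twice the
same section of `g n` minus the contraction of `g' n` with `1_T`, which (KW) controls
(`ae_eq_zero_of_tendsto_star₁₁`). What remains is a mixing Poisson limit theorem with a fixed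
parameter.

By symmetry `∫ g n * g' n = ‖g n‖²`, so these squared norms tend to `g₀`. By (KP₄) the kernel `g n`
is `L²`-close to half the indicator of `{g n > 1/4}`, that is, to half the adjacency kernel of a
graph on `Z`, which may be replaced by a graph on finitely many cells. By (KR⋆) the integral of its
squared degrees vanishes in the limit, and its mean number of edges tends to `2 * g₀`
(`exists_graph_sequence`). The `L²` bound for double integrals transfers the problem to these graphs
(`IsPoissonProcess.eLpNorm_poissonIntegral₂_sub_le`).

The double integral of half an adjacency kernel is the number `W` of joined pairs of points, minus
its mean `m`, minus a linear statistic whose variance is the integral of the squared degrees. By the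
Mecke formula `E[W e^{isW} h]` is an integral of `e^{isW} h` after the addition of two joined
points. These create one edge between them and, typically, no other, so `φ(s) = E[e^{isW} h]` nearly
solves `φ' = i m e^{is} φ`. The solution is the Poisson characteristic function times `E[h]`
(`norm_integral_exp_charlierPoly_sub_le`).

Here `h` may be any bounded function of the counts of a fixed partition. Each graph integral is
itself a function of such counts, so the variables `e^{itJ_n}` minus their limiting mean are
asymptotically orthogonal to each one of them. A Hilbert space argument of Rényi type then gives
weak convergence to zero in `L²(P)`, which is mixing (`IsPoissonProcess.tendsto_integral_exp_mul`).
Independence of `N` and `η` identifies the joint limit, and Lévy's continuity theorem in the plane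
concludes. -/

theorem poissonMeasure_singleton_succ_mul (r : ℝ≥0) (n : ℕ) :
    poissonMeasure r {n + 1} * (n + 1 : ℕ) = r * poissonMeasure r {n} := by
  rw [poissonMeasure_singleton, poissonMeasure_singleton,
    ← ENNReal.ofReal_natCast, ← ENNReal.ofReal_coe_nnreal,
    ← ENNReal.ofReal_mul (by positivity), ← ENNReal.ofReal_mul (by positivity)]
  congr 1
  rw [Nat.factorial_succ]
  push_cast
  field_simp
  ring

theorem integral_sub_sub_add {α : Type*} [MeasurableSpace α] {μ : Measure α} {u v w z : α → ℝ}
    (hu : Integrable u μ) (hv : Integrable v μ) (hw : Integrable w μ) (hz : Integrable z μ)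
    (b c d : ℝ) :
    ∫ x, (u x - b * v x - c * w x + d * z x) ∂μ =
      ∫ x, u x ∂μ - b * ∫ x, v x ∂μ - c * ∫ x, w x ∂μ + d * ∫ x, z x ∂μ := by
  have h1 : Integrable (fun x => u x - b * v x) μ := hu.sub (hv.const_mul b)
  have h2 : Integrable (fun x => u x - b * v x - c * w x) μ := h1.sub (hw.const_mul c)
  rw [integral_add h2 (hz.const_mul d), integral_sub h1 (hw.const_mul c),
    integral_sub hu (hv.const_mul b), integral_const_mul, integral_const_mul, integral_const_mul]

/-! ### Functions of polynomial growth under product Poisson laws. -/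

section PolyBdd

variable {κ : Type*} [Fintype κ]

/-- The law of a finite family of independent Poisson variables with means `p`. -/
noncomputable abbrev piPoisson (p : κ → ℝ≥0) : Measure (κ → ℕ) :=
  Measure.pi fun k => poissonMeasure (p k)

/-- Functions of at most polynomial growth. -/
def PolyBdd (f : (κ → ℕ) → ℝ) : Prop :=
  ∃ (C : ℝ) (j : ℕ), 0 ≤ C ∧ ∀ x, |f x| ≤ C * (1 + ∑ i, (x i : ℝ)) ^ j

theorem one_le_one_add_sum (x : κ → ℕ) : (1 : ℝ) ≤ 1 + ∑ i, (x i : ℝ) :=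
  le_add_of_nonneg_right (by positivity)

theorem PolyBdd.const (c : ℝ) : PolyBdd (fun _ : κ → ℕ => c) :=
  ⟨|c|, 0, abs_nonneg c, fun x => by simp⟩

theorem PolyBdd.coord (k : κ) : PolyBdd (fun x : κ → ℕ => (x k : ℝ)) := by
  refine ⟨1, 1, zero_le_one, fun x => ?_⟩
  have : (x k : ℝ) ≤ ∑ i, (x i : ℝ) :=
    Finset.single_le_sum (f := fun i => (x i : ℝ)) (fun _ _ => by positivity) (Finset.mem_univ k)
  rw [abs_of_nonneg (by positivity)]
  linarith

theorem PolyBdd.mul {f g : (κ → ℕ) → ℝ} (hf : PolyBdd f) (hg : PolyBdd g) :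
    PolyBdd (fun x => f x * g x) := by
  obtain ⟨C, j, hC, hf⟩ := hf
  obtain ⟨D, i, hD, hg⟩ := hg
  refine ⟨C * D, j + i, by positivity, fun x => ?_⟩
  rw [abs_mul, pow_add, mul_mul_mul_comm]
  exact mul_le_mul (hf x) (hg x) (abs_nonneg _) ((abs_nonneg _).trans (hf x))

theorem PolyBdd.add {f g : (κ → ℕ) → ℝ} (hf : PolyBdd f) (hg : PolyBdd g) :
    PolyBdd (fun x => f x + g x) := by
  obtain ⟨C, j, hC, hf⟩ := hf
  obtain ⟨D, i, hD, hg⟩ := hg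
  refine ⟨C + D, j + i, by positivity, fun x => (abs_add_le _ _).trans ?_⟩
  have h1 := one_le_one_add_sum x
  rw [add_mul]
  exact add_le_add
    ((hf x).trans (mul_le_mul_of_nonneg_left (pow_le_pow_right₀ h1 (by omega)) hC))
    ((hg x).trans (mul_le_mul_of_nonneg_left (pow_le_pow_right₀ h1 (by omega)) hD))

theorem PolyBdd.neg {f : (κ → ℕ) → ℝ} (hf : PolyBdd f) : PolyBdd (fun x => -f x) := by
  simpa using (PolyBdd.const (-1)).mul hf

theorem PolyBdd.sub {f g : (κ → ℕ) → ℝ} (hf : PolyBdd f) (hg : PolyBdd g) :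
    PolyBdd (fun x => f x - g x) := by
  simpa [sub_eq_add_neg] using hf.add hg.neg

theorem PolyBdd.sum {ι : Type*} (s : Finset ι) {f : ι → (κ → ℕ) → ℝ}
    (hf : ∀ i, PolyBdd (f i)) : PolyBdd (fun x => ∑ i ∈ s, f i x) := by
  classical
  induction s using Finset.induction_on with
  | empty => simpa using PolyBdd.const (κ := κ) 0
  | insert a s ha ih => simpa [Finset.sum_insert ha] using (hf a).add ih

/-- A power `y ^ j` is at most `j! * e ^ y`. With `y = 1 + ∑ x i` the bound factorises over the
coordinates, and Poisson laws have exponential moments. -/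
theorem PolyBdd.integrable {f : (κ → ℕ) → ℝ} (hf : PolyBdd f) (p : κ → ℝ≥0) :
    Integrable f (piPoisson p) := by
  obtain ⟨C, j, hC, hf⟩ := hf
  have hexp : Integrable (fun x : κ → ℕ => ∏ i, Real.exp (x i : ℝ)) (piPoisson p) := by
    refine Integrable.fintype_prod (μ := fun i => poissonMeasure (p i))
      (f := fun _ (n : ℕ) => Real.exp (n : ℝ)) fun i => ?_
    rw [integrable_poissonMeasure_iff]
    have := (Real.summable_pow_div_factorial ((p i : ℝ) * Real.exp 1)).mul_left
      (Real.exp (-(p i : ℝ)))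
    refine this.congr fun n => ?_
    rw [Real.norm_of_nonneg (Real.exp_pos _).le, mul_pow, ← Real.exp_nat_mul, mul_one]
    ring
  refine (hexp.const_mul (C * (j.factorial * Real.exp 1))).mono'
    StronglyMeasurable.of_discrete.aestronglyMeasurable (.of_forall fun x => ?_)
  have h1 := one_le_one_add_sum x
  have h2 := Real.pow_div_factorial_le_exp (1 + ∑ i, (x i : ℝ)) (by linarith) j
  rw [div_le_iff₀ (by positivity), Real.exp_add, Real.exp_sum] at h2
  rw [Real.norm_eq_abs, mul_assoc]
  exact (hf x).trans (mul_le_mul_of_nonneg_left (h2.trans (le_of_eq (by ring))) hC)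

theorem PolyBdd.integrable_smul {f : (κ → ℕ) → ℝ} (hf : PolyBdd f) (p : κ → ℝ≥0)
    {h : (κ → ℕ) → ℂ} {C : ℝ} (hC : ∀ x, ‖h x‖ ≤ C) :
    Integrable (fun x => f x • h x) (piPoisson p) := by
  refine ((hf.integrable p).norm.mul_const C).mono'
    StronglyMeasurable.of_discrete.aestronglyMeasurable (.of_forall fun x => ?_)
  rw [norm_smul]
  exact mul_le_mul_of_nonneg_left (hC x) (norm_nonneg _)

end PolyBdd

/-! ### The Mecke formula and second Charlier polynomials for finitely many cells. -/

section FiniteDim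

variable {κ : Type*} [Fintype κ] [DecidableEq κ]

/-- The Mecke formula on finitely many cells: weighting by the count of a cell amounts to adding a
point to it. On singletons this is the recursion of the Poisson weights, and both sides vanish where
`x k = 0`. -/
theorem piPoisson_withDensity_coord (p : κ → ℝ≥0) (k : κ) :
    (piPoisson p).withDensity (fun x => ((x k : ℝ≥0) : ℝ≥0∞)) =
      (p k : ℝ≥0∞) • (piPoisson p).map (fun x => x + Pi.single k 1) := by
  refine Measure.ext_of_singleton fun x => ?_
  rw [withDensity_apply _ (measurableSet_singleton x), lintegral_singleton,
    Measure.smul_apply, Measure.map_apply (measurable_of_countable _) (measurableSet_singleton x)]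
  rcases Nat.eq_zero_or_pos (x k) with h0 | hpos
  · have : (fun y : κ → ℕ => y + Pi.single k 1) ⁻¹' {x} = ∅ := by
      ext y
      simp only [Set.mem_preimage, Set.mem_singleton_iff, Set.mem_empty_iff_false, iff_false]
      rintro rfl
      simp at h0
    simp [this, h0]
  · set y : κ → ℕ := x - Pi.single k 1 with hy
    have hxy : x = y + Pi.single k 1 := by
      funext i
      by_cases hi : i = k
      · subst hi; simp [hy]; omega
      · simp [hy, hi]
    have hpre : (fun y : κ → ℕ => y + Pi.single k 1) ⁻¹' {x} = {y} := by
      ext z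
      simp only [Set.mem_preimage, Set.mem_singleton_iff]
      rw [hxy]
      exact add_left_inj _
    rw [hpre, Measure.pi_singleton, Measure.pi_singleton,
      Fintype.prod_eq_mul_prod_compl k, Fintype.prod_eq_mul_prod_compl k]
    have h1 : x k = y k + 1 := by rw [hxy]; simp
    have h2 : ∏ i ∈ {k}ᶜ, poissonMeasure (p i) {x i} =
        ∏ i ∈ {k}ᶜ, poissonMeasure (p i) {y i} := by
      refine Finset.prod_congr rfl fun i hi => ?_
      have : i ≠ k := by simpa using hi
      rw [hxy]; simp [this]
    rw [h2, h1, smul_eq_mul, ← mul_assoc (p k : ℝ≥0∞), ← poissonMeasure_singleton_succ_mul]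
    simp only [ENNReal.coe_natCast]
    ring

theorem integral_coord_smul {E : Type*} [NormedAddCommGroup E] [NormedSpace ℝ E]
    (p : κ → ℝ≥0) (k : κ) (f : (κ → ℕ) → E) :
    ∫ x, (x k : ℝ) • f x ∂(piPoisson p) =
      (p k : ℝ) • ∫ x, f (x + Pi.single k 1) ∂(piPoisson p) := by
  have h := integral_withDensity_eq_integral_smul (μ := piPoisson p)
    (f := fun x => (x k : ℝ≥0)) (measurable_of_countable _) f
  rw [piPoisson_withDensity_coord, integral_smul_measure,
    integral_map (measurable_of_countable _).aemeasurable
      StronglyMeasurable.of_discrete.aestronglyMeasurable] at h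
  simpa [NNReal.smul_def] using h.symm

/-- Two applications of the Mecke formula. Write the polynomial as `x k * (x l - δ)` with `δ` the
Kronecker symbol; the point added at `k` raises `x l` by exactly `δ`, which leaves `x l` for the
second application. -/
theorem integral_factorial_smul {E : Type*} [NormedAddCommGroup E] [NormedSpace ℝ E]
    (p : κ → ℝ≥0) (k l : κ) (f : (κ → ℕ) → E) :
    ∫ x, ((x k : ℝ) * x l - if k = l then (x k : ℝ) else 0) • f x ∂(piPoisson p) =
      ((p k : ℝ) * p l) •
        ∫ x, f (x + Pi.single k 1 + Pi.single l 1) ∂(piPoisson p) := by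
  have h1 : ∀ x : κ → ℕ, ((x k : ℝ) * x l - if k = l then (x k : ℝ) else 0) • f x =
      (x k : ℝ) • (((x l : ℝ) - if k = l then 1 else 0) • f x) := by
    intro x
    rw [smul_smul]
    congr 1
    split_ifs <;> ring
  simp_rw [h1]
  rw [integral_coord_smul, mul_smul]
  congr 1
  have h2 := integral_coord_smul p l (fun x => f (x + Pi.single k 1))
  have h3 : ∀ x : κ → ℕ, x + Pi.single l 1 + Pi.single k 1 =
      x + Pi.single k 1 + Pi.single l 1 := fun x => add_right_comm _ _ _
  simp_rw [h3] at h2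
  rw [← h2]
  refine integral_congr_ae (.of_forall fun x => ?_)
  by_cases hkl : k = l
  · subst hkl; simp
  · simp [hkl, Ne.symm hkl]

theorem PolyBdd.shift {f : (κ → ℕ) → ℝ} (hf : PolyBdd f) (k : κ) :
    PolyBdd (fun x => f (x + Pi.single k 1)) := by
  obtain ⟨C, j, hC, hf⟩ := hf
  refine ⟨C * 2 ^ j, j, by positivity, fun x => (hf _).trans ?_⟩
  rw [mul_assoc, ← mul_pow]
  refine mul_le_mul_of_nonneg_left (pow_le_pow_left₀ (by positivity) ?_ j) hC
  have h1 := one_le_one_add_sum x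
  have : ∑ i, ((x + Pi.single k 1 : κ → ℕ) i : ℝ) = ∑ i, (x i : ℝ) + 1 := by
    simp [Finset.sum_add_distrib, Pi.single_apply]
  rw [this]; linarith

/-- The second factorial polynomial `∑ a k l (x k x l - δ k l x k)`. -/
def factorialPoly (a : κ → κ → ℝ) (x : κ → ℕ) : ℝ :=
  ∑ k, ∑ l, a k l * ((x k : ℝ) * x l - if k = l then (x k : ℝ) else 0)

/-- The second Charlier polynomial, i.e. the double Poisson integral of a step function. -/
def charlierPoly (p : κ → ℝ≥0) (a : κ → κ → ℝ) (x : κ → ℕ) : ℝ :=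
  ∑ k, ∑ l, a k l * (((x k : ℝ) * x l - if k = l then (x k : ℝ) else 0)
    - x k * p l - x l * p k + p k * p l)

theorem PolyBdd.factorial (k l : κ) :
    PolyBdd (fun x : κ → ℕ => (x k : ℝ) * x l - if k = l then (x k : ℝ) else 0) := by
  refine ((PolyBdd.coord k).mul (PolyBdd.coord l)).sub ?_
  split_ifs
  · exact PolyBdd.coord k
  · exact PolyBdd.const 0

theorem PolyBdd.factorialPoly (a : κ → κ → ℝ) : PolyBdd (factorialPoly a) :=
  PolyBdd.sum _ fun k => PolyBdd.sum _ fun l => (PolyBdd.const _).mul (PolyBdd.factorial k l)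

theorem PolyBdd.charlierPoly (p : κ → ℝ≥0) (a : κ → κ → ℝ) : PolyBdd (charlierPoly p a) :=
  PolyBdd.sum _ fun k => PolyBdd.sum _ fun l => (PolyBdd.const _).mul
    ((((PolyBdd.factorial k l).sub ((PolyBdd.coord k).mul (PolyBdd.const _))).sub
      ((PolyBdd.coord l).mul (PolyBdd.const _))).add (PolyBdd.const _))

/-- A new point forms ordered pairs with the points already present; the diagonal correction removes
the pair it would form with itself. -/
theorem factorialPoly_shift (a : κ → κ → ℝ) (x : κ → ℕ) (j : κ) :
    factorialPoly a (x + Pi.single j 1) - factorialPoly a x = ∑ l, (a j l + a l j) * x l := by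
  have h : ∀ k l, a k l * (((x + Pi.single j 1 : κ → ℕ) k : ℝ) * ((x + Pi.single j 1 : κ → ℕ) l : ℝ)
        - if k = l then ((x + Pi.single j 1 : κ → ℕ) k : ℝ) else 0)
      - a k l * ((x k : ℝ) * x l - if k = l then (x k : ℝ) else 0)
      = (if k = j then a k l * x l else 0) + (if l = j then a k l * x k else 0) := by
    intro k l
    by_cases h1 : k = l
    · subst h1
      by_cases h2 : k = j
      · subst h2; simp; ring
      · simp [h2]
    · by_cases h2 : k = j
      · subst h2
        simp [Ne.symm h1, h1]; ring
      · by_cases h3 : l = j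
        · subst h3; simp [h1]; ring
        · simp [h1, h2, h3]
  simp only [factorialPoly]
  rw [← Finset.sum_sub_distrib]
  simp_rw [← Finset.sum_sub_distrib, h, Finset.sum_add_distrib]
  rw [Finset.sum_comm]
  simp [Finset.sum_add_distrib, add_mul]

theorem charlierPoly_eq (p : κ → ℝ≥0) (a : κ → κ → ℝ) (x : κ → ℕ) :
    charlierPoly p a x = factorialPoly a x - ∑ k, (∑ l, (a k l + a l k) * p l) * x k
      + ∑ k, ∑ l, a k l * p k * p l := by
  have h : ∑ k, (∑ l, (a k l + a l k) * p l) * (x k : ℝ) =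
      ∑ k, ∑ l, a k l * (x k * p l) + ∑ k, ∑ l, a k l * (x l * p k) := by
    rw [Finset.sum_comm (f := fun k l => a k l * ((x l : ℝ) * p k)), ← Finset.sum_add_distrib]
    refine Finset.sum_congr rfl fun k _ => ?_
    rw [Finset.sum_mul, ← Finset.sum_add_distrib]
    exact Finset.sum_congr rfl fun l _ => by ring
  rw [h, charlierPoly, factorialPoly, ← Finset.sum_add_distrib, ← Finset.sum_sub_distrib,
    ← Finset.sum_add_distrib]
  refine Finset.sum_congr rfl fun k _ => ?_
  rw [← Finset.sum_add_distrib, ← Finset.sum_sub_distrib, ← Finset.sum_add_distrib]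
  exact Finset.sum_congr rfl fun l _ => by ring

/-- Second differences kill the affine compensation, and only the two ordered pairs formed by the
added points survive. -/
theorem charlierPoly_shift_shift (p : κ → ℝ≥0) (a : κ → κ → ℝ) (x : κ → ℕ) (i j : κ) :
    charlierPoly p a (x + Pi.single i 1 + Pi.single j 1) - charlierPoly p a (x + Pi.single i 1)
      - charlierPoly p a (x + Pi.single j 1) + charlierPoly p a x = a i j + a j i := by
  have h1 := factorialPoly_shift a (x + Pi.single i 1) j
  have h2 := factorialPoly_shift a x j
  have h3 : ∀ (c : κ → ℝ) (y : κ → ℕ) (m : κ),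
      ∑ k, c k * ((y + Pi.single m 1 : κ → ℕ) k : ℝ) = ∑ k, c k * y k + c m := by
    intro c y m
    simp [mul_add, Finset.sum_add_distrib, Pi.single_apply]
  rw [h3] at h1
  simp only [charlierPoly_eq, h3]
  linarith

/-- Integration by parts for the second Charlier polynomial. -/
theorem integral_charlierPoly_mul (p : κ → ℝ≥0) (a : κ → κ → ℝ) {f : (κ → ℕ) → ℝ}
    (hf : PolyBdd f) :
    ∫ x, charlierPoly p a x * f x ∂(piPoisson p) =
      ∑ k, ∑ l, a k l * (p k * p l * ∫ x, (f (x + Pi.single k 1 + Pi.single l 1)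
        - f (x + Pi.single k 1) - f (x + Pi.single l 1) + f x) ∂(piPoisson p)) := by
  have hI : ∀ k l, Integrable (fun x : κ → ℕ => a k l * ((((x k : ℝ) * x l
      - if k = l then (x k : ℝ) else 0) - x k * p l - x l * p k + p k * p l) * f x))
      (piPoisson p) := by
    intro k l
    refine PolyBdd.integrable ((PolyBdd.const _).mul (PolyBdd.mul ?_ hf)) p
    exact (((PolyBdd.factorial k l).sub ((PolyBdd.coord k).mul (PolyBdd.const _))).sub
      ((PolyBdd.coord l).mul (PolyBdd.const _))).add (PolyBdd.const _)
  simp only [charlierPoly, Finset.sum_mul]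
  simp only [← mul_assoc] at hI
  rw [integral_finsetSum _ fun k _ => integrable_finsetSum _ fun l _ => hI k l]
  refine Finset.sum_congr rfl fun k _ => ?_
  rw [integral_finsetSum _ fun l _ => hI k l]
  refine Finset.sum_congr rfl fun l _ => ?_
  simp_rw [mul_assoc (a k l)]
  rw [integral_const_mul]
  congr 1
  have e1 := integral_factorial_smul p k l f
  have e2 := integral_coord_smul p k f
  have e3 := integral_coord_smul p l f
  simp only [smul_eq_mul] at e1 e2 e3
  have i1 := ((PolyBdd.factorial k l).mul hf).integrable p
  have i2 := ((PolyBdd.coord k).mul hf).integrable p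
  have i3 := ((PolyBdd.coord l).mul hf).integrable p
  have i4 := hf.integrable p
  have j1 := ((hf.shift l).shift k).integrable p
  have j2 := (hf.shift k).integrable p
  have j3 := (hf.shift l).integrable p
  have : ∀ x : κ → ℕ, (((x k : ℝ) * x l - if k = l then (x k : ℝ) else 0)
      - x k * p l - x l * p k + p k * p l) * f x =
      (((x k : ℝ) * x l - if k = l then (x k : ℝ) else 0) * f x) - p l * (x k * f x)
        - p k * (x l * f x) + p k * p l * f x := fun x => by ring
  simp_rw [this]
  rw [integral_sub_sub_add i1 i2 i3 i4]
  have hsh := integral_sub_sub_add j1 j2 j3 i4 1 1 1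
  simp only [one_mul] at hsh
  rw [hsh, e1, e2, e3]
  ring

/-- Integration by parts against the polynomial itself leaves its constant second difference `a k l
+ a l k`. Since `a` need not be symmetric, the cross terms are bounded by `2uv ≤ u² + v²`. This is
the `L²` estimate on which the extension of the double integral rests. -/
theorem integral_charlierPoly_sq_le (p : κ → ℝ≥0) (a : κ → κ → ℝ) :
    ∫ x, charlierPoly p a x ^ 2 ∂(piPoisson p) ≤ 2 * ∑ k, ∑ l, a k l ^ 2 * (p k * p l) := by
  simp_rw [sq (charlierPoly p a _)]
  rw [integral_charlierPoly_mul p a (PolyBdd.charlierPoly p a)]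
  simp_rw [charlierPoly_shift_shift, integral_const]
  simp only [probReal_univ, one_smul]
  have hswap : ∑ k, ∑ l, a k l ^ 2 * ((p k : ℝ) * p l) =
      ∑ k, ∑ l, a l k ^ 2 * ((p k : ℝ) * p l) := by
    rw [Finset.sum_comm]
    exact Finset.sum_congr rfl fun k _ => Finset.sum_congr rfl fun l _ => by ring
  have key : ∀ k l, a k l * ((p k : ℝ) * p l * (a k l + a l k)) ≤
      3 / 2 * (a k l ^ 2 * (p k * p l)) + 1 / 2 * (a l k ^ 2 * (p k * p l)) := by
    intro k l
    have h1 : 0 ≤ (p k : ℝ) * p l := by positivity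
    nlinarith [mul_nonneg h1 (sq_nonneg (a k l - a l k))]
  calc _ ≤ ∑ k, ∑ l, (3 / 2 * (a k l ^ 2 * ((p k : ℝ) * p l))
        + 1 / 2 * (a l k ^ 2 * ((p k : ℝ) * p l))) :=
        Finset.sum_le_sum fun k _ => Finset.sum_le_sum fun l _ => key k l
    _ = 3 / 2 * ∑ k, ∑ l, a k l ^ 2 * ((p k : ℝ) * p l)
        + 1 / 2 * ∑ k, ∑ l, a l k ^ 2 * ((p k : ℝ) * p l) := by
        simp_rw [Finset.sum_add_distrib, Finset.mul_sum]
    _ = _ := by rw [← hswap]; ring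

end FiniteDim

/-! ### Characteristic functions on the cells: differentiation and notation. -/

section CharFun

variable {κ : Type*} [Fintype κ]

theorem norm_exp_I_mul_ofReal (y : ℝ) : ‖Complex.exp (Complex.I * (y : ℂ))‖ = 1 := by
  rw [mul_comm]; exact Complex.norm_exp_ofReal_mul_I y

theorem hasDerivAt_integral_exp_mul {p : κ → ℝ≥0} {W : (κ → ℕ) → ℝ} (hW : PolyBdd W)
    {h : (κ → ℕ) → ℂ} {C : ℝ} (hC : ∀ x, ‖h x‖ ≤ C) (s : ℝ) :
    HasDerivAt (fun s : ℝ => ∫ x, Complex.exp (Complex.I * ((s * W x : ℝ) : ℂ)) * h x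
      ∂(piPoisson p))
      (∫ x, W x • (Complex.I * (Complex.exp (Complex.I * ((s * W x : ℝ) : ℂ)) * h x))
        ∂(piPoisson p)) s := by
  have hC0 : 0 ≤ C := (norm_nonneg _).trans (hC 0)
  refine (hasDerivAt_integral_of_dominated_loc_of_deriv_le (μ := piPoisson p) (𝕜 := ℝ)
    (F := fun (s : ℝ) x => Complex.exp (Complex.I * ((s * W x : ℝ) : ℂ)) * h x)
    (F' := fun (s : ℝ) x =>
      W x • (Complex.I * (Complex.exp (Complex.I * ((s * W x : ℝ) : ℂ)) * h x)))
    (bound := fun x => |W x| * C) (s := Set.univ) (x₀ := s) univ_mem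
    (.of_forall fun s => StronglyMeasurable.of_discrete.aestronglyMeasurable)
    ?_ StronglyMeasurable.of_discrete.aestronglyMeasurable ?_ ((hW.integrable p).abs.mul_const C)
    ?_).2
  · refine (integrable_const C).mono' StronglyMeasurable.of_discrete.aestronglyMeasurable
      (.of_forall fun x => ?_)
    rw [norm_mul, norm_exp_I_mul_ofReal, one_mul]
    exact hC x
  · refine .of_forall fun x s _ => ?_
    rw [norm_smul, norm_mul, norm_mul, norm_exp_I_mul_ofReal, Complex.norm_I, one_mul, one_mul,
      Real.norm_eq_abs]
    exact mul_le_mul_of_nonneg_left (hC x) (abs_nonneg _)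
  · refine .of_forall fun x s _ => ?_
    have h1 : HasDerivAt (fun s : ℝ => Complex.I * ((s * W x : ℝ) : ℂ))
        (Complex.I * (W x : ℂ)) s := by
      have := ((hasDerivAt_id s).mul_const (W x)).ofReal_comp.const_mul Complex.I
      simpa using this
    convert! (h1.cexp.mul_const (h x)) using 1
    rw [Complex.real_smul]
    ring

/-- The half-sum `∑_{k,l} b k l p k p l / 2`: the mean of the edge count. -/
noncomputable def edgeMean (p : κ → ℝ≥0) (b : κ → κ → ℝ) : ℝ := (∑ k, ∑ l, b k l * p k * p l) / 2

/-- The mean degree of a point in the cell `k`. -/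
noncomputable def degreeMean (p : κ → ℝ≥0) (b : κ → κ → ℝ) (k : κ) : ℝ := ∑ l, b k l * p l

end CharFun

/-! ### Poisson approximation of the edge count of a sparse graph. -/

section CharFun

variable {κ : Type*} [Fintype κ] [DecidableEq κ]

theorem integral_coord (p : κ → ℝ≥0) (k : κ) : ∫ x, (x k : ℝ) ∂(piPoisson p) = p k := by
  simpa using integral_coord_smul p k (fun _ => (1 : ℝ))

/-- For symmetric `b` the quantity `factorialPoly b x / 2` is the number of edges. Two added points
contribute the edge between them, and the edges from each of them to the old points. -/
theorem factorialPoly_half_shift_shift {b : κ → κ → ℝ} (hs : ∀ k l, b k l = b l k)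
    (x : κ → ℕ) (k l : κ) :
    factorialPoly b (x + Pi.single k 1 + Pi.single l 1) / 2 =
      factorialPoly b x / 2 + b k l + (∑ j, b k j * x j + ∑ j, b l j * x j) := by
  have h1 := factorialPoly_shift b (x + Pi.single k 1) l
  have h2 := factorialPoly_shift b x k
  have h3 : ∀ (j : κ) (y : κ → ℕ), ∑ i, (b j i + b i j) * (y i : ℝ) = 2 * ∑ i, b j i * y i := by
    intro j y
    rw [Finset.mul_sum]
    exact Finset.sum_congr rfl fun i _ => by rw [hs i j]; ring
  have h4 : ∑ i, b l i * ((x + Pi.single k 1 : κ → ℕ) i : ℝ) = ∑ i, b l i * x i + b l k := by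
    simp [mul_add, Finset.sum_add_distrib, Pi.single_apply]
  rw [h3, h4] at h1
  rw [h3] at h2
  rw [hs k l]
  linarith

/-- Points added to two joined cells raise the edge count by `1 + V`, where `V` counts the edges to
old points. The `1` gives the factor `e^{is}`, and dropping `V` costs `|s| V`. Undoing the shift of
`h` costs at most `2C`, and nothing if neither cell lies in `T`. -/
theorem norm_shift_shift_sub_le {b : κ → κ → ℝ} (hs : ∀ k l, b k l = b l k)
    (hb : ∀ k l, 0 ≤ b k l) {h : (κ → ℕ) → ℂ} {C : ℝ} (hC : ∀ x, ‖h x‖ ≤ C) {T : Finset κ}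
    (hT : ∀ k ∉ T, ∀ x, h (x + Pi.single k 1) = h x) (s : ℝ) (x : κ → ℕ) {k l : κ}
    (hkl : b k l = 1) :
    ‖Complex.exp (Complex.I *
          ((s * (factorialPoly b (x + Pi.single k 1 + Pi.single l 1) / 2) : ℝ) : ℂ))
          * h (x + Pi.single k 1 + Pi.single l 1)
        - Complex.exp (Complex.I * s) *
          (Complex.exp (Complex.I * ((s * (factorialPoly b x / 2) : ℝ) : ℂ)) * h x)‖
      ≤ C * |s| * (∑ j, b k j * x j + ∑ j, b l j * x j)
        + 2 * C * ((if k ∈ T then 1 else 0) + if l ∈ T then 1 else 0) := by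
  have hC0 : 0 ≤ C := (norm_nonneg _).trans (hC 0)
  set V : ℝ := ∑ j, b k j * x j + ∑ j, b l j * x j with hV
  have hV0 : 0 ≤ V := add_nonneg (Finset.sum_nonneg fun j _ => mul_nonneg (hb _ _) (by positivity))
    (Finset.sum_nonneg fun j _ => mul_nonneg (hb _ _) (by positivity))
  set h' := h (x + Pi.single k 1 + Pi.single l 1) with hh'
  set u := Complex.exp (Complex.I * s) * Complex.exp (Complex.I *
    ((s * (factorialPoly b x / 2) : ℝ) : ℂ)) with hu
  have hun : ‖u‖ = 1 := by rw [hu, norm_mul, norm_exp_I_mul_ofReal, norm_exp_I_mul_ofReal, one_mul]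
  have h1 : Complex.exp (Complex.I *
      ((s * (factorialPoly b (x + Pi.single k 1 + Pi.single l 1) / 2) : ℝ) : ℂ)) =
      u * Complex.exp (Complex.I * ((s * V : ℝ) : ℂ)) := by
    rw [factorialPoly_half_shift_shift hs, hkl, hu, ← Complex.exp_add, ← Complex.exp_add, ← hV]
    congr 1
    push_cast
    ring
  have h2 : u * Complex.exp (Complex.I * ((s * V : ℝ) : ℂ)) * h' -
      Complex.exp (Complex.I * s) *
          (Complex.exp (Complex.I * ((s * (factorialPoly b x / 2) : ℝ) : ℂ)) * h x) =
      u * ((Complex.exp (Complex.I * ((s * V : ℝ) : ℂ)) - 1) * h') + u * (h' - h x) := by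
    rw [hu]; ring
  rw [h1, h2]
  clear_value u
  refine (norm_add_le _ _).trans (add_le_add ?_ ?_)
  · rw [norm_mul, norm_mul, hun, one_mul]
    have h3 : ‖Complex.exp (Complex.I * ((s * V : ℝ) : ℂ)) - 1‖ ≤ |s| * V := by
      refine Real.norm_exp_I_mul_ofReal_sub_one_le.trans ?_
      rw [Real.norm_eq_abs, abs_mul, abs_of_nonneg hV0]
    calc _ ≤ |s| * V * C := mul_le_mul h3 (hC _) (norm_nonneg _) (by positivity)
      _ = _ := by ring
  · rw [norm_mul, hun, one_mul]
    by_cases hk : k ∈ T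
    · refine (norm_sub_le _ _).trans ?_
      have := hC x
      have := hC (x + Pi.single k 1 + Pi.single l 1)
      rw [if_pos hk]
      split_ifs <;> linarith
    · by_cases hl : l ∈ T
      · refine (norm_sub_le _ _).trans ?_
        have := hC x
        have := hC (x + Pi.single k 1 + Pi.single l 1)
        rw [if_pos hl, if_neg hk]
        linarith
      · rw [hh', hT l hl, hT k hk, sub_self, norm_zero]
        positivity

/-- The approximate differential equation `φ' ≈ i m e^{is} φ`. The Mecke formula replaces the edge
count under the integral by two added points, and the preceding comparison is averaged: the number
of edges from a point of cell `k` to the old points has mean `degreeMean p b k`. -/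
theorem norm_deriv_sub_le {p : κ → ℝ≥0} {b : κ → κ → ℝ} (hs : ∀ k l, b k l = b l k)
    (hb : ∀ k l, b k l = 0 ∨ b k l = 1) {h : (κ → ℕ) → ℂ} {C : ℝ} (hC : ∀ x, ‖h x‖ ≤ C)
    {T : Finset κ} (hT : ∀ k ∉ T, ∀ x, h (x + Pi.single k 1) = h x) (s : ℝ) :
    ‖∫ x, (factorialPoly b x / 2) • (Complex.I * (Complex.exp (Complex.I *
          ((s * (factorialPoly b x / 2) : ℝ) : ℂ)) * h x)) ∂(piPoisson p)
      - Complex.I * edgeMean p b * Complex.exp (Complex.I * s) *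
        ∫ x, Complex.exp (Complex.I * ((s * (factorialPoly b x / 2) : ℝ) : ℂ)) * h x
          ∂(piPoisson p)‖
      ≤ C * |s| * ∑ k, p k * degreeMean p b k ^ 2 + 2 * C * ∑ k ∈ T, p k * degreeMean p b k := by
  have hC0 : 0 ≤ C := (norm_nonneg _).trans (hC 0)
  have hb0 : ∀ k l, 0 ≤ b k l := fun k l => by rcases hb k l with h | h <;> simp [h]
  set G : (κ → ℕ) → ℂ := fun x =>
    Complex.exp (Complex.I * ((s * (factorialPoly b x / 2) : ℝ) : ℂ)) * h x with hG
  have hGC : ∀ x, ‖G x‖ ≤ C := fun x => by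
    rw [hG]; simp only; rw [norm_mul, norm_exp_I_mul_ofReal, one_mul]; exact hC x
  have hint : ∀ f : (κ → ℕ) → ℂ, (∀ x, ‖f x‖ ≤ C) → Integrable f (piPoisson p) := fun f hf =>
    (integrable_const C).mono' StronglyMeasurable.of_discrete.aestronglyMeasurable (.of_forall hf)
  have e1 : ∫ x, (factorialPoly b x / 2) • (Complex.I * G x) ∂(piPoisson p) =
      ∑ k, ∑ l, (b k l * p k * p l / 2) • (Complex.I *
        ∫ x, G (x + Pi.single k 1 + Pi.single l 1) ∂(piPoisson p)) := by
    have e2 : ∀ x, (factorialPoly b x / 2) • (Complex.I * G x) = ∑ k, ∑ l,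
        (b k l / 2) • (((x k : ℝ) * x l - if k = l then (x k : ℝ) else 0) • (Complex.I * G x)) := by
      intro x
      simp_rw [smul_smul, ← Finset.sum_smul]
      congr 1
      rw [factorialPoly, Finset.sum_div]
      refine Finset.sum_congr rfl fun k _ => ?_
      rw [Finset.sum_div]
      exact Finset.sum_congr rfl fun l _ => by ring
    simp_rw [e2]
    have hI : ∀ k l, Integrable (fun x : κ → ℕ => (b k l / 2) •
        (((x k : ℝ) * x l - if k = l then (x k : ℝ) else 0) • (Complex.I * G x)))
        (piPoisson p) := fun k l => by
      refine ((PolyBdd.factorial k l).integrable_smul p (C := C) fun x => ?_).smul (b k l / 2)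
      rw [norm_mul, Complex.norm_I, one_mul]
      exact hGC x
    rw [integral_finsetSum _ fun k _ => integrable_finsetSum _ fun l _ => hI k l]
    refine Finset.sum_congr rfl fun k _ => ?_
    rw [integral_finsetSum _ fun l _ => hI k l]
    refine Finset.sum_congr rfl fun l _ => ?_
    rw [integral_smul, integral_factorial_smul p k l (fun x => Complex.I * G x), smul_smul,
      integral_const_mul]
    congr 1
    ring
  have e3 : Complex.I * edgeMean p b * Complex.exp (Complex.I * s) * ∫ x, G x ∂(piPoisson p) =
      ∑ k, ∑ l, (b k l * p k * p l / 2) • (Complex.I *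
        ∫ x, Complex.exp (Complex.I * s) * G x ∂(piPoisson p)) := by
    simp_rw [← Finset.sum_smul]
    rw [integral_const_mul, edgeMean, Finset.sum_div, Complex.real_smul]
    simp_rw [Finset.sum_div]
    ring
  have hV : ∀ k, Integrable (fun x : κ → ℕ => ∑ j, b k j * (x j : ℝ)) (piPoisson p) := fun k =>
    (PolyBdd.sum _ fun j => (PolyBdd.const _).mul (PolyBdd.coord j)).integrable p
  have hVd : ∀ k, ∫ x, ∑ j, b k j * (x j : ℝ) ∂(piPoisson p) = degreeMean p b k := fun k => by
    rw [integral_finsetSum _ fun j _ => ((PolyBdd.const _).mul (PolyBdd.coord j)).integrable p]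
    exact Finset.sum_congr rfl fun j _ => by rw [integral_const_mul, integral_coord]
  have key : ∀ k l, ‖(b k l * p k * p l / 2) • (Complex.I *
        ∫ x, G (x + Pi.single k 1 + Pi.single l 1) ∂(piPoisson p)) -
        (b k l * p k * p l / 2) • (Complex.I *
        ∫ x, Complex.exp (Complex.I * s) * G x ∂(piPoisson p))‖ ≤
      (b k l * p k * p l / 2) * (C * |s| * (degreeMean p b k + degreeMean p b l)
        + 2 * C * ((if k ∈ T then 1 else 0) + if l ∈ T then 1 else 0)) := by
    intro k l
    rcases hb k l with hkl | hkl
    · simp [hkl]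
    · rw [← smul_sub, ← mul_sub, ← integral_sub, norm_smul, norm_mul, Complex.norm_I, one_mul,
        Real.norm_of_nonneg (by rw [hkl]; positivity)]
      · refine mul_le_mul_of_nonneg_left ?_ (by rw [hkl]; positivity)
        refine (norm_integral_le_integral_norm _).trans ?_
        have : C * |s| * (degreeMean p b k + degreeMean p b l)
            + 2 * C * ((if k ∈ T then 1 else 0) + if l ∈ T then 1 else 0) =
            ∫ x, (C * |s| * (∑ j, b k j * (x j : ℝ) + ∑ j, b l j * x j)
        + 2 * C * ((if k ∈ T then 1 else 0) + if l ∈ T then 1 else 0)) ∂(piPoisson p) := by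
          have hVV : Integrable (fun x : κ → ℕ => ∑ j, b k j * (x j : ℝ) + ∑ j, b l j * x j)
            (piPoisson p) := (hV k).add (hV l)
          rw [integral_add (hVV.const_mul _) (integrable_const _),
            integral_const_mul, integral_add (hV k) (hV l), hVd, hVd]
          simp
        rw [this]
        refine integral_mono_of_nonneg (.of_forall fun x => norm_nonneg _)
          ((((hV k).add (hV l)).const_mul _).add (integrable_const _)) (.of_forall fun x => ?_)
        exact norm_shift_shift_sub_le hs hb0 hC hT s x hkl
      · exact hint _ fun x => hGC _
      · refine hint _ fun x => ?_
        rw [norm_mul, norm_exp_I_mul_ofReal, one_mul]; exact hGC x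
  change ‖∫ x, (factorialPoly b x / 2) • (Complex.I * G x) ∂(piPoisson p) -
    Complex.I * edgeMean p b * Complex.exp (Complex.I * s) * ∫ x, G x ∂(piPoisson p)‖ ≤ _
  rw [e1, e3, ← Finset.sum_sub_distrib]
  simp_rw [← Finset.sum_sub_distrib]
  refine (norm_sum_le _ _).trans ((Finset.sum_le_sum fun k _ => (norm_sum_le _ _).trans
    (Finset.sum_le_sum fun l _ => key k l)).trans (le_of_eq ?_))
  -- The error splits into a share `c k` for each end of an edge. By symmetry of `b` both ends
  -- contribute equally, which absorbs the factor `1 / 2`.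
  set c : κ → ℝ := fun k => C * |s| * degreeMean p b k + 2 * C * (if k ∈ T then 1 else 0) with hc
  have e4 : ∀ k l, (b k l * p k * p l / 2) * (C * |s| * (degreeMean p b k + degreeMean p b l)
        + 2 * C * ((if k ∈ T then 1 else 0) + if l ∈ T then 1 else 0)) =
      b k l * p k * p l / 2 * c k + b l k * p l * p k / 2 * c l := fun k l => by
    rw [hs l k, hc]; ring
  simp_rw [e4, Finset.sum_add_distrib]
  rw [Finset.sum_comm (f := fun k l => b l k * (p l : ℝ) * p k / 2 * c l), ← two_mul,
    Finset.mul_sum]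
  have e5 : ∀ k, 2 * ∑ l, b k l * (p k : ℝ) * p l / 2 * c k = p k * degreeMean p b k * c k := by
    intro k
    rw [degreeMean, Finset.mul_sum, Finset.mul_sum, Finset.sum_mul]
    exact Finset.sum_congr rfl fun l _ => by ring
  simp_rw [e5, hc, mul_add, Finset.sum_add_distrib]
  congr 1
  · rw [Finset.mul_sum]; exact Finset.sum_congr rfl fun k _ => by ring
  · rw [Finset.mul_sum, ← Finset.sum_filter_add_sum_filter_not Finset.univ (· ∈ T)]
    rw [Finset.sum_eq_zero (s := Finset.univ.filter (· ∉ T))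
      (fun k hk => by simp [(Finset.mem_filter.1 hk).2]), add_zero]
    rw [Finset.filter_univ_mem]
    exact Finset.sum_congr rfl fun k hk => by rw [if_pos hk]; ring

/-- Variation of constants with the integrating factor `exp (-m (e^{is} - 1))`. Its modulus is `exp
(m (1 - cos s)) ≤ exp (2m)`, while its inverse has modulus at most one, so that multiplying back
costs nothing. -/
theorem norm_integral_exp_factorialPoly_sub_le {p : κ → ℝ≥0} {b : κ → κ → ℝ}
    (hs : ∀ k l, b k l = b l k) (hb : ∀ k l, b k l = 0 ∨ b k l = 1)
    {h : (κ → ℕ) → ℂ} {C : ℝ} (hC : ∀ x, ‖h x‖ ≤ C)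
    {T : Finset κ} (hT : ∀ k ∉ T, ∀ x, h (x + Pi.single k 1) = h x) (t : ℝ) :
    ‖∫ x, Complex.exp (Complex.I * ((t * (factorialPoly b x / 2) : ℝ) : ℂ)) * h x ∂(piPoisson p)
      - Complex.exp (edgeMean p b * (Complex.exp (Complex.I * t) - 1)) * ∫ x, h x ∂(piPoisson p)‖
      ≤ (C * |t| * ∑ k, p k * degreeMean p b k ^ 2 + 2 * C * ∑ k ∈ T, p k * degreeMean p b k)
        * Real.exp (2 * edgeMean p b) * |t| := by
  have hC0 : 0 ≤ C := (norm_nonneg _).trans (hC 0)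
  have hb0 : ∀ k l, 0 ≤ b k l := fun k l => by rcases hb k l with h | h <;> simp [h]
  set m := edgeMean p b with hm
  have hm0 : 0 ≤ m := div_nonneg (Finset.sum_nonneg fun k _ => Finset.sum_nonneg fun l _ =>
    mul_nonneg (mul_nonneg (hb0 k l) (p k).2) (p l).2) zero_le_two
  have hd0 : ∀ k, 0 ≤ degreeMean p b k := fun k =>
    Finset.sum_nonneg fun l _ => mul_nonneg (hb0 k l) (p l).2
  set φ : ℝ → ℂ := fun s => ∫ x, Complex.exp (Complex.I *
    ((s * (factorialPoly b x / 2) : ℝ) : ℂ)) * h x ∂(piPoisson p) with hφ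
  set φ' : ℝ → ℂ := fun s => ∫ x, (factorialPoly b x / 2) • (Complex.I * (Complex.exp (Complex.I *
    ((s * (factorialPoly b x / 2) : ℝ) : ℂ)) * h x)) ∂(piPoisson p) with hφ'
  set e : ℝ → ℂ := fun s => Complex.exp (-(m * (Complex.exp (Complex.I * s) - 1))) with he
  have hW : PolyBdd (fun x : κ → ℕ => factorialPoly b x / 2) := by
    simpa [div_eq_mul_inv] using (PolyBdd.factorialPoly b).mul (PolyBdd.const (1 / 2))
  have hre : ∀ s : ℝ, (m * (Complex.exp (Complex.I * s) - 1)).re = m * (Real.cos s - 1) := by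
    intro s
    rw [mul_comm Complex.I, Complex.re_ofReal_mul, Complex.sub_re, Complex.exp_ofReal_mul_I_re,
      Complex.one_re]
  have hder : ∀ s : ℝ, HasDerivAt (fun s => φ s * e s)
      ((φ' s - Complex.I * m * Complex.exp (Complex.I * s) * φ s) * e s) s := by
    intro s
    have h1 : HasDerivAt φ (φ' s) s := hasDerivAt_integral_exp_mul hW hC s
    have h2 : HasDerivAt (fun s : ℝ => Complex.I * (s : ℂ)) Complex.I s := by
      simpa using (hasDerivAt_id s).ofReal_comp.const_mul Complex.I
    have h3 : HasDerivAt e _ s := ((h2.cexp.sub_const 1).const_mul (m : ℂ)).neg.cexp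
    convert! h1.mul h3 using 1
    simp only [he, Pi.neg_apply]
    ring
  set K := C * |t| * ∑ k, p k * degreeMean p b k ^ 2 + 2 * C * ∑ k ∈ T, p k * degreeMean p b k
  have hr0 : 0 ≤ ∑ k, (p k : ℝ) * degreeMean p b k ^ 2 :=
    Finset.sum_nonneg fun k _ => mul_nonneg (p k).2 (sq_nonneg _)
  have hT0 : 0 ≤ ∑ k ∈ T, (p k : ℝ) * degreeMean p b k :=
    Finset.sum_nonneg fun k _ => mul_nonneg (p k).2 (hd0 k)
  have hbound : ∀ s ∈ Set.uIcc 0 t,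
      ‖(φ' s - Complex.I * m * Complex.exp (Complex.I * s) * φ s) * e s‖ ≤
        K * Real.exp (2 * m) := by
    intro s hs'
    have hst : |s| ≤ |t| := by
      have := Set.abs_sub_left_of_mem_uIcc hs'
      simpa using this
    rw [norm_mul]
    refine mul_le_mul ((norm_deriv_sub_le hs hb hC hT s).trans ?_) ?_ (norm_nonneg _)
      (by positivity)
    · exact add_le_add_left (mul_le_mul_of_nonneg_right
        (mul_le_mul_of_nonneg_left hst hC0) hr0) _
    · rw [he, Complex.norm_exp, Complex.neg_re, hre, Real.exp_le_exp]
      nlinarith [Real.neg_one_le_cos s]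
  have hmv := Convex.norm_image_sub_le_of_norm_hasDerivWithin_le
    (fun s _ => (hder s).hasDerivWithinAt) hbound (convex_uIcc 0 t) Set.left_mem_uIcc
    Set.right_mem_uIcc
  have he0 : φ 0 * e 0 = ∫ x, h x ∂(piPoisson p) := by simp [hφ, he]
  have hfin : φ t - Complex.exp (m * (Complex.exp (Complex.I * t) - 1)) * ∫ x, h x ∂(piPoisson p) =
      Complex.exp (m * (Complex.exp (Complex.I * t) - 1)) * (φ t * e t - φ 0 * e 0) := by
    have h1 : Complex.exp (m * (Complex.exp (Complex.I * t) - 1)) * e t = 1 := by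
      rw [he, ← Complex.exp_add, add_neg_cancel, Complex.exp_zero]
    rw [he0]
    linear_combination -(φ t) * h1
  change ‖φ t - _‖ ≤ _
  rw [hfin, norm_mul, Complex.norm_exp, hre]
  rw [sub_zero, Real.norm_eq_abs] at hmv
  refine (mul_le_of_le_one_left (norm_nonneg _) ?_).trans hmv
  rw [Real.exp_le_one_iff]
  nlinarith [Real.cos_le_one t]

theorem integral_coord_sub_mul {p : κ → ℝ≥0} (k : κ) {f : (κ → ℕ) → ℝ} (hf : PolyBdd f) :
    ∫ x, ((x k : ℝ) - p k) * f x ∂(piPoisson p) =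
      p k * ∫ x, (f (x + Pi.single k 1) - f x) ∂(piPoisson p) := by
  have h1 := integral_coord_smul p k f
  simp only [smul_eq_mul] at h1
  simp_rw [sub_mul]
  rw [integral_sub (((PolyBdd.coord k).mul hf).integrable p) ((hf.integrable p).const_mul _),
    integral_sub ((hf.shift k).integrable p) (hf.integrable p), h1, integral_const_mul, mul_sub]

/-- Integration by parts against the linear statistic itself gives its variance, because its
difference in direction `k` is the constant `d k`. Nonnegativity of the variance of `|L|` passes to
the first moment. -/
theorem integral_abs_linear_le (p : κ → ℝ≥0) (d : κ → ℝ) :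
    ∫ x, |∑ k, d k * ((x k : ℝ) - p k)| ∂(piPoisson p) ≤ √(∑ k, p k * d k ^ 2) := by
  set L : (κ → ℕ) → ℝ := fun x => ∑ k, d k * ((x k : ℝ) - p k) with hL
  have hp : PolyBdd L := PolyBdd.sum _ fun k =>
    (PolyBdd.const _).mul ((PolyBdd.coord k).sub (PolyBdd.const _))
  have hsq : ∫ x, L x ^ 2 ∂(piPoisson p) = ∑ k, p k * d k ^ 2 := by
    have h1 : ∀ x, L x ^ 2 = ∑ k, d k * (((x k : ℝ) - p k) * L x) := by
      intro x
      rw [sq]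
      nth_rw 1 [hL]
      simp only [Finset.sum_mul, mul_assoc]
    simp_rw [h1]
    rw [integral_finsetSum _ fun k _ => ((PolyBdd.const _).mul
      (((PolyBdd.coord k).sub (PolyBdd.const _)).mul hp)).integrable p]
    refine Finset.sum_congr rfl fun k _ => ?_
    have h2 : ∀ x, L (x + Pi.single k 1) - L x = d k := by
      intro x
      rw [hL]
      simp only
      rw [← Finset.sum_sub_distrib]
      have : ∀ i, d i * (((x + Pi.single k 1 : κ → ℕ) i : ℝ) - p i) - d i * ((x i : ℝ) - p i) =
          if i = k then d i else 0 := by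
        intro i
        by_cases hi : i = k
        · subst hi; simp; ring
        · simp [hi]
      simp_rw [this]
      simp
    rw [integral_const_mul, integral_coord_sub_mul k hp]
    simp_rw [h2]
    simp
    ring
  rw [← hsq]
  have hi2 : Integrable (fun x => |L x| ^ 2) (piPoisson p) := by
    simp_rw [sq_abs, sq]; exact (hp.mul hp).integrable p
  refine Real.le_sqrt_of_sq_le ?_
  have hv := variance_nonneg (fun x => |L x|) (piPoisson p)
  rw [variance_eq_sub] at hv
  · simp only [Pi.pow_apply, sq_abs] at hv
    linarith
  · rw [memLp_two_iff_integrable_sq StronglyMeasurable.of_discrete.aestronglyMeasurable]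
    exact hi2

/-- Poisson approximation of the compensated edge count, jointly with a functional `h` that only
depends on the coordinates in `T`. -/
theorem norm_integral_exp_charlierPoly_sub_le {p : κ → ℝ≥0} {b : κ → κ → ℝ}
    (hs : ∀ k l, b k l = b l k) (hb : ∀ k l, b k l = 0 ∨ b k l = 1)
    {h : (κ → ℕ) → ℂ} {C : ℝ} (hC : ∀ x, ‖h x‖ ≤ C)
    {T : Finset κ} (hT : ∀ k ∉ T, ∀ x, h (x + Pi.single k 1) = h x) (t : ℝ) :
    ‖∫ x, Complex.exp (Complex.I * ((t * charlierPoly p (fun k l => b k l / 2) x : ℝ) : ℂ)) * h x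
        ∂(piPoisson p)
      - Complex.exp (edgeMean p b * (Complex.exp (Complex.I * t) - 1 - Complex.I * t)) *
        ∫ x, h x ∂(piPoisson p)‖
      ≤ C * |t| * √(∑ k, p k * degreeMean p b k ^ 2) +
        (C * |t| * ∑ k, p k * degreeMean p b k ^ 2 + 2 * C * ∑ k ∈ T, p k * degreeMean p b k)
        * Real.exp (2 * edgeMean p b) * |t| := by
  have hC0 : 0 ≤ C := (norm_nonneg _).trans (hC 0)
  set m := edgeMean p b with hm
  set L : (κ → ℕ) → ℝ := fun x => ∑ k, degreeMean p b k * ((x k : ℝ) - p k) with hL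
  have hpL : PolyBdd L := PolyBdd.sum _ fun k =>
    (PolyBdd.const _).mul ((PolyBdd.coord k).sub (PolyBdd.const _))
  -- The linear terms have mean `2 * m`, each edge being seen from both ends. Centring them turns
  -- the constant `+m` of the Charlier polynomial into `-m`.
  have hJ : ∀ x, charlierPoly p (fun k l => b k l / 2) x = factorialPoly b x / 2 - m - L x := by
    intro x
    rw [charlierPoly_eq]
    have h1 : factorialPoly (fun k l => b k l / 2) x = factorialPoly b x / 2 := by
      simp only [factorialPoly, Finset.sum_div]
      exact Finset.sum_congr rfl fun k _ => Finset.sum_congr rfl fun l _ => by ring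
    have h2 : ∀ k, ∑ l, (b k l / 2 + b l k / 2) * (p l : ℝ) = degreeMean p b k := fun k =>
      Finset.sum_congr rfl fun l _ => by rw [hs l k]; ring
    have h3 : ∑ k, ∑ l, b k l / 2 * (p k : ℝ) * p l = m := by
      rw [hm, edgeMean, Finset.sum_div]
      simp_rw [Finset.sum_div]
      exact Finset.sum_congr rfl fun k _ => Finset.sum_congr rfl fun l _ => by ring
    have h4 : ∑ k, degreeMean p b k * (p k : ℝ) = 2 * m := by
      rw [hm, edgeMean, mul_div_cancel₀ _ two_ne_zero]
      refine Finset.sum_congr rfl fun k _ => ?_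
      rw [degreeMean, Finset.sum_mul]
      exact Finset.sum_congr rfl fun l _ => by ring
    simp_rw [h2]
    rw [h1, h3, hL]
    simp only [mul_sub, Finset.sum_sub_distrib]
    rw [h4]
    ring
  have hint : ∀ f : (κ → ℕ) → ℂ, (∀ x, ‖f x‖ ≤ C) → Integrable f (piPoisson p) := fun f hf =>
    (integrable_const C).mono' StronglyMeasurable.of_discrete.aestronglyMeasurable (.of_forall hf)
  set A := ∫ x, Complex.exp (Complex.I *
    ((t * charlierPoly p (fun k l => b k l / 2) x : ℝ) : ℂ)) * h x ∂(piPoisson p) with hA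
  set B := ∫ x, Complex.exp (Complex.I * ((t * (factorialPoly b x / 2) : ℝ) : ℂ)) * h x
    ∂(piPoisson p) with hB
  set u := Complex.exp (-(Complex.I * ((t * m : ℝ) : ℂ))) with hu
  have hun : ‖u‖ = 1 := by
    rw [hu, ← mul_neg, ← Complex.ofReal_neg, norm_exp_I_mul_ofReal]
  have h1 : ‖A - u * B‖ ≤ C * |t| * √(∑ k, p k * degreeMean p b k ^ 2) := by
    rw [hA, hB, ← integral_const_mul, ← integral_sub]
    · refine (norm_integral_le_integral_norm _).trans ?_
      refine (integral_mono_of_nonneg (g := fun x => C * |t| * |L x|)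
        (.of_forall fun x => norm_nonneg _) ((hpL.integrable p).abs.const_mul _)
        (.of_forall fun x => ?_)).trans ?_
      · simp only
        set v := Complex.exp (Complex.I * ((t * (factorialPoly b x / 2) : ℝ) : ℂ)) with hv
        have : Complex.exp (Complex.I *
            ((t * charlierPoly p (fun k l => b k l / 2) x : ℝ) : ℂ)) * h x - u * (v * h x) =
            (u * v) * ((Complex.exp (Complex.I * ((t * (-L x) : ℝ) : ℂ)) - 1) * h x) := by
          have : Complex.exp (Complex.I *
            ((t * charlierPoly p (fun k l => b k l / 2) x : ℝ) : ℂ)) =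
              u * v * Complex.exp (Complex.I * ((t * (-L x) : ℝ) : ℂ)) := by
            rw [hu, hv, ← Complex.exp_add, ← Complex.exp_add, hJ]
            congr 1; push_cast; ring
          rw [this]; ring
        have hvn : ‖v‖ = 1 := norm_exp_I_mul_ofReal _
        rw [this]
        clear_value u v
        rw [norm_mul, norm_mul u, hun, hvn, one_mul, one_mul, norm_mul]
        have h5 : ‖Complex.exp (Complex.I * ((t * (-L x) : ℝ) : ℂ)) - 1‖ ≤ |t| * |L x| := by
          refine Real.norm_exp_I_mul_ofReal_sub_one_le.trans ?_
          rw [Real.norm_eq_abs, abs_mul, abs_neg]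
        calc _ ≤ |t| * |L x| * C := mul_le_mul h5 (hC x) (norm_nonneg _) (by positivity)
          _ = _ := by ring
      · rw [integral_const_mul]
        exact mul_le_mul_of_nonneg_left (integral_abs_linear_le p _) (by positivity)
    · exact hint _ fun x => by rw [norm_mul, norm_exp_I_mul_ofReal, one_mul]; exact hC x
    · refine (hint _ fun x => ?_).const_mul u
      rw [norm_mul, norm_exp_I_mul_ofReal, one_mul]; exact hC x
  have h2 := norm_integral_exp_factorialPoly_sub_le (p := p) hs hb hC hT t
  have h3 : Complex.exp (m * (Complex.exp (Complex.I * t) - 1 - Complex.I * t)) =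
      u * Complex.exp (m * (Complex.exp (Complex.I * t) - 1)) := by
    rw [hu, ← Complex.exp_add]; congr 1; push_cast; ring
  have h4 : A - Complex.exp (m * (Complex.exp (Complex.I * t) - 1 - Complex.I * t)) *
        ∫ x, h x ∂(piPoisson p) = (A - u * B) +
      u * (B - Complex.exp (m * (Complex.exp (Complex.I * t) - 1)) *
        ∫ x, h x ∂(piPoisson p)) := by
    rw [h3]; ring
  rw [h4]
  refine (norm_add_le _ _).trans (add_le_add h1 ?_)
  rw [norm_mul, hun, one_mul]
  exact h2

end CharFun

/-! ### The second factorial measure on rectangles. -/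

section FactorialSq

variable {Z : Type*} [MeasurableSpace Z]

theorem IsProper.sFinite {m : Measure Z} (h : IsProper m) : SFinite m := by
  obtain ⟨I, x, rfl⟩ := h
  infer_instance

/-- Pairs of distinct indices and diagonal pairs together exhaust all pairs. The identity links
`factorialSq`, defined through a choice of enumeration, to quantities that depend on `m` alone and
measurably so. -/
theorem factorialSq_add_diag {m : Measure Z} (h : IsProper m) {s : Set (Z × Z)}
    (hs : MeasurableSet s) :
    factorialSq m s + m ((fun x => (x, x)) ⁻¹' s) = (m.prod m) s := by
  classical
  have := h.sFinite
  have hm := h.choose_spec.choose_spec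
  set x := h.choose_spec.choose with hx
  have hdiag : MeasurableSet ((fun x : Z => (x, x)) ⁻¹' s) :=
    (measurable_id.prodMk measurable_id) hs
  have hint : ∀ f : Z → ℝ≥0∞, Measurable f → ∫⁻ z, f z ∂m = ∑' i, f (x i) := fun f hf => by
    conv_lhs => rw [hm]
    rw [lintegral_sum_measure]
    exact tsum_congr fun i => lintegral_dirac' _ hf
  have hset : ∀ t : Set Z, MeasurableSet t → m t = ∑' i, t.indicator 1 (x i) := fun t ht => by
    rw [← lintegral_indicator_one ht, hint _ (measurable_one.indicator ht)]
  have h1 : (m.prod m) s = ∑' p : h.choose × h.choose, s.indicator 1 (x p.1, x p.2) := by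
    rw [Measure.prod_apply hs, hint _ (measurable_measure_prodMk_left hs),
      ENNReal.tsum_prod (f := fun i j => s.indicator 1 (x i, x j))]
    refine tsum_congr fun i => ?_
    rw [hset _ (measurable_prodMk_left hs)]
    rfl
  have h2 : factorialSq m s = ∑' p : {p : h.choose × h.choose // p.1 ≠ p.2},
      s.indicator 1 (x p.1.1, x p.1.2) := by
    rw [factorialSq, dif_pos h, Measure.sum_apply _ hs]
    exact tsum_congr fun p => Measure.dirac_apply' _ hs
  have h3 : m ((fun x => (x, x)) ⁻¹' s) =
      ∑' p : ({p : h.choose × h.choose | p.1 ≠ p.2}ᶜ : Set (h.choose × h.choose)),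
        (s.indicator 1 (x p.1.1, x p.1.2) : ℝ≥0∞) := by
    rw [hset _ hdiag]
    let e : h.choose ≃ ({p : h.choose × h.choose | p.1 ≠ p.2}ᶜ : Set (h.choose × h.choose)) :=
      { toFun := fun i => ⟨(i, i), by simp⟩
        invFun := fun p => p.1.1
        left_inv := fun i => rfl
        right_inv := fun p => by
          rcases p with ⟨⟨i, j⟩, hp⟩
          have : i = j := by simpa using hp
          subst this; rfl }
    rw [← e.tsum_eq]
    rfl
  rw [h1, h2, h3]
  exact Summable.tsum_add_tsum_compl (s := {p : h.choose × h.choose | p.1 ≠ p.2})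
    (f := fun p => (s.indicator 1 (x p.1, x p.2) : ℝ≥0∞)) ENNReal.summable ENNReal.summable

theorem factorialSq_prod_add {m : Measure Z} (h : IsProper m) {A C : Set Z}
    (hA : MeasurableSet A) (hC : MeasurableSet C) :
    factorialSq m (A ×ˢ C) + m (A ∩ C) = m A * m C := by
  have := h.sFinite
  have h1 := factorialSq_add_diag h (hA.prod hC)
  rw [Measure.prod_prod] at h1
  exact h1

end FactorialSq

/-! ### Counts of a Poisson process in the cells of a finite partition. -/

section Cells

variable {Ω Z : Type*} [MeasurableSpace Ω] [MeasurableSpace Z] {P : Measure Ω}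
  {ν : Measure Z} {η : Ω → Measure Z} {κ : Type*}

/-- The `ν`-measure of the fibre of `c` over `k` (and `0` if it is infinite). -/
noncomputable def cellMean (ν : Measure Z) (c : Z → κ) (k : κ) : ℝ≥0 := (ν (c ⁻¹' {k})).toNNReal

open Classical in
/-- The number of points of `m` in the fibre of `c` over `k` (and `0` if that fibre has infinite
`ν`-measure). -/
noncomputable def cellCount (ν : Measure Z) (c : Z → κ) (m : Measure Z) (k : κ) : ℕ :=
  if ν (c ⁻¹' {k}) < ∞ then ⌊(m (c ⁻¹' {k})).toReal⌋₊ else 0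

/-- Cells of infinite measure get count `0` and mean `0` by default; this makes the two defaults
agree in `IsPoissonProcess.map_cellCount`. -/
theorem poissonMeasure_zero : poissonMeasure 0 = Measure.dirac 0 := by
  refine Measure.ext_of_singleton fun n => ?_
  rw [poissonMeasure_singleton, Measure.dirac_apply' _ (measurableSet_singleton n)]
  rcases n with _ | n <;> simp

theorem measurable_cellCount {c : Z → κ} (hc : ∀ k, MeasurableSet (c ⁻¹' {k})) (k : κ) :
    Measurable (fun m : Measure Z => cellCount ν c m k) := by
  unfold cellCount
  split_ifs
  · exact (Measure.measurable_coe (hc k)).ennreal_toReal.nat_floor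
  · exact measurable_const

theorem IsPoissonProcess.measurable_apply (hη : IsPoissonProcess η ν P) {B : Set Z}
    (hB : MeasurableSet B) : Measurable fun ω => η ω B :=
  (Measure.measurable_coe hB).comp hη.measurable

theorem IsPoissonProcess.measurable_cellCount (hη : IsPoissonProcess η ν P) {c : Z → κ}
    (hc : ∀ k, MeasurableSet (c ⁻¹' {k})) : Measurable fun ω => cellCount ν c (η ω) :=
  measurable_pi_iff.2 fun k => (PoissonMixture.measurable_cellCount hc k).comp hη.measurable

theorem IsPoissonProcess.map_cellCount [IsProbabilityMeasure P] (hη : IsPoissonProcess η ν P)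
    [Fintype κ] {c : Z → κ} (hc : ∀ k, MeasurableSet (c ⁻¹' {k})) :
    P.map (fun ω => cellCount ν c (η ω)) = piPoisson (cellMean ν c) := by
  classical
  have hmeas : ∀ k, Measurable (fun ω => cellCount ν c (η ω) k) := fun k =>
    (PoissonMixture.measurable_cellCount hc k).comp hη.measurable
  have hind : iIndepFun (fun k ω => cellCount ν c (η ω) k) P := by
    let e := Fintype.equivFin κ
    have h1 := hη.indep _ (fun i => c ⁻¹' {e.symm i}) (fun i => hc _) (fun i j hij => by
      refine Disjoint.preimage _ ?_
      simpa using hij)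
    have h2 := h1.precomp e.injective
    have h3 := h2.comp (γ := fun _ => ℕ)
      (fun k (y : ℝ≥0∞) => if ν (c ⁻¹' {k}) < ∞ then ⌊y.toReal⌋₊ else 0) (fun k => by
        split_ifs
        · exact ENNReal.measurable_toReal.nat_floor
        · exact measurable_const)
    convert! h3 using 2 with k
    funext ω
    simp [cellCount]
  rw [(iIndepFun_iff_map_fun_eq_pi_map fun k => (hmeas k).aemeasurable).1 hind]
  congr 1
  funext k
  by_cases hk : ν (c ⁻¹' {k}) < ∞
  · have h1 : (fun ω => cellCount ν c (η ω) k) =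
        (fun y : ℝ≥0∞ => ⌊y.toReal⌋₊) ∘ (fun ω => η ω (c ⁻¹' {k})) := by
      funext ω; simp [cellCount, hk]
    rw [h1, ← Measure.map_map ENNReal.measurable_toReal.nat_floor
      (hη.measurable_apply (hc k)), hη.law _ (hc k) hk,
      Measure.map_map ENNReal.measurable_toReal.nat_floor (measurable_of_countable _)]
    have : (fun y : ℝ≥0∞ => ⌊y.toReal⌋₊) ∘ (fun n : ℕ => (n : ℝ≥0∞)) = id := by
      funext n; simp
    rw [this, Measure.map_id, cellMean]
  · have h1 : (fun ω => cellCount ν c (η ω) k) = fun _ => 0 := by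
      funext ω; simp only [cellCount, if_neg hk]
    rw [h1, Measure.map_const, measure_univ, one_smul, cellMean, not_lt_top_iff.1 hk,
      ENNReal.toNNReal_top, poissonMeasure_zero]

theorem IsPoissonProcess.ae_eq_natCast (hη : IsPoissonProcess η ν P)
    {B : Set Z} (hB : MeasurableSet B) (hf : ν B < ∞) : ∀ᵐ ω ∂P, ∃ n : ℕ, η ω B = n := by
  have h1 : ∀ᵐ y ∂(P.map fun ω => η ω B), ∃ n : ℕ, y = (n : ℝ≥0∞) := by
    rw [hη.law B hB hf]
    refine (ae_map_iff (measurable_of_countable _).aemeasurable ?_).2 (.of_forall fun n => ⟨n, rfl⟩)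
    have : {y : ℝ≥0∞ | ∃ n : ℕ, y = n} = Set.range (fun n : ℕ => (n : ℝ≥0∞)) := by
      ext y; simp [eq_comm]
    rw [this]
    exact (Set.countable_range _).measurableSet
  exact ae_of_ae_map (hη.measurable_apply hB).aemeasurable h1

theorem IsPoissonProcess.ae_cellCount (hη : IsPoissonProcess η ν P)
    [Countable κ] {c : Z → κ} (hc : ∀ k, MeasurableSet (c ⁻¹' {k})) :
    ∀ᵐ ω ∂P, ∀ k, ν (c ⁻¹' {k}) < ∞ → η ω (c ⁻¹' {k}) = cellCount ν c (η ω) k := by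
  refine ae_all_iff.2 fun k => ?_
  by_cases hk : ν (c ⁻¹' {k}) < ∞
  · filter_upwards [hη.ae_eq_natCast (hc k) hk] with ω hω _
    obtain ⟨n, hn⟩ := hω
    simp [cellCount, hk, hn]
  · exact .of_forall fun ω h => absurd h hk

end Cells

/-! ### First and second moments of a Poisson process. -/

section Intensity

variable {Ω Z : Type*} [MeasurableSpace Ω] [MeasurableSpace Z] {P : Measure Ω}
  {ν : Measure Z} {η : Ω → Measure Z}

theorem lintegral_coord_mul {κ : Type*} [Fintype κ] [DecidableEq κ] (p : κ → ℝ≥0) (k : κ)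
    (f : (κ → ℕ) → ℝ≥0∞) :
    ∫⁻ x, x k * f x ∂(piPoisson p) = p k * ∫⁻ x, f (x + Pi.single k 1) ∂(piPoisson p) := by
  have h := congrArg (fun μ => ∫⁻ x, f x ∂μ) (piPoisson_withDensity_coord p k)
  rw [lintegral_withDensity_eq_lintegral_mul _ (measurable_of_countable _)
    (measurable_of_countable f), lintegral_smul_measure,
    lintegral_map (measurable_of_countable f) (measurable_of_countable _)] at h
  simpa using h

theorem lintegral_coord {κ : Type*} [Fintype κ] [DecidableEq κ] (p : κ → ℝ≥0) (k : κ) :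
    ∫⁻ x, (x k : ℝ≥0∞) ∂(piPoisson p) = p k := by
  simpa using lintegral_coord_mul p k (fun _ => 1)

theorem lintegral_coord_mul_coord {κ : Type*} [Fintype κ] [DecidableEq κ] (p : κ → ℝ≥0)
    (k l : κ) :
    ∫⁻ x, (x k : ℝ≥0∞) * x l ∂(piPoisson p) = p k * p l + if k = l then (p k : ℝ≥0∞) else 0 := by
  rw [lintegral_coord_mul p k (fun x => (x l : ℝ≥0∞))]
  have : ∀ x : κ → ℕ, (((x + Pi.single k 1 : κ → ℕ) l : ℕ) : ℝ≥0∞) =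
      x l + if k = l then 1 else 0 := by
    intro x
    by_cases h : k = l
    · subst h; simp
    · simp [h, Ne.symm h]
  simp_rw [this]
  rw [lintegral_add_right _ measurable_const, lintegral_coord, lintegral_const, measure_univ,
    mul_one, mul_add]
  split_ifs <;> simp

theorem IsPoissonProcess.lintegral_apply_of_lt_top (hη : IsPoissonProcess η ν P)
    {B : Set Z} (hB : MeasurableSet B) (hf : ν B < ∞) : ∫⁻ ω, η ω B ∂P = ν B := by
  have h1 : ∫⁻ ω, η ω B ∂P = ∫⁻ y, y ∂(P.map fun ω => η ω B) := by
    rw [lintegral_map (f := fun y => y) measurable_id (hη.measurable_apply hB)]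
  rw [h1, hη.law B hB hf, lintegral_map (f := fun y => y) measurable_id (measurable_of_countable _)]
  have h2 := lintegral_coord (κ := Unit) (fun _ => (ν B).toNNReal) ()
  rw [piPoisson, (measurePreserving_eval (fun _ : Unit => poissonMeasure (ν B).toNNReal)
    ()).lintegral_comp (f := fun n : ℕ => (n : ℝ≥0∞)) (measurable_of_countable _),
    ENNReal.coe_toNNReal hf.ne] at h2
  exact h2

theorem IsPoissonProcess.bind_eq [SigmaFinite ν] (hη : IsPoissonProcess η ν P) :
    P.bind η = ν := by
  refine Measure.ext fun s hs => ?_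
  have hmono : Monotone fun k => s ∩ spanningSets ν k := fun i j hij =>
    Set.inter_subset_inter_right _ (monotone_spanningSets ν hij)
  have hU : ⋃ k, s ∩ spanningSets ν k = s := by
    rw [← Set.inter_iUnion, iUnion_spanningSets, Set.inter_univ]
  have h1 := tendsto_measure_iUnion_atTop (μ := ν) hmono
  have h2 := tendsto_measure_iUnion_atTop (μ := P.bind η) hmono
  rw [hU] at h1 h2
  refine tendsto_nhds_unique (h2.congr fun k => ?_) h1
  have hk := hs.inter (measurableSet_spanningSets ν k)
  simp only [Function.comp_apply]
  rw [Measure.bind_apply hk hη.measurable.aemeasurable]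
  exact hη.lintegral_apply_of_lt_top hk
    ((measure_mono Set.inter_subset_right).trans_lt (measure_spanningSets_lt_top ν k))

theorem IsPoissonProcess.lintegral_mul [IsProbabilityMeasure P] (hη : IsPoissonProcess η ν P)
    {A C : Set Z} (hA : MeasurableSet A) (hC : MeasurableSet C) (hAf : ν A < ∞) (hCf : ν C < ∞) :
    ∫⁻ ω, η ω A * η ω C ∂P = ν A * ν C + ν (A ∩ C) := by
  classical
  -- Membership in `A` and in `C` labels four disjoint cells with independent counts. The term `ν (A
  -- ∩ C)` comes from the variance of the count in the common cell.
  let c : Z → Bool × Bool := fun z => (decide (z ∈ A), decide (z ∈ C))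
  have e11 : c ⁻¹' {(true, true)} = A ∩ C := by ext z; simp [c, Prod.ext_iff]
  have e10 : c ⁻¹' {(true, false)} = A \ C := by ext z; simp [c, Prod.ext_iff]
  have e01 : c ⁻¹' {(false, true)} = C \ A := by ext z; simp [c, Prod.ext_iff, and_comm]
  have e00 : c ⁻¹' {(false, false)} = (A ∪ C)ᶜ := by ext z; simp [c, Prod.ext_iff]
  have hc : ∀ k, MeasurableSet (c ⁻¹' {k}) := by
    rintro ⟨_ | _, _ | _⟩
    · rw [e00]; exact (hA.union hC).compl
    · rw [e01]; exact hC.diff hA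
    · rw [e10]; exact hA.diff hC
    · rw [e11]; exact hA.inter hC
  have f11 : ν (c ⁻¹' {(true, true)}) < ∞ := by
    rw [e11]; exact (measure_mono Set.inter_subset_left).trans_lt hAf
  have f10 : ν (c ⁻¹' {(true, false)}) < ∞ := by
    rw [e10]; exact (measure_mono Set.sdiff_subset).trans_lt hAf
  have f01 : ν (c ⁻¹' {(false, true)}) < ∞ := by
    rw [e01]; exact (measure_mono Set.sdiff_subset).trans_lt hCf
  have hsplit : ∀ μ : Measure Z, μ A = μ (c ⁻¹' {(true, true)}) + μ (c ⁻¹' {(true, false)}) ∧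
      μ C = μ (c ⁻¹' {(true, true)}) + μ (c ⁻¹' {(false, true)}) := fun μ => by
    rw [e11, e10, e01]
    refine ⟨(measure_inter_add_sdiff A hC).symm, ?_⟩
    rw [Set.inter_comm]
    exact (measure_inter_add_sdiff C hA).symm
  have h1 : ∫⁻ ω, η ω A * η ω C ∂P = ∫⁻ x, ((x (true, true) : ℝ≥0∞) + x (true, false)) *
      (x (true, true) + x (false, true)) ∂(piPoisson (cellMean ν c)) := by
    rw [← hη.map_cellCount hc, lintegral_map (measurable_of_countable _)
      (hη.measurable_cellCount hc)]
    refine lintegral_congr_ae ?_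
    filter_upwards [hη.ae_cellCount hc] with ω hω
    rw [(hsplit (η ω)).1, (hsplit (η ω)).2, hω _ f11, hω _ f10, hω _ f01]
  have hp : ∀ k, ν (c ⁻¹' {k}) < ∞ → (cellMean ν c k : ℝ≥0∞) = ν (c ⁻¹' {k}) := fun k hk =>
    ENNReal.coe_toNNReal hk.ne
  simp_rw [h1, add_mul, mul_add]
  rw [lintegral_add_left (measurable_of_countable _), lintegral_add_left (measurable_of_countable _),
    lintegral_add_left (measurable_of_countable _)]
  simp only [lintegral_coord_mul_coord]
  rw [(hsplit ν).1, (hsplit ν).2, ← e11, ← hp _ f11, ← hp _ f10, ← hp _ f01]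
  simp
  ring

end Intensity

/-! ### Measurability and intensity of the second factorial measure. -/

section Modification

variable {Ω Z : Type*} [MeasurableSpace Ω] [MeasurableSpace Z] {P : Measure Ω}
  {ν : Measure Z} {η : Ω → Measure Z}

/-- The second factorial measure has a measurable modification, with intensity `ν ⊗ ν`. -/
theorem IsPoissonProcess.exists_measurable_factorialSq [IsProbabilityMeasure P] [SigmaFinite ν]
    (hη : IsPoissonProcess η ν P) :
    ∃ ξ : Ω → Measure (Z × Z), Measurable ξ ∧ (∀ᵐ ω ∂P, factorialSq (η ω) = ξ ω) ∧
      P.bind ξ = ν.prod ν := by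
  classical
  set S := spanningSets ν with hS
  have hSm : ∀ k, MeasurableSet (S k) := measurableSet_spanningSets ν
  have hSf : ∀ k, ν (S k) < ∞ := measure_spanningSets_lt_top ν
  have hae : ∀ᵐ ω ∂P, IsProper (η ω) ∧ ∀ k, η ω (S k) < ∞ := by
    refine hη.proper.and (ae_all_iff.2 fun k => ?_)
    filter_upwards [hη.ae_eq_natCast (hSm k) (hSf k)] with ω hω
    obtain ⟨n, hn⟩ := hω
    rw [hn]; exact ENNReal.natCast_lt_top n
  obtain ⟨D, hD, hDm, hD0⟩ := exists_measurable_superset_of_null (ae_iff.1 hae)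
  have hgood : ∀ ω ∈ Dᶜ, IsProper (η ω) ∧ ∀ k, η ω (S k) < ∞ := fun ω hω => by
    by_contra h
    exact hω (hD h)
  -- Outside the measurable null set `D` the configuration is proper and finite on every spanning
  -- set. Setting the measure to zero on `D` gives measurability everywhere.
  set ξ : Ω → Measure (Z × Z) := fun ω => if ω ∈ D then 0 else factorialSq (η ω) with hξ
  have hrect : ∀ ω, ω ∉ D → ∀ A C : Set Z, MeasurableSet A → MeasurableSet C → ∀ k,
      ξ ω ((A ∩ S k) ×ˢ (C ∩ S k)) =
        η ω (A ∩ S k) * η ω (C ∩ S k) - η ω ((A ∩ S k) ∩ (C ∩ S k)) := by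
    intro ω hω A C hA hC k
    rw [← factorialSq_prod_add (hgood ω hω).1 (hA.inter (hSm k)) (hC.inter (hSm k)),
      ENNReal.add_sub_cancel_right, hξ]
    · simp [hω]
    · exact ((measure_mono (Set.inter_subset_left.trans Set.inter_subset_right)).trans_lt
        ((hgood ω hω).2 k)).ne
  have hmono : Monotone fun k => S k ×ˢ S k := fun i j hij =>
    Set.prod_mono (monotone_spanningSets ν hij) (monotone_spanningSets ν hij)
  have hUn : ⋃ k, S k ×ˢ S k = Set.univ := by
    refine Set.eq_univ_of_forall fun p => ?_
    have h1 : ∀ z, ∃ k, z ∈ S k := fun z => Set.mem_iUnion.1 (by rw [hS, iUnion_spanningSets]; trivial)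
    obtain ⟨i, hi⟩ := h1 p.1
    obtain ⟨j, hj⟩ := h1 p.2
    exact Set.mem_iUnion.2 ⟨max i j, monotone_spanningSets ν (le_max_left i j) hi,
      monotone_spanningSets ν (le_max_right i j) hj⟩
  have hrectm : ∀ A C : Set Z, MeasurableSet A → MeasurableSet C → ∀ k,
      Measurable fun ω => ξ ω ((A ∩ S k) ×ˢ (C ∩ S k)) := by
    intro A C hA hC k
    have : (fun ω => ξ ω ((A ∩ S k) ×ˢ (C ∩ S k))) = fun ω => if ω ∈ D then 0 else
        η ω (A ∩ S k) * η ω (C ∩ S k) - η ω ((A ∩ S k) ∩ (C ∩ S k)) := by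
      funext ω
      by_cases hω : ω ∈ D
      · simp [hξ, hω]
      · rw [hrect ω hω A C hA hC, if_neg hω]
    rw [this]
    have h1 := hη.measurable_apply (hA.inter (hSm k))
    have h2 := hη.measurable_apply (hC.inter (hSm k))
    have h3 := hη.measurable_apply ((hA.inter (hSm k)).inter (hC.inter (hSm k)))
    exact Measurable.ite hDm measurable_const ((h1.mul h2).sub h3)
  have hmk : ∀ k, Measurable fun ω => (ξ ω).restrict (S k ×ˢ S k) := by
    intro k
    have hfin : ∀ ω, IsFiniteMeasure ((ξ ω).restrict (S k ×ˢ S k)) := fun ω => by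
      refine ⟨?_⟩
      rw [Measure.restrict_apply_univ]
      by_cases hω : ω ∈ D
      · simp [hξ, hω]
      · have := hrect ω hω Set.univ Set.univ .univ .univ k
        simp only [Set.univ_inter] at this
        rw [this]
        exact tsub_le_self.trans_lt (ENNReal.mul_lt_top ((hgood ω hω).2 k) ((hgood ω hω).2 k))
    -- Rectangles determine a measurable family of finite measures, which is the reason for the
    -- restriction to `S k × S k`.
    refine Measurable.measure_of_isPiSystem generateFrom_prod.symm isPiSystem_prod ?_ ?_
    · rintro _ ⟨A, hA, C, hC, rfl⟩
      simp only
      have : ∀ ω, (ξ ω).restrict (S k ×ˢ S k) (A ×ˢ C) = ξ ω ((A ∩ S k) ×ˢ (C ∩ S k)) := fun ω => by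
        rw [Measure.restrict_apply (MeasurableSet.prod hA hC), Set.prod_inter_prod]
      simp_rw [this]
      exact hrectm A C hA hC k
    · have := hrectm Set.univ Set.univ .univ .univ k
      simpa using this
  have hξm : Measurable ξ := by
    refine Measure.measurable_of_measurable_coe _ fun s hs => ?_
    have h1 : ∀ ω, ξ ω s = ⨆ k, (ξ ω).restrict (S k ×ˢ S k) s := fun ω => by
      have h2 : s = ⋃ k, s ∩ S k ×ˢ S k := by rw [← Set.inter_iUnion, hUn, Set.inter_univ]
      have h3 : Monotone fun k => s ∩ S k ×ˢ S k := fun i j hij =>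
        Set.inter_subset_inter_right _ (hmono hij)
      conv_lhs => rw [h2]
      rw [h3.measure_iUnion]
      exact iSup_congr fun k => (Measure.restrict_apply hs).symm
    simp_rw [h1]
    exact .iSup fun k => (Measure.measurable_coe hs).comp (hmk k)
  have hae2 : ∀ᵐ ω ∂P, ω ∉ D := measure_eq_zero_iff_ae_notMem.1 hD0
  refine ⟨ξ, hξm, ?_, ?_⟩
  · filter_upwards [hae2] with ω hω
    simp [hξ, hω]
  · symm
    refine Measure.prod_eq fun A C hA hC => ?_
    rw [← Measure.prod_prod]
    have hmono2 : Monotone fun k => (A ∩ S k) ×ˢ (C ∩ S k) := fun i j hij =>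
      Set.prod_mono (Set.inter_subset_inter_right _ (monotone_spanningSets ν hij))
        (Set.inter_subset_inter_right _ (monotone_spanningSets ν hij))
    have hU2 : ⋃ k, (A ∩ S k) ×ˢ (C ∩ S k) = A ×ˢ C := by
      simp_rw [← Set.prod_inter_prod]
      rw [← Set.inter_iUnion, hUn, Set.inter_univ]
    have h1 := tendsto_measure_iUnion_atTop (μ := ν.prod ν) hmono2
    have h2 := tendsto_measure_iUnion_atTop (μ := P.bind ξ) hmono2
    rw [hU2] at h1 h2
    refine tendsto_nhds_unique (h2.congr fun k => ?_) h1
    simp only [Function.comp_apply]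
    have hAm := hA.inter (hSm k)
    have hCm := hC.inter (hSm k)
    have hAf : ν (A ∩ S k) < ∞ := (measure_mono Set.inter_subset_right).trans_lt (hSf k)
    have hCf : ν (C ∩ S k) < ∞ := (measure_mono Set.inter_subset_right).trans_lt (hSf k)
    rw [Measure.bind_apply (hAm.prod hCm) hξm.aemeasurable, Measure.prod_prod]
    have h3 := hη.lintegral_mul hAm hCm hAf hCf
    have hIf : ν ((A ∩ S k) ∩ (C ∩ S k)) < ∞ := (measure_mono Set.inter_subset_left).trans_lt hAf
    have h4 : ∫⁻ ω, η ω (A ∩ S k) * η ω (C ∩ S k) ∂P =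
        ∫⁻ ω, (ξ ω ((A ∩ S k) ×ˢ (C ∩ S k)) + η ω ((A ∩ S k) ∩ (C ∩ S k))) ∂P := by
      refine lintegral_congr_ae ?_
      filter_upwards [hae2] with ω hω
      rw [← factorialSq_prod_add (hgood ω hω).1 hAm hCm, hξ]
      simp [hω]
    rw [h4, lintegral_add_left (hrectm A C hA hC k),
      hη.lintegral_apply_of_lt_top (hAm.inter hCm) hIf] at h3
    -- The mean diagonal mass is the finite number `ν (A ∩ C)` of the localised sets and cancels,
    -- leaving the product of their measures.
    exact (ENNReal.add_left_inj hIf.ne).1 h3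

end Modification

/-! ### Linearity of the pathwise double integral under absolute integrability. -/

section PathNorm

variable {Z : Type*} [MeasurableSpace Z]

/-- The sum of the absolute integrals that occur in `pathIntegral₂`. -/
noncomputable def pathNorm (ν m : Measure Z) (f : Z × Z → ℝ) : ℝ≥0∞ :=
  (∫⁻ p, ‖f p‖ₑ ∂(factorialSq m)) + (∫⁻ x, ∫⁻ y, ‖f (x, y)‖ₑ ∂ν ∂m)
    + (∫⁻ y, ∫⁻ x, ‖f (x, y)‖ₑ ∂ν ∂m) + ∫⁻ p, ‖f p‖ₑ ∂(ν.prod ν)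

theorem enorm_pathIntegral₂_le (ν m : Measure Z) (f : Z × Z → ℝ) :
    ‖pathIntegral₂ ν m f‖ₑ ≤ pathNorm ν m f := by
  unfold pathIntegral₂ pathNorm
  refine (enorm_add_le _ _).trans (add_le_add ?_ (enorm_integral_le_lintegral_enorm _))
  refine enorm_sub_le.trans (add_le_add ?_ ?_)
  · refine enorm_sub_le.trans (add_le_add (enorm_integral_le_lintegral_enorm _) ?_)
    exact (enorm_integral_le_lintegral_enorm _).trans
      (lintegral_mono fun x => enorm_integral_le_lintegral_enorm _)
  · exact (enorm_integral_le_lintegral_enorm _).trans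
      (lintegral_mono fun x => enorm_integral_le_lintegral_enorm _)

variable {ν m : Measure Z} [SFinite ν]

theorem integrable_integral_of_lintegral_lt_top {f : Z × Z → ℝ} (hf : Measurable f)
    (h : ∫⁻ x, ∫⁻ y, ‖f (x, y)‖ₑ ∂ν ∂m < ∞) :
    Integrable (fun x => ∫ y, f (x, y) ∂ν) m ∧ ∀ᵐ x ∂m, Integrable (fun y => f (x, y)) ν := by
  refine ⟨⟨hf.stronglyMeasurable.integral_prod_right'.aestronglyMeasurable,
    (lintegral_mono fun x => enorm_integral_le_lintegral_enorm _).trans_lt h⟩, ?_⟩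
  have hm : Measurable fun x => ∫⁻ y, ‖f (x, y)‖ₑ ∂ν := hf.enorm.lintegral_prod_right'
  filter_upwards [ae_lt_top hm h.ne] with x hx
  exact ⟨(hf.comp measurable_prodMk_left).aestronglyMeasurable, hx⟩

theorem integral_integral_add_mul {f g : Z × Z → ℝ} (hf : Measurable f) (hg : Measurable g)
    (hfn : ∫⁻ x, ∫⁻ y, ‖f (x, y)‖ₑ ∂ν ∂m < ∞) (hgn : ∫⁻ x, ∫⁻ y, ‖g (x, y)‖ₑ ∂ν ∂m < ∞) (a : ℝ) :
    ∫ x, ∫ y, (f (x, y) + a * g (x, y)) ∂ν ∂m =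
      ∫ x, ∫ y, f (x, y) ∂ν ∂m + a * ∫ x, ∫ y, g (x, y) ∂ν ∂m := by
  obtain ⟨h1, h2⟩ := integrable_integral_of_lintegral_lt_top hf hfn
  obtain ⟨h3, h4⟩ := integrable_integral_of_lintegral_lt_top hg hgn
  rw [← integral_const_mul, ← integral_add h1 (h3.const_mul a)]
  refine integral_congr_ae ?_
  filter_upwards [h2, h4] with x hx hx'
  rw [integral_add hx (hx'.const_mul a), integral_const_mul]

theorem pathIntegral₂_add_mul {f g : Z × Z → ℝ} (hf : Measurable f) (hg : Measurable g)
    (hfn : pathNorm ν m f < ∞) (hgn : pathNorm ν m g < ∞) (a : ℝ) :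
    pathIntegral₂ ν m (fun p => f p + a * g p) =
      pathIntegral₂ ν m f + a * pathIntegral₂ ν m g := by
  simp only [pathNorm, ENNReal.add_lt_top] at hfn hgn
  obtain ⟨⟨⟨hf1, hf2⟩, hf3⟩, hf4⟩ := hfn
  obtain ⟨⟨⟨hg1, hg2⟩, hg3⟩, hg4⟩ := hgn
  have hi : ∀ {μ : Measure (Z × Z)} {f : Z × Z → ℝ}, Measurable f → ∫⁻ p, ‖f p‖ₑ ∂μ < ∞ →
      Integrable f μ := fun hf h => ⟨hf.aestronglyMeasurable, h⟩
  have e3 := integral_integral_add_mul (ν := ν) (m := m) (f := fun p => f p.swap)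
    (g := fun p => g p.swap) (hf.comp measurable_swap) (hg.comp measurable_swap) hf3 hg3 a
  simp only [Prod.swap_prod_mk] at e3
  unfold pathIntegral₂
  rw [integral_integral_add_mul hf hg hf2 hg2, e3,
    integral_add (hi hf hf1) ((hi hg hg1).const_mul a),
    integral_add (hi hf hf4) ((hi hg hg4).const_mul a), integral_const_mul, integral_const_mul]
  ring

end PathNorm

/-! ### Measurability and the `L¹` bound of the pathwise double integral. -/

section PathIntegral

variable {Ω Z : Type*} [MeasurableSpace Ω] [MeasurableSpace Z] {P : Measure Ω}
  {ν : Measure Z} {η : Ω → Measure Z}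

/-- The integral is a difference of Lebesgue integrals of positive and negative parts, each of which
depends measurably on the measure. -/
theorem aemeasurable_integral_of_measurable {W : Type*} [MeasurableSpace W] {ξ : Ω → Measure W}
    (hξ : Measurable ξ) {f : W → ℝ} (hf : Measurable f) (hi : ∀ᵐ ω ∂P, Integrable f (ξ ω)) :
    AEMeasurable (fun ω => ∫ w, f w ∂(ξ ω)) P := by
  have h1 : Measurable fun ω => (∫⁻ w, ENNReal.ofReal (f w) ∂(ξ ω)).toReal
      - (∫⁻ w, ENNReal.ofReal (-f w) ∂(ξ ω)).toReal :=
    (((Measure.measurable_lintegral hf.ennreal_ofReal).comp hξ).ennreal_toReal).sub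
      (((Measure.measurable_lintegral hf.neg.ennreal_ofReal).comp hξ).ennreal_toReal)
  refine h1.aemeasurable.congr ?_
  filter_upwards [hi] with ω hω
  exact (integral_eq_lintegral_pos_part_sub_lintegral_neg_part hω).symm

theorem IsPoissonProcess.lintegral_lintegral_self [SigmaFinite ν] (hη : IsPoissonProcess η ν P) {f : Z → ℝ≥0∞}
    (hf : Measurable f) : ∫⁻ ω, ∫⁻ z, f z ∂(η ω) ∂P = ∫⁻ z, f z ∂ν := by
  conv_rhs => rw [← hη.bind_eq]
  rw [Measure.lintegral_bind hη.measurable.aemeasurable hf.aemeasurable]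

variable [IsProbabilityMeasure P] [SigmaFinite ν]

/-- Each of the four terms has the `L¹` norm of `f` as its mean, since `η` has intensity `ν` and its
factorial square has intensity `ν ⊗ ν`. -/
theorem IsPoissonProcess.pathNorm_ae_eq (hη : IsPoissonProcess η ν P) {f : Z × Z → ℝ}
    (hf : Measurable f) :
    AEMeasurable (fun ω => pathNorm ν (η ω) f) P ∧
      ∫⁻ ω, pathNorm ν (η ω) f ∂P = 4 * ∫⁻ p, ‖f p‖ₑ ∂(ν.prod ν) := by
  obtain ⟨ξ, hξm, hξ, hbind⟩ := hη.exists_measurable_factorialSq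
  have e1 : (fun ω => ∫⁻ p, ‖f p‖ₑ ∂(factorialSq (η ω))) =ᵐ[P] fun ω => ∫⁻ p, ‖f p‖ₑ ∂(ξ ω) := by
    filter_upwards [hξ] with ω hω
    rw [hω]
  have m1 : AEMeasurable (fun ω => ∫⁻ p, ‖f p‖ₑ ∂(factorialSq (η ω))) P :=
    ((Measure.measurable_lintegral hf.enorm).comp hξm).aemeasurable.congr e1.symm
  have hx : Measurable fun x => ∫⁻ y, ‖f (x, y)‖ₑ ∂ν := hf.enorm.lintegral_prod_right'
  have hy : Measurable fun y => ∫⁻ x, ‖f (x, y)‖ₑ ∂ν := hf.enorm.lintegral_prod_left'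
  have m2 : Measurable fun ω => ∫⁻ x, ∫⁻ y, ‖f (x, y)‖ₑ ∂ν ∂(η ω) :=
    (Measure.measurable_lintegral hx).comp hη.measurable
  have m3 : Measurable fun ω => ∫⁻ y, ∫⁻ x, ‖f (x, y)‖ₑ ∂ν ∂(η ω) :=
    (Measure.measurable_lintegral hy).comp hη.measurable
  refine ⟨((m1.add m2.aemeasurable).add m3.aemeasurable).add aemeasurable_const, ?_⟩
  unfold pathNorm
  rw [lintegral_add_right _ measurable_const, lintegral_add_right _ m3, lintegral_add_right _ m2,
    lintegral_congr_ae e1, hη.lintegral_lintegral_self hx, hη.lintegral_lintegral_self hy,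
    ← Measure.lintegral_bind hξm.aemeasurable hf.enorm.aemeasurable, hbind, lintegral_const,
    measure_univ, mul_one, lintegral_lintegral (f := fun x y => ‖f (x, y)‖ₑ) hf.enorm.aemeasurable,
    lintegral_lintegral_symm (f := fun x y => ‖f (y, x)‖ₑ)
      (hf.enorm.comp measurable_swap).aemeasurable]
  ring

theorem IsPoissonProcess.ae_pathNorm_lt_top (hη : IsPoissonProcess η ν P) {f : Z × Z → ℝ}
    (hf : Measurable f) (hfi : Integrable f (ν.prod ν)) : ∀ᵐ ω ∂P, pathNorm ν (η ω) f < ∞ := by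
  obtain ⟨h1, h2⟩ := hη.pathNorm_ae_eq hf
  refine ae_lt_top' h1 ?_
  rw [h2]
  exact ENNReal.mul_ne_top (by simp) hfi.2.ne

theorem IsPoissonProcess.aestronglyMeasurable_pathIntegral₂ (hη : IsPoissonProcess η ν P)
    {f : Z × Z → ℝ} (hf : Measurable f) (hfi : Integrable f (ν.prod ν)) :
    AEStronglyMeasurable (fun ω => pathIntegral₂ ν (η ω) f) P := by
  obtain ⟨ξ, hξm, hξ, hbind⟩ := hη.exists_measurable_factorialSq
  have hfin := hη.ae_pathNorm_lt_top hf hfi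
  simp only [pathNorm, ENNReal.add_lt_top] at hfin
  have m1 : AEMeasurable (fun ω => ∫ p, f p ∂(factorialSq (η ω))) P := by
    refine (aemeasurable_integral_of_measurable hξm hf ?_).congr
      (g := fun ω => ∫ p, f p ∂(factorialSq (η ω))) ?_
    · filter_upwards [hfin, hξ] with ω hω h
      rw [← h]
      exact ⟨hf.aestronglyMeasurable, hω.1.1.1⟩
    · filter_upwards [hξ] with ω hω
      rw [hω]
  have m2 : AEMeasurable (fun ω => ∫ x, ∫ y, f (x, y) ∂ν ∂(η ω)) P := by
    refine aemeasurable_integral_of_measurable hη.measurable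
      hf.stronglyMeasurable.integral_prod_right'.measurable ?_
    filter_upwards [hfin] with ω hω
    exact (integrable_integral_of_lintegral_lt_top hf hω.1.1.2).1
  have m3 : AEMeasurable (fun ω => ∫ y, ∫ x, f (x, y) ∂ν ∂(η ω)) P := by
    refine aemeasurable_integral_of_measurable hη.measurable
      hf.stronglyMeasurable.integral_prod_left'.measurable ?_
    filter_upwards [hfin] with ω hω
    exact (integrable_integral_of_lintegral_lt_top (hf.comp measurable_swap) hω.1.2).1
  exact (((m1.sub m2).sub m3).add aemeasurable_const).aestronglyMeasurable

end PathIntegral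

/-! ### Step functions on products of cells. -/

/-- The function of two variables that is constant on products of cells of `c`. -/
def stepFun {Z κ : Type*} (c : Z → κ) (a : κ → κ → ℝ) : Z × Z → ℝ := fun p => a (c p.1) (c p.2)

/-- The summands of a step function. -/
noncomputable def stepTerm {Z κ : Type*} (c : Z → κ) (a : κ → κ → ℝ) (q : κ × κ) : Z × Z → ℝ :=
  fun p => a q.1 q.2 * ((c ⁻¹' {q.1}) ×ˢ (c ⁻¹' {q.2})).indicator 1 p

theorem stepFun_eq_sum {Z κ : Type*} [Fintype κ] (c : Z → κ) (a : κ → κ → ℝ) :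
    stepFun c a = fun p => ∑ q, stepTerm c a q p := by
  classical
  funext p
  rw [Finset.sum_eq_single (c p.1, c p.2)]
  · simp [stepFun, stepTerm]
  · intro q _ hq
    have : p ∉ (c ⁻¹' {q.1}) ×ˢ (c ⁻¹' {q.2}) := by
      rintro ⟨h1, h2⟩
      exact hq (Prod.ext h1.symm h2.symm)
    simp [stepTerm, this]
  · simp

section StepFunction

variable {Z : Type*} [MeasurableSpace Z] {ν : Measure Z}

/-- `c : Z → κ` is a finite measurable partition and the kernel `a` vanishes outside the cells of
finite measure. -/
structure IsStep {κ : Type*} (ν : Measure Z) (c : Z → κ) (a : κ → κ → ℝ) : Prop where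
  measurableSet : ∀ k, MeasurableSet (c ⁻¹' {k})
  lt_top : ∀ k l, a k l ≠ 0 → ν (c ⁻¹' {k}) < ∞ ∧ ν (c ⁻¹' {l}) < ∞

variable {κ : Type*} {c : Z → κ} {a : κ → κ → ℝ}

theorem IsStep.measurable_stepTerm (h : IsStep ν c a) (q : κ × κ) :
    Measurable (stepTerm c a q) :=
  (measurable_one.indicator ((h.measurableSet _).prod (h.measurableSet _))).const_mul _

theorem IsStep.integrable_stepTerm [SigmaFinite ν] (h : IsStep ν c a) (q : κ × κ) :
    Integrable (stepTerm c a q) (ν.prod ν) := by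
  by_cases hq : a q.1 q.2 = 0
  · have : stepTerm c a q = 0 := by funext p; simp [stepTerm, hq]
    rw [this]; exact integrable_zero _ _ _
  · refine Integrable.const_mul ?_ _
    refine (integrable_indicator_iff ((h.measurableSet _).prod (h.measurableSet _))).2 ?_
    refine integrableOn_const ?_
    rw [Measure.prod_prod]
    exact (ENNReal.mul_lt_top (h.lt_top _ _ hq).1 (h.lt_top _ _ hq).2).ne

theorem IsStep.integral_stepTerm [SigmaFinite ν] (h : IsStep ν c a) (q : κ × κ) :
    ∫ p, stepTerm c a q p ∂(ν.prod ν) = a q.1 q.2 * (cellMean ν c q.1 * cellMean ν c q.2) := by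
  simp only [stepTerm]
  rw [integral_const_mul,
    integral_indicator_one ((h.measurableSet _).prod (h.measurableSet _)), measureReal_prod_prod]
  rfl

theorem IsStep.measurable [Fintype κ] (h : IsStep ν c a) : Measurable (stepFun c a) := by
  rw [stepFun_eq_sum]
  exact Finset.measurable_sum _ fun q _ => h.measurable_stepTerm q

theorem IsStep.integrable [Fintype κ] [SigmaFinite ν] (h : IsStep ν c a) :
    Integrable (stepFun c a) (ν.prod ν) := by
  rw [stepFun_eq_sum]
  exact integrable_finsetSum _ fun q _ => h.integrable_stepTerm q

theorem IsStep.integral [Fintype κ] [SigmaFinite ν] (h : IsStep ν c a) :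
    ∫ p, stepFun c a p ∂(ν.prod ν) =
      ∑ k, ∑ l, a k l * (cellMean ν c k * cellMean ν c l) := by
  rw [stepFun_eq_sum, integral_finsetSum _ fun q _ => h.integrable_stepTerm q,
    Fintype.sum_prod_type]
  exact Finset.sum_congr rfl fun k _ => Finset.sum_congr rfl fun l _ => h.integral_stepTerm (k, l)

theorem IsStep.comp (h : IsStep ν c a) (u : ℝ → ℝ) (hu : u 0 = 0) :
    IsStep ν c (fun k l => u (a k l)) :=
  ⟨h.measurableSet, fun k l hkl => h.lt_top k l fun h0 => hkl (by rw [h0, hu])⟩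

theorem IsStep.integral_sq [Fintype κ] [SigmaFinite ν] (h : IsStep ν c a) :
    ∫ p, stepFun c a p ^ 2 ∂(ν.prod ν) =
      ∑ k, ∑ l, a k l ^ 2 * (cellMean ν c k * cellMean ν c l) :=
  (h.comp (· ^ 2) (by simp)).integral

theorem IsStep.memLp_two [Fintype κ] [SigmaFinite ν] (h : IsStep ν c a) :
    MemLp (stepFun c a) 2 (ν.prod ν) := by
  rw [memLp_two_iff_integrable_sq h.measurable.aestronglyMeasurable]
  exact (h.comp (· ^ 2) (by simp)).integrable

/-- Refinement of a partition. -/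
theorem IsStep.refine_left {κ' : Type*} [Countable κ] [Countable κ'] {c' : Z → κ'}
    (h : IsStep ν c a) (hc' : ∀ k, MeasurableSet (c' ⁻¹' {k})) :
    IsStep ν (fun z => (c z, c' z)) (fun k l => a k.1 l.1) := by
  have hpre : ∀ k : κ × κ', (fun z => (c z, c' z)) ⁻¹' {k} = c ⁻¹' {k.1} ∩ c' ⁻¹' {k.2} := by
    intro k; ext z; simp [Prod.ext_iff]
  refine ⟨fun k => ?_, fun k l hkl => ?_⟩
  · rw [hpre]; exact (h.measurableSet _).inter (hc' _)
  · rw [hpre, hpre]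
    exact ⟨(measure_mono Set.inter_subset_left).trans_lt (h.lt_top _ _ hkl).1,
      (measure_mono Set.inter_subset_left).trans_lt (h.lt_top _ _ hkl).2⟩

theorem IsStep.refine_right {κ' : Type*} {c' : Z → κ'}
    (h : IsStep ν c a) (hc' : ∀ k, MeasurableSet (c' ⁻¹' {k})) :
    IsStep ν (fun z => (c' z, c z)) (fun k l => a k.2 l.2) := by
  have hpre : ∀ k : κ' × κ, (fun z => (c' z, c z)) ⁻¹' {k} = c' ⁻¹' {k.1} ∩ c ⁻¹' {k.2} := by
    intro k; ext z; simp [Prod.ext_iff]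
  refine ⟨fun k => ?_, fun k l hkl => ?_⟩
  · rw [hpre]; exact (hc' _).inter (h.measurableSet _)
  · rw [hpre, hpre]
    exact ⟨(measure_mono Set.inter_subset_right).trans_lt (h.lt_top _ _ hkl).1,
      (measure_mono Set.inter_subset_right).trans_lt (h.lt_top _ _ hkl).2⟩

theorem IsStep.add_mul {b : κ → κ → ℝ} (h : IsStep ν c a) (h' : IsStep ν c b) (r : ℝ) :
    IsStep ν c (fun k l => a k l + r * b k l) := by
  refine ⟨h.measurableSet, fun k l hkl => ?_⟩
  by_cases ha : a k l = 0
  · refine h'.lt_top k l fun hb => hkl ?_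
    simp [ha, hb]
  · exact h.lt_top k l ha

end StepFunction

/-! ### Double integrals of step functions as Charlier polynomials of the cell counts. -/

section PathIntegral

variable {Ω Z : Type*} [MeasurableSpace Ω] [MeasurableSpace Z] {P : Measure Ω}
  {ν : Measure Z} {η : Ω → Measure Z}

theorem eLpNorm_two_sq {α : Type*} [MeasurableSpace α] (μ : Measure α) (f : α → ℝ) :
    eLpNorm f 2 μ ^ 2 = ∫⁻ x, ‖f x‖ₑ ^ 2 ∂μ := by
  have := eLpNorm_nnreal_pow_eq_lintegral (f := f) (μ := μ) (p := 2) (by simp)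
  simpa using this

theorem eLpNorm_two_sq_eq_integral {α : Type*} [MeasurableSpace α] {μ : Measure α} {f : α → ℝ}
    (hf : Integrable (fun x => f x ^ 2) μ) :
    eLpNorm f 2 μ ^ 2 = ENNReal.ofReal (∫ x, f x ^ 2 ∂μ) := by
  rw [eLpNorm_two_sq, ofReal_integral_eq_lintegral_ofReal hf (.of_forall fun x => sq_nonneg _)]
  refine lintegral_congr fun x => ?_
  rw [← enorm_pow, Real.enorm_of_nonneg (sq_nonneg _)]

theorem IsPoissonProcess.integral_comp_cellCount {κ : Type*} {E : Type*} [NormedAddCommGroup E]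
    [NormedSpace ℝ E] [Fintype κ] [IsProbabilityMeasure P] {c : Z → κ}
    (hη : IsPoissonProcess η ν P) (hc : ∀ k, MeasurableSet (c ⁻¹' {k})) (f : (κ → ℕ) → E) :
    ∫ ω, f (cellCount ν c (η ω)) ∂P = ∫ x, f x ∂(piPoisson (cellMean ν c)) := by
  rw [← hη.map_cellCount hc, integral_map (hη.measurable_cellCount hc).aemeasurable
    StronglyMeasurable.of_discrete.aestronglyMeasurable]

variable [SigmaFinite ν]

theorem IsPoissonProcess.ae_pathIntegral₂_add_mul [IsProbabilityMeasure P] (hη : IsPoissonProcess η ν P)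
    {f g : Z × Z → ℝ} (hf : Measurable f) (hfi : Integrable f (ν.prod ν)) (hg : Measurable g)
    (hgi : Integrable g (ν.prod ν)) (r : ℝ) :
    ∀ᵐ ω ∂P, pathIntegral₂ ν (η ω) (fun p => f p + r * g p) =
      pathIntegral₂ ν (η ω) f + r * pathIntegral₂ ν (η ω) g := by
  filter_upwards [hη.ae_pathNorm_lt_top hf hfi, hη.ae_pathNorm_lt_top hg hgi] with ω h1 h2
  exact pathIntegral₂_add_mul hf hg h1 h2 r

theorem IsPoissonProcess.ae_pathIntegral₂_sum [IsProbabilityMeasure P] (hη : IsPoissonProcess η ν P)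
    {ι : Type*} (s : Finset ι) {f : ι → Z × Z → ℝ} (hf : ∀ i, Measurable (f i))
    (hfi : ∀ i, Integrable (f i) (ν.prod ν)) :
    ∀ᵐ ω ∂P, pathIntegral₂ ν (η ω) (fun p => ∑ i ∈ s, f i p) =
      ∑ i ∈ s, pathIntegral₂ ν (η ω) (f i) := by
  classical
  induction s using Finset.induction_on with
  | empty => exact .of_forall fun ω => by simp [pathIntegral₂]
  | insert i s hi ih =>
    filter_upwards [ih, hη.ae_pathIntegral₂_add_mul (hf i) (hfi i)
      (Finset.measurable_sum s fun j _ => hf j) (integrable_finsetSum s fun j _ => hfi j) 1]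
      with ω h1 h2
    simp only [one_mul] at h2
    simp only [Finset.sum_insert hi]
    rw [h2, h1]

variable {κ : Type*} {c : Z → κ} {a : κ → κ → ℝ}

theorem IsPoissonProcess.ae_pathIntegral₂_stepTerm [Countable κ] [DecidableEq κ]
    (hη : IsPoissonProcess η ν P) (h : IsStep ν c a) (q : κ × κ) :
    ∀ᵐ ω ∂P, pathIntegral₂ ν (η ω) (stepTerm c a q) =
      a q.1 q.2 * (((cellCount ν c (η ω) q.1 : ℝ) * cellCount ν c (η ω) q.2
        - if q.1 = q.2 then (cellCount ν c (η ω) q.1 : ℝ) else 0)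
        - cellCount ν c (η ω) q.1 * cellMean ν c q.2 - cellCount ν c (η ω) q.2 * cellMean ν c q.1
        + cellMean ν c q.1 * cellMean ν c q.2) := by
  by_cases hq : a q.1 q.2 = 0
  · refine .of_forall fun ω => ?_
    simp [pathIntegral₂, stepTerm, hq]
  obtain ⟨hA, hC⟩ := h.lt_top _ _ hq
  filter_upwards [hη.proper, hη.ae_cellCount h.measurableSet] with ω hp hω
  have mA := h.measurableSet q.1
  have mC := h.measurableSet q.2
  have hAC := factorialSq_prod_add hp mA mC
  set A := c ⁻¹' {q.1}
  set C := c ⁻¹' {q.2}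
  have eA := hω _ hA
  have eC := hω _ hC
  have e1 : ∫ p, stepTerm c a q p ∂(factorialSq (η ω)) =
      a q.1 q.2 * ((cellCount ν c (η ω) q.1 : ℝ) * cellCount ν c (η ω) q.2
        - if q.1 = q.2 then (cellCount ν c (η ω) q.1 : ℝ) else 0) := by
    simp only [stepTerm]
    rw [integral_const_mul, integral_indicator_one (mA.prod mC)]
    congr 1
    rw [eA, eC] at hAC
    -- Two cells of a partition coincide or are disjoint, so the diagonal part of the product
    -- measure is the count of a single cell or zero.
    have e2 : η ω (A ∩ C) = ((if q.1 = q.2 then cellCount ν c (η ω) q.1 else 0 : ℕ) : ℝ≥0∞) := by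
      split_ifs with hkl
      · have : A = C := by simp only [A, C, hkl]
        rw [← this, Set.inter_self, eA]
      · have : A ∩ C = ∅ := by
          rw [← Set.disjoint_iff_inter_eq_empty]
          exact Disjoint.preimage _ (by simpa using hkl)
        simp [this]
    rw [e2] at hAC
    have e3 := congrArg ENNReal.toReal hAC
    rw [ENNReal.toReal_add _ (ENNReal.natCast_ne_top _)] at e3
    · simp only [ENNReal.toReal_natCast, ENNReal.toReal_mul] at e3
      rw [Measure.real]
      push_cast at e3
      split_ifs at e3 ⊢ <;> simp_all; linarith
    · intro htop
      rw [htop, top_add] at hAC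
      exact ENNReal.mul_ne_top (ENNReal.natCast_ne_top _) (ENNReal.natCast_ne_top _) hAC.symm
  have e4 : ∀ x y, stepTerm c a q (x, y) = a q.1 q.2 * (A.indicator 1 x * C.indicator 1 y) := by
    intro x y
    simp only [stepTerm]
    congr 1
    by_cases hx : x ∈ A <;> by_cases hy : y ∈ C <;> simp [A, C, hx, hy, Set.indicator]
  have rA : (η ω).real A = cellCount ν c (η ω) q.1 := by rw [Measure.real, eA]; simp
  have rC : (η ω).real C = cellCount ν c (η ω) q.2 := by rw [Measure.real, eC]; simp
  have nA : ν.real A = cellMean ν c q.1 := rfl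
  have nC : ν.real C = cellMean ν c q.2 := rfl
  have e5 : ∫ x, ∫ y, stepTerm c a q (x, y) ∂ν ∂(η ω) =
      a q.1 q.2 * (cellCount ν c (η ω) q.1 * cellMean ν c q.2) := by
    simp_rw [e4, integral_const_mul, integral_indicator_one mC, integral_mul_const,
      integral_indicator_one mA, rA, nC]
  have e6 : ∫ y, ∫ x, stepTerm c a q (x, y) ∂ν ∂(η ω) =
      a q.1 q.2 * (cellCount ν c (η ω) q.2 * cellMean ν c q.1) := by
    simp_rw [e4, integral_const_mul, integral_mul_const, integral_const_mul,
      integral_indicator_one mA, integral_indicator_one mC, rC, nA]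
    ring
  rw [pathIntegral₂, e1, e5, e6, h.integral_stepTerm]
  ring

/-- The bridge from the point process to finitely many independent Poisson variables; every later
computation with step kernels passes through it. -/
theorem IsPoissonProcess.ae_pathIntegral₂_stepFun [IsProbabilityMeasure P] [Fintype κ] [DecidableEq κ]
    (hη : IsPoissonProcess η ν P) (h : IsStep ν c a) :
    ∀ᵐ ω ∂P, pathIntegral₂ ν (η ω) (stepFun c a) =
      charlierPoly (cellMean ν c) a (cellCount ν c (η ω)) := by
  have h1 := hη.ae_pathIntegral₂_sum Finset.univ h.measurable_stepTerm h.integrable_stepTerm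
  have h2 := ae_all_iff.2 (hη.ae_pathIntegral₂_stepTerm h)
  filter_upwards [h1, h2] with ω h1 h2
  rw [stepFun_eq_sum, h1, Fintype.sum_prod_type, charlierPoly]
  exact Finset.sum_congr rfl fun k _ => Finset.sum_congr rfl fun l _ => h2 (k, l)

theorem IsPoissonProcess.memLp_pathIntegral₂_stepFun [IsProbabilityMeasure P] [Fintype κ]
    (hη : IsPoissonProcess η ν P) (h : IsStep ν c a) :
    MemLp (fun ω => pathIntegral₂ ν (η ω) (stepFun c a)) 2 P ∧
    eLpNorm (fun ω => pathIntegral₂ ν (η ω) (stepFun c a)) 2 P ≤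
      2 * eLpNorm (stepFun c a) 2 (ν.prod ν) := by
  classical
  have hae := hη.ae_pathIntegral₂_stepFun h
  set Q := charlierPoly (cellMean ν c) a with hQ
  have hX := hη.measurable_cellCount h.measurableSet
  have hQp : PolyBdd Q := PolyBdd.charlierPoly _ a
  have hQ2 : PolyBdd (fun x => Q x ^ 2) := by simpa only [sq] using hQp.mul hQp
  have hi : Integrable (fun ω => Q (cellCount ν c (η ω)) ^ 2) P := by
    have := hQ2.integrable (cellMean ν c)
    rw [← hη.map_cellCount h.measurableSet] at this
    exact this.comp_measurable hX
  have hsm : AEStronglyMeasurable (fun ω => Q (cellCount ν c (η ω))) P :=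
    ((measurable_of_countable Q).comp hX).aestronglyMeasurable
  refine ⟨(memLp_congr_ae hae).2 ((memLp_two_iff_integrable_sq hsm).2 hi), ?_⟩
  rw [eLpNorm_congr_ae hae]
  refine (ENNReal.pow_le_pow_left_iff two_ne_zero).1 ?_
  rw [mul_pow, eLpNorm_two_sq_eq_integral hi,
    eLpNorm_two_sq_eq_integral (f := stepFun c a) (h.comp (· ^ 2) (by simp)).integrable,
    hη.integral_comp_cellCount h.measurableSet (fun x => Q x ^ 2)]
  have h1 := integral_charlierPoly_sq_le (cellMean ν c) a
  rw [← h.integral_sq] at h1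
  have h0 : 0 ≤ ∫ p, stepFun c a p ^ 2 ∂(ν.prod ν) := integral_nonneg fun p => sq_nonneg _
  calc ENNReal.ofReal (∫ x, Q x ^ 2 ∂(piPoisson (cellMean ν c)))
      ≤ ENNReal.ofReal (4 * ∫ p, stepFun c a p ^ 2 ∂(ν.prod ν)) :=
        ENNReal.ofReal_le_ofReal (h1.trans (by linarith))
    _ = _ := by
        rw [ENNReal.ofReal_mul (by norm_num)]
        norm_num

end PathIntegral

/-! ### Density of step functions in `L²` and in `L¹ ∩ L²`. -/

section Density

variable {Z : Type*} [MeasurableSpace Z] {ν : Measure Z}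

/-- Rectangles form a π-system generating the product σ-algebra, and the sets over which the
integral vanishes are closed under complements and disjoint unions. -/
theorem ae_eq_zero_of_forall_setIntegral_prod_of_isFiniteMeasure [IsFiniteMeasure ν]
    {f : Z × Z → ℝ} (hf : Integrable f (ν.prod ν))
    (h : ∀ A C, MeasurableSet A → MeasurableSet C → ∫ p in A ×ˢ C, f p ∂(ν.prod ν) = 0) :
    f =ᵐ[ν.prod ν] 0 := by
  refine hf.ae_eq_zero_of_forall_setIntegral_eq_zero fun s hs _ => ?_
  have huniv : ∫ p, f p ∂(ν.prod ν) = 0 := by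
    have := h Set.univ Set.univ .univ .univ
    rwa [Set.univ_prod_univ, setIntegral_univ] at this
  induction s, hs using MeasurableSpace.induction_on_inter generateFrom_prod.symm isPiSystem_prod with
  | empty => simp
  | basic t ht =>
    obtain ⟨A, hA, C, hC, rfl⟩ := ht
    exact h A C hA hC
  | compl t ht ih =>
    have h1 := integral_add_compl ht hf
    rw [ih (measure_lt_top _ _), huniv, zero_add] at h1
    exact h1
  | iUnion t hd ht ih =>
    rw [integral_iUnion ht hd hf.integrableOn]
    simp [fun i => ih i (measure_lt_top _ _)]

theorem ae_eq_zero_of_forall_setIntegral_prod [SigmaFinite ν] {f : Z × Z → ℝ}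
    (hf : MemLp f 2 (ν.prod ν))
    (h : ∀ A C, MeasurableSet A → MeasurableSet C → ν A < ∞ → ν C < ∞ →
      ∫ p in A ×ˢ C, f p ∂(ν.prod ν) = 0) :
    f =ᵐ[ν.prod ν] 0 := by
  have hS : ∀ k, f =ᵐ[(ν.prod ν).restrict (spanningSets ν k ×ˢ spanningSets ν k)] 0 := by
    intro k
    have hSm := measurableSet_spanningSets ν k
    have hSf := measure_spanningSets_lt_top ν k
    rw [← Measure.prod_restrict]
    have : IsFiniteMeasure (ν.restrict (spanningSets ν k)) := ⟨by simpa using hSf⟩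
    refine ae_eq_zero_of_forall_setIntegral_prod_of_isFiniteMeasure ?_ fun A C hA hC => ?_
    · rw [Measure.prod_restrict]
      have : IsFiniteMeasure ((ν.prod ν).restrict (spanningSets ν k ×ˢ spanningSets ν k)) := by
        rw [← Measure.prod_restrict]; infer_instance
      exact (hf.restrict _).integrable one_le_two
    · rw [Measure.prod_restrict, Measure.restrict_restrict (hA.prod hC), Set.prod_inter_prod]
      exact h _ _ (hA.inter hSm) (hC.inter hSm)
        ((measure_mono Set.inter_subset_right).trans_lt hSf)
        ((measure_mono Set.inter_subset_right).trans_lt hSf)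
  have hU : ⋃ k, spanningSets ν k ×ˢ spanningSets ν k = Set.univ := by
    refine Set.eq_univ_of_forall fun p => ?_
    have h1 : ∀ z, ∃ k, z ∈ spanningSets ν k := fun z =>
      Set.mem_iUnion.1 (by rw [iUnion_spanningSets]; trivial)
    obtain ⟨i, hi⟩ := h1 p.1
    obtain ⟨j, hj⟩ := h1 p.2
    exact Set.mem_iUnion.2 ⟨max i j, monotone_spanningSets ν (le_max_left i j) hi,
      monotone_spanningSets ν (le_max_right i j) hj⟩
  have := (ae_restrict_iUnion_iff (μ := ν.prod ν)
    (fun k => spanningSets ν k ×ˢ spanningSets ν k) (fun p => f p = 0)).2 hS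
  rw [hU, Measure.restrict_univ] at this
  exact this

/-- Step functions on products of cells of finite measure. -/
def IsStepFun (ν : Measure Z) (ψ : Z × Z → ℝ) : Prop :=
  ∃ (κ : Type) (_ : Fintype κ) (c : Z → κ) (a : κ → κ → ℝ), IsStep ν c a ∧ ψ = stepFun c a

theorem IsStepFun.add_mul {ψ φ : Z × Z → ℝ} (hψ : IsStepFun ν ψ) (hφ : IsStepFun ν φ) (r : ℝ) :
    IsStepFun ν (fun p => ψ p + r * φ p) := by
  obtain ⟨κ, _, c, a, h, rfl⟩ := hψ
  obtain ⟨κ', _, c', a', h', rfl⟩ := hφ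
  exact ⟨κ × κ', inferInstance, fun z => (c z, c' z), _,
    (h.refine_left h'.measurableSet).add_mul (h'.refine_right h.measurableSet) r, rfl⟩

theorem measurableSet_preimage_decide {A : Set Z} [DecidablePred (· ∈ A)] (hA : MeasurableSet A)
    (b : Bool) : MeasurableSet ((fun z => decide (z ∈ A)) ⁻¹' {b}) := by
  cases b
  · convert hA.compl using 1; ext z; simp
  · convert hA using 1; ext z; simp

theorem isStepFun_indicator {A C : Set Z} (hA : MeasurableSet A) (hC : MeasurableSet C)
    (hAf : ν A < ∞) (hCf : ν C < ∞) : IsStepFun ν ((A ×ˢ C).indicator 1) := by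
  classical
  refine ⟨Bool × Bool, inferInstance, fun z => (decide (z ∈ A), decide (z ∈ C)),
    fun k l => if k.1 = true ∧ l.2 = true then 1 else 0, ⟨?_, ?_⟩, ?_⟩
  · rintro ⟨b, b'⟩
    convert (measurableSet_preimage_decide hA b).inter (measurableSet_preimage_decide hC b') using 1
    ext z; simp [Prod.ext_iff]
  · rintro ⟨b, b'⟩ ⟨d, d'⟩ h
    have h1 : b = true ∧ d' = true := by
      by_contra h2
      exact h (if_neg h2)
    obtain ⟨rfl, rfl⟩ := h1
    refine ⟨(measure_mono ?_).trans_lt hAf, (measure_mono ?_).trans_lt hCf⟩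
    · intro z hz; simp [Prod.ext_iff] at hz; exact hz.1
    · intro z hz; simp [Prod.ext_iff] at hz; exact hz.2
  · funext p
    simp [stepFun, Set.indicator, Set.mem_prod]

theorem IsStepFun.of_restrict {S : Set Z} (hS : MeasurableSet S) (hSf : ν S < ∞)
    {ψ : Z × Z → ℝ} (hψ : IsStepFun (ν.restrict S) ψ) :
    IsStepFun ν ((S ×ˢ S).indicator ψ) := by
  classical
  obtain ⟨κ, _, c, a, h, rfl⟩ := hψ
  refine ⟨κ × Bool, inferInstance, fun z => (c z, decide (z ∈ S)),
    fun k l => if k.2 = true ∧ l.2 = true then a k.1 l.1 else 0, ⟨?_, ?_⟩, ?_⟩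
  · rintro ⟨k, b⟩
    convert (h.measurableSet k).inter (measurableSet_preimage_decide hS b) using 1
    ext z; simp [Prod.ext_iff]
  · rintro ⟨k, b⟩ ⟨l, b'⟩ hkl
    have h1 : b = true ∧ b' = true := by
      by_contra h2
      exact hkl (if_neg h2)
    obtain ⟨rfl, rfl⟩ := h1
    refine ⟨(measure_mono ?_).trans_lt hSf, (measure_mono ?_).trans_lt hSf⟩ <;>
    · intro z hz; simp [Prod.ext_iff] at hz; exact hz.2
  · funext p
    simp [stepFun, Set.indicator, Set.mem_prod]

theorem IsStepFun.memLp_two [SigmaFinite ν] {ψ : Z × Z → ℝ} (hψ : IsStepFun ν ψ) :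
    MemLp ψ 2 (ν.prod ν) := by
  obtain ⟨κ, _, c, a, h, rfl⟩ := hψ
  exact h.memLp_two

theorem IsStepFun.measurable {ψ : Z × Z → ℝ} (hψ : IsStepFun ν ψ) : Measurable ψ := by
  obtain ⟨κ, _, c, a, h, rfl⟩ := hψ
  exact h.measurable

theorem IsStepFun.integrable [SigmaFinite ν] {ψ : Z × Z → ℝ} (hψ : IsStepFun ν ψ) :
    Integrable ψ (ν.prod ν) := by
  obtain ⟨κ, _, c, a, h, rfl⟩ := hψ
  exact h.integrable

/-- Step functions form a subspace of `L²` containing the indicators of rectangles. A function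
orthogonal to all of these vanishes, so the subspace is dense. -/
theorem exists_isStepFun_eLpNorm_sub_le_of_isFiniteMeasure [IsFiniteMeasure ν] {f : Z × Z → ℝ}
    (hf : MemLp f 2 (ν.prod ν)) {ε : ℝ≥0∞} (hε : ε ≠ 0) :
    ∃ ψ, IsStepFun ν ψ ∧ eLpNorm (fun p => f p - ψ p) 2 (ν.prod ν) ≤ ε := by
  let V : Submodule ℝ (Lp ℝ 2 (ν.prod ν)) :=
    { carrier := {F | ∃ ψ, IsStepFun ν ψ ∧ F =ᵐ[ν.prod ν] ψ}
      zero_mem' := by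
        refine ⟨(∅ ×ˢ ∅ : Set (Z × Z)).indicator 1, isStepFun_indicator .empty .empty (by simp)
          (by simp), ?_⟩
        filter_upwards [Lp.coeFn_zero ℝ 2 (ν.prod ν)] with p hp
        exact hp.trans (by simp)
      add_mem' := by
        rintro F G ⟨ψ, hψ, hF⟩ ⟨φ, hφ, hG⟩
        refine ⟨_, hψ.add_mul hφ 1, ?_⟩
        filter_upwards [hF, hG, Lp.coeFn_add F G] with p h1 h2 h3
        rw [h3, Pi.add_apply, h1, h2, one_mul]
      smul_mem' := by
        rintro r F ⟨ψ, hψ, hF⟩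
        refine ⟨_, hψ.add_mul hψ (r - 1), ?_⟩
        filter_upwards [hF, Lp.coeFn_smul r F] with p h1 h2
        rw [h2, Pi.smul_apply, h1, smul_eq_mul]
        ring }
  have hV : Vᗮ = ⊥ := by
    rw [eq_bot_iff]
    intro F hF
    rw [Submodule.mem_bot]
    rw [Lp.eq_zero_iff_ae_eq_zero]
    refine ae_eq_zero_of_forall_setIntegral_prod (Lp.memLp F) fun A C hA hC hAf hCf => ?_
    set s := A ×ˢ C
    have hs : MeasurableSet s := hA.prod hC
    have h1 : indicatorConstLp 2 hs (measure_ne_top (ν.prod ν) s) (1 : ℝ) ∈ V :=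
      ⟨_, isStepFun_indicator hA hC hAf hCf, by
        filter_upwards [indicatorConstLp_coeFn (p := 2) (hs := hs)
          (hμs := measure_ne_top (ν.prod ν) s) (c := (1 : ℝ))] with p hp
        rw [hp]; rfl⟩
    have h2 := hF _ h1
    rwa [L2.inner_indicatorConstLp_one] at h2
  have hcl : V.topologicalClosure = ⊤ := Submodule.topologicalClosure_eq_top_iff.2 hV
  have hmem : hf.toLp f ∈ closure (V : Set (Lp ℝ 2 (ν.prod ν))) := by
    rw [← Submodule.topologicalClosure_coe, hcl]; trivial
  obtain ⟨G, ⟨ψ, hψ, hG⟩, hlt⟩ := EMetric.mem_closure_iff.1 hmem ε (pos_iff_ne_zero.2 hε)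
  refine ⟨ψ, hψ, ?_⟩
  rw [Lp.edist_def] at hlt
  refine (le_of_eq (eLpNorm_congr_ae ?_)).trans hlt.le
  filter_upwards [hG, hf.coeFn_toLp] with p h1 h2
  rw [Pi.sub_apply, h1, h2]

/-- Approximation in `L²` on a square of finite measure. -/
theorem exists_isStepFun_eLpNorm_indicator_sub_le [SigmaFinite ν] {f : Z × Z → ℝ} {S : Set Z}
    (hS : MeasurableSet S) (hSf : ν S < ∞)
    (hf : MemLp f 2 (ν.prod ν)) {ε : ℝ≥0∞} (hε : ε ≠ 0) :
    ∃ ψ, IsStepFun ν ψ ∧ (∀ p ∉ S ×ˢ S, ψ p = 0) ∧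
      eLpNorm (fun p => (S ×ˢ S).indicator f p - ψ p) 2 (ν.prod ν) ≤ ε := by
  have : IsFiniteMeasure (ν.restrict S) := ⟨by simpa using hSf⟩
  have hf' : MemLp f 2 ((ν.restrict S).prod (ν.restrict S)) := by
    rw [Measure.prod_restrict]; exact hf.restrict _
  obtain ⟨ψ, hψ, hle⟩ := exists_isStepFun_eLpNorm_sub_le_of_isFiniteMeasure hf' hε
  refine ⟨_, hψ.of_restrict hS hSf, fun p hp => Set.indicator_of_notMem hp _, ?_⟩
  have : (fun p => (S ×ˢ S).indicator f p - (S ×ˢ S).indicator ψ p) =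
      (S ×ˢ S).indicator (fun p => f p - ψ p) := by
    rw [Set.indicator_sub]
  rw [this, eLpNorm_indicator_eq_eLpNorm_restrict (hS.prod hS), ← Measure.prod_restrict]
  exact hle

theorem tendsto_setLIntegral_compl_spanningSets [SigmaFinite ν] {h : Z × Z → ℝ≥0∞}
    (hh : ∫⁻ p, h p ∂(ν.prod ν) ≠ ∞) :
    Tendsto (fun k => ∫⁻ p in (spanningSets ν k ×ˢ spanningSets ν k)ᶜ, h p ∂(ν.prod ν))
      atTop (𝓝 0) := by
  set T := fun k => (spanningSets ν k ×ˢ spanningSets ν k)ᶜ with hT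
  have hTm : ∀ k, MeasurableSet (T k) := fun k =>
    ((measurableSet_spanningSets ν k).prod (measurableSet_spanningSets ν k)).compl
  have hanti : Antitone T := fun i j hij => Set.compl_subset_compl.2
    (Set.prod_mono (monotone_spanningSets ν hij) (monotone_spanningSets ν hij))
  have hI : ⋂ k, T k = ∅ := by
    refine Set.eq_empty_of_forall_notMem fun p hp => ?_
    have h1 : ∀ z, ∃ k, z ∈ spanningSets ν k := fun z =>
      Set.mem_iUnion.1 (by rw [iUnion_spanningSets]; trivial)
    obtain ⟨i, hi⟩ := h1 p.1
    obtain ⟨j, hj⟩ := h1 p.2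
    exact Set.mem_iInter.1 hp (max i j) ⟨monotone_spanningSets ν (le_max_left i j) hi,
      monotone_spanningSets ν (le_max_right i j) hj⟩
  have h1 := tendsto_measure_iInter_atTop (μ := (ν.prod ν).withDensity h)
    (fun k => (hTm k).nullMeasurableSet) hanti ⟨0, by
      rw [withDensity_apply _ (hTm 0)]
      exact ((setLIntegral_le_lintegral _ _).trans_lt (lt_top_iff_ne_top.2 hh)).ne⟩
  rw [hI, measure_empty] at h1
  exact h1.congr fun k => withDensity_apply _ (hTm k)

theorem tendsto_eLpNorm_indicator_compl_spanningSets [SigmaFinite ν] {f : Z × Z → ℝ} {q : ℝ≥0}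
    (hq : q ≠ 0) (hf : MemLp f q (ν.prod ν)) :
    Tendsto (fun k => eLpNorm ((spanningSets ν k ×ˢ spanningSets ν k)ᶜ.indicator f) q (ν.prod ν))
      atTop (𝓝 0) := by
  have hfin : ∫⁻ p, ‖f p‖ₑ ^ (q : ℝ) ∂(ν.prod ν) ≠ ∞ := by
    rw [← eLpNorm_nnreal_pow_eq_lintegral hq]
    exact ENNReal.rpow_ne_top_of_nonneg q.2 hf.2.ne
  have h1 := (tendsto_setLIntegral_compl_spanningSets hfin).ennrpow_const ((q : ℝ)⁻¹)
  rw [ENNReal.zero_rpow_of_pos (inv_pos.2 (NNReal.coe_pos.2 (pos_iff_ne_zero.2 hq)))] at h1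
  refine h1.congr fun k => ?_
  have hm : MeasurableSet (spanningSets ν k ×ˢ spanningSets ν k)ᶜ :=
    ((measurableSet_spanningSets ν k).prod (measurableSet_spanningSets ν k)).compl
  rw [eLpNorm_indicator_eq_eLpNorm_restrict hm, ← eLpNorm_nnreal_pow_eq_lintegral hq,
    ← ENNReal.rpow_mul, mul_inv_cancel₀ (NNReal.coe_ne_zero.2 hq), ENNReal.rpow_one]

theorem exists_isStepFun_eLpNorm_sub_le [SigmaFinite ν] {f : Z × Z → ℝ}
    (hf1 : MemLp f 1 (ν.prod ν)) (hf2 : MemLp f 2 (ν.prod ν)) {ε : ℝ≥0∞} (hε : ε ≠ 0) :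
    ∃ ψ, IsStepFun ν ψ ∧ eLpNorm (fun p => f p - ψ p) 1 (ν.prod ν) ≤ ε ∧
      eLpNorm (fun p => f p - ψ p) 2 (ν.prod ν) ≤ ε := by
  have hε2 : 0 < ε / 2 := ENNReal.half_pos hε
  have t1 := tendsto_eLpNorm_indicator_compl_spanningSets (q := 1) one_ne_zero
    (by simpa using hf1)
  have t2 := tendsto_eLpNorm_indicator_compl_spanningSets (q := 2) two_ne_zero
    (by simpa using hf2)
  obtain ⟨k, hk1, hk2⟩ := ((t1.eventually (gt_mem_nhds hε2)).and
    (t2.eventually (gt_mem_nhds hε2))).exists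
  set S := spanningSets ν k
  have hS : MeasurableSet S := measurableSet_spanningSets ν k
  have hSf : ν S < ∞ := measure_spanningSets_lt_top ν k
  -- On a square of finite measure the `L¹` norm is at most `(ν ⊗ ν)(S × S)^{1/2}` times the `L²`
  -- norm. As `K` dominates both this constant and `1`, an `L²` error of `ε / 2 / K` is an error of
  -- at most `ε / 2` in both norms.
  set K : ℝ≥0∞ := 1 + (ν.prod ν) (S ×ˢ S) ^ (2⁻¹ : ℝ) with hK
  have hKtop : K ≠ ∞ := by
    refine ENNReal.add_ne_top.2 ⟨ENNReal.one_ne_top, ENNReal.rpow_ne_top_of_nonneg (by norm_num) ?_⟩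
    rw [Measure.prod_prod]
    exact (ENNReal.mul_lt_top hSf hSf).ne
  have hK0 : K ≠ 0 := by simp [hK]
  obtain ⟨ψ, hψ, hψ0, hle⟩ := exists_isStepFun_eLpNorm_indicator_sub_le hS hSf hf2
    (ε := ε / 2 / K) (ENNReal.div_pos hε2.ne' hKtop).ne'
  set d : Z × Z → ℝ := fun p => (S ×ˢ S).indicator f p - ψ p with hd
  have hdm : AEStronglyMeasurable d (ν.prod ν) :=
    (hf2.1.indicator (hS.prod hS)).sub hψ.measurable.aestronglyMeasurable
  have hcm : AEStronglyMeasurable ((S ×ˢ S)ᶜ.indicator f) (ν.prod ν) :=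
    hf2.1.indicator (hS.prod hS).compl
  have hsum : (fun p => f p - ψ p) = fun p => (S ×ˢ S)ᶜ.indicator f p + d p := by
    funext p
    by_cases hp : p ∈ S ×ˢ S <;> simp [hd, hp, Set.indicator, sub_eq_add_neg]
  have hd2 : eLpNorm d 2 (ν.prod ν) ≤ ε / 2 := hle.trans
    (ENNReal.div_le_of_le_mul (le_mul_of_one_le_right zero_le (by simp [hK])))
  have hd1 : eLpNorm d 1 (ν.prod ν) ≤ ε / 2 := by
    have hdi : d = (S ×ˢ S).indicator d := by
      funext p
      by_cases hp : p ∈ S ×ˢ S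
      · rw [Set.indicator_of_mem hp]
      · rw [Set.indicator_of_notMem hp, hd]
        simp [hp, hψ0 p hp]
    rw [hdi, eLpNorm_indicator_eq_eLpNorm_restrict (hS.prod hS)]
    refine (eLpNorm_le_eLpNorm_mul_rpow_measure_univ one_le_two hdm.restrict).trans ?_
    rw [← eLpNorm_indicator_eq_eLpNorm_restrict (hS.prod hS), ← hdi, Measure.restrict_apply_univ]
    refine (mul_le_mul' hle (?_ : _ ≤ K)).trans (le_of_eq (ENNReal.div_mul_cancel hK0 hKtop))
    rw [hK]
    refine le_trans (le_of_eq ?_) le_add_self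
    congr 1
    norm_num
  refine ⟨ψ, hψ, ?_, ?_⟩
  · rw [hsum]
    refine (eLpNorm_add_le hcm hdm le_rfl).trans ?_
    rw [← ENNReal.add_halves ε]
    exact add_le_add (by simpa using hk1.le) hd1
  · rw [hsum]
    refine (eLpNorm_add_le hcm hdm one_le_two).trans ?_
    rw [← ENNReal.add_halves ε]
    exact add_le_add (by simpa using hk2.le) hd2

end Density

/-! ### The double Poisson integral on `L²`. -/

section Extension

variable {Ω Z : Type*} [MeasurableSpace Ω] [MeasurableSpace Z] {P : Measure Ω}
  {ν : Measure Z} {η : Ω → Measure Z} [IsProbabilityMeasure P] [SigmaFinite ν]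

theorem exists_isStepFun_eLpNorm_two_sub_le {f : Z × Z → ℝ} (hf : MemLp f 2 (ν.prod ν))
    {ε : ℝ≥0∞} (hε : ε ≠ 0) :
    ∃ ψ, IsStepFun ν ψ ∧ eLpNorm (fun p => f p - ψ p) 2 (ν.prod ν) ≤ ε := by
  have hε2 : 0 < ε / 2 := ENNReal.half_pos hε
  have t2 := tendsto_eLpNorm_indicator_compl_spanningSets (q := 2) two_ne_zero
    (by simpa using hf)
  obtain ⟨k, hk⟩ := (t2.eventually (gt_mem_nhds hε2)).exists
  set S := spanningSets ν k
  have hS : MeasurableSet S := measurableSet_spanningSets ν k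
  obtain ⟨ψ, hψ, -, hle⟩ := exists_isStepFun_eLpNorm_indicator_sub_le hS
    (measure_spanningSets_lt_top ν k) hf hε2.ne'
  refine ⟨ψ, hψ, ?_⟩
  have hsum : (fun p => f p - ψ p) = fun p => (S ×ˢ S)ᶜ.indicator f p +
      ((S ×ˢ S).indicator f p - ψ p) := by
    funext p
    by_cases hp : p ∈ S ×ˢ S <;> simp [hp, Set.indicator, sub_eq_add_neg]
  rw [hsum]
  refine (eLpNorm_add_le (hf.1.indicator (hS.prod hS).compl)
    ((hf.1.indicator (hS.prod hS)).sub hψ.measurable.aestronglyMeasurable) one_le_two).trans ?_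
  rw [← ENNReal.add_halves ε]
  exact add_le_add (by simpa using hk.le) hle

theorem IsPoissonProcess.ae_pathIntegral₂_sub (hη : IsPoissonProcess η ν P)
    {f g : Z × Z → ℝ} (hf : Measurable f) (hfi : Integrable f (ν.prod ν)) (hg : Measurable g)
    (hgi : Integrable g (ν.prod ν)) :
    ∀ᵐ ω ∂P, pathIntegral₂ ν (η ω) (fun p => f p - g p) =
      pathIntegral₂ ν (η ω) f - pathIntegral₂ ν (η ω) g := by
  filter_upwards [hη.ae_pathIntegral₂_add_mul hf hfi hg hgi (-1)] with ω hω
  simpa only [neg_one_mul, ← sub_eq_add_neg] using hω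

theorem IsPoissonProcess.eLpNorm_one_pathIntegral₂_sub_le (hη : IsPoissonProcess η ν P)
    {f g : Z × Z → ℝ} (hf : Measurable f) (hfi : Integrable f (ν.prod ν)) (hg : Measurable g)
    (hgi : Integrable g (ν.prod ν)) :
    eLpNorm (fun ω => pathIntegral₂ ν (η ω) f - pathIntegral₂ ν (η ω) g) 1 P ≤
      4 * eLpNorm (fun p => f p - g p) 1 (ν.prod ν) := by
  have h1 := hη.ae_pathIntegral₂_sub hf hfi hg hgi
  rw [eLpNorm_congr_ae (Filter.EventuallyEq.symm h1), eLpNorm_one_eq_lintegral_enorm,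
    eLpNorm_one_eq_lintegral_enorm, ← (hη.pathNorm_ae_eq (f := fun p => f p - g p) (hf.sub hg)).2]
  exact lintegral_mono fun ω => enorm_pathIntegral₂_le _ _ _

theorem IsPoissonProcess.memLp_pathIntegral₂ (hη : IsPoissonProcess η ν P) {ψ : Z × Z → ℝ}
    (hψ : IsStepFun ν ψ) : MemLp (fun ω => pathIntegral₂ ν (η ω) ψ) 2 P := by
  obtain ⟨κ, _, c, a, h, rfl⟩ := hψ
  exact (hη.memLp_pathIntegral₂_stepFun h).1

theorem IsPoissonProcess.eLpNorm_two_pathIntegral₂_sub_le (hη : IsPoissonProcess η ν P)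
    {ψ φ : Z × Z → ℝ} (hψ : IsStepFun ν ψ) (hφ : IsStepFun ν φ) :
    eLpNorm (fun ω => pathIntegral₂ ν (η ω) ψ - pathIntegral₂ ν (η ω) φ) 2 P ≤
      2 * eLpNorm (fun p => ψ p - φ p) 2 (ν.prod ν) := by
  have h1 := hη.ae_pathIntegral₂_sub hψ.measurable hψ.integrable hφ.measurable hφ.integrable
  rw [eLpNorm_congr_ae (Filter.EventuallyEq.symm h1)]
  have h2 := hψ.add_mul hφ (-1)
  simp only [neg_one_mul, ← sub_eq_add_neg] at h2
  obtain ⟨κ, _, c, a, h, h3⟩ := h2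
  rw [h3]
  exact (hη.memLp_pathIntegral₂_stepFun h).2

/-- Integrals of approximating step functions are Cauchy in `L²(P)` by the `L²` bound, so
`poissonIntegral₂` never takes its default value on `L²` kernels. -/
theorem IsPoissonProcess.exists_isPoissonIntegral₂ (hη : IsPoissonProcess η ν P) {f : Z × Z → ℝ}
    (hf : MemLp f 2 (ν.prod ν)) : ∃ F, IsPoissonIntegral₂ P ν η f F := by
  have h1 : ∀ k : ℕ, ∃ ψ, IsStepFun ν ψ ∧
      eLpNorm (fun p => f p - ψ p) 2 (ν.prod ν) ≤ ((k : ℝ≥0∞) + 1)⁻¹ := fun k =>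
    exists_isStepFun_eLpNorm_two_sub_le hf (by simp)
  choose ψ hψ hle using h1
  have hψf : ∀ k, eLpNorm (fun p => ψ k p - f p) 2 (ν.prod ν) ≤ ((k : ℝ≥0∞) + 1)⁻¹ := fun k => by
    have : (fun p => ψ k p - f p) = -(fun p => f p - ψ k p) := by funext p; simp
    rw [this, eLpNorm_neg]; exact hle k
  have hlim : Tendsto (fun k : ℕ => ((k : ℝ≥0∞) + 1)⁻¹) atTop (𝓝 0) := by
    simpa [Function.comp_def] using
      ENNReal.tendsto_inv_nat_nhds_zero.comp (tendsto_add_atTop_nat 1)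
  have hmem := fun k => hη.memLp_pathIntegral₂ (hψ k)
  set I : ℕ → Lp ℝ 2 P := fun k => (hmem k).toLp _ with hI
  have hdist : ∀ j k, edist (I j) (I k) ≤ 2 * (((j : ℝ≥0∞) + 1)⁻¹ + ((k : ℝ≥0∞) + 1)⁻¹) := by
    intro j k
    rw [hI, Lp.edist_toLp_toLp]
    refine (hη.eLpNorm_two_pathIntegral₂_sub_le (hψ j) (hψ k)).trans (mul_le_mul_right ?_ 2)
    have : (fun p => ψ j p - ψ k p) = fun p => (ψ j p - f p) + (f p - ψ k p) := by
      funext p; ring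
    rw [this]
    exact (eLpNorm_add_le ((hψ j).measurable.aestronglyMeasurable.sub hf.1)
      (hf.1.sub (hψ k).measurable.aestronglyMeasurable) one_le_two).trans
      (add_le_add (hψf j) (hle k))
  have hC : CauchySeq I := by
    refine EMetric.cauchySeq_iff_le_tendsto_0.2
      ⟨fun N => 2 * (((N : ℝ≥0∞) + 1)⁻¹ + ((N : ℝ≥0∞) + 1)⁻¹), fun n m N hn hm => ?_, ?_⟩
    · refine (hdist n m).trans (mul_le_mul_right (add_le_add ?_ ?_) 2) <;>
      · refine ENNReal.inv_le_inv.2 (add_le_add ?_ le_rfl)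
        exact_mod_cast ‹_›
    · simpa using ENNReal.Tendsto.const_mul (a := 2) (hlim.add hlim) (Or.inr (by simp))
  obtain ⟨G, hG⟩ := cauchySeq_tendsto_of_complete hC
  refine ⟨G, Lp.memLp G, ψ, fun k => ⟨(hψ k).measurable,
    memLp_one_iff_integrable.2 (hψ k).integrable, (hψ k).memLp_two⟩,
    tendsto_of_tendsto_of_tendsto_of_le_of_le tendsto_const_nhds hlim (fun _ => zero_le) hψf, ?_⟩
  rw [tendsto_iff_edist_tendsto_0] at hG
  refine hG.congr fun k => ?_
  rw [Lp.edist_def]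
  refine eLpNorm_congr_ae ?_
  filter_upwards [(hmem k).coeFn_toLp] with ω hω
  rw [Pi.sub_apply, hI]
  simp only
  rw [hω]

theorem IsPoissonProcess.isPoissonIntegral₂ (hη : IsPoissonProcess η ν P) {f : Z × Z → ℝ}
    (hf : MemLp f 2 (ν.prod ν)) : IsPoissonIntegral₂ P ν η f (poissonIntegral₂ P ν η f) := by
  have h := hη.exists_isPoissonIntegral₂ hf
  rw [poissonIntegral₂, dif_pos h]
  exact h.choose_spec

/-- Comparison of the double Poisson integral with that of a step function. -/
theorem IsPoissonProcess.eLpNorm_poissonIntegral₂_sub_le (hη : IsPoissonProcess η ν P)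
    {f : Z × Z → ℝ} (hf : MemLp f 2 (ν.prod ν)) {ψ : Z × Z → ℝ} (hψ : IsStepFun ν ψ) :
    eLpNorm (fun ω => poissonIntegral₂ P ν η f ω - pathIntegral₂ ν (η ω) ψ) 1 P ≤
      2 * eLpNorm (fun p => f p - ψ p) 2 (ν.prod ν) := by
  obtain ⟨hFm, φ, hφ, hφf, hφF⟩ := hη.isPoissonIntegral₂ hf
  set F := poissonIntegral₂ P ν η f
  refine ENNReal.le_of_forall_pos_le_add fun ε hε _ => ?_
  -- The three comparisons below cost `ε/9`, `4 · ε/9` and `2 · (ε/9 + ε/9)`, and `1 + 4 + 4 = 9`.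
  have hε9 : (0 : ℝ≥0∞) < ε / 9 := ENNReal.div_pos (by simpa using hε.ne') (by simp)
  obtain ⟨k, hk1, hk2⟩ := ((hφf.eventually (gt_mem_nhds hε9)).and
    (hφF.eventually (gt_mem_nhds hε9))).exists
  obtain ⟨hm, h1, h2⟩ := hφ k
  -- The function `φ k` is an arbitrary element of `L¹ ∩ L²`, for which only the `L¹` bound of the
  -- path integral is at hand. A step function close to it in both norms gives access to the `L²`
  -- bound.
  obtain ⟨ψ', hψ', hle1, hle2⟩ := exists_isStepFun_eLpNorm_sub_le h1 h2 hε9.ne'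
  have hint : Integrable (φ k) (ν.prod ν) := memLp_one_iff_integrable.1 h1
  have a0 := hη.aestronglyMeasurable_pathIntegral₂ hm hint
  have a1 := hη.aestronglyMeasurable_pathIntegral₂ hψ'.measurable hψ'.integrable
  have a2 := hη.aestronglyMeasurable_pathIntegral₂ hψ.measurable hψ.integrable
  have hsplit : (fun ω => F ω - pathIntegral₂ ν (η ω) ψ) = fun ω =>
      ((F ω - pathIntegral₂ ν (η ω) (φ k)) +
        (pathIntegral₂ ν (η ω) (φ k) - pathIntegral₂ ν (η ω) ψ')) +
      (pathIntegral₂ ν (η ω) ψ' - pathIntegral₂ ν (η ω) ψ) := by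
    funext ω; ring
  have b1 : eLpNorm (fun ω => F ω - pathIntegral₂ ν (η ω) (φ k)) 1 P ≤ ε / 9 := by
    have : (fun ω => F ω - pathIntegral₂ ν (η ω) (φ k)) =
        -(fun ω => pathIntegral₂ ν (η ω) (φ k) - F ω) := by funext ω; simp
    rw [this, eLpNorm_neg]
    exact (eLpNorm_le_eLpNorm_of_exponent_le one_le_two (a0.sub hFm.1)).trans hk2.le
  have b2 : eLpNorm (fun ω => pathIntegral₂ ν (η ω) (φ k) - pathIntegral₂ ν (η ω) ψ') 1 P ≤
      4 * (ε / 9) :=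
    (hη.eLpNorm_one_pathIntegral₂_sub_le hm hint hψ'.measurable hψ'.integrable).trans
      (mul_le_mul_right hle1 4)
  have b3 : eLpNorm (fun ω => pathIntegral₂ ν (η ω) ψ' - pathIntegral₂ ν (η ω) ψ) 1 P ≤
      2 * (ε / 9 + ε / 9 + eLpNorm (fun p => f p - ψ p) 2 (ν.prod ν)) := by
    refine (eLpNorm_le_eLpNorm_of_exponent_le one_le_two (a1.sub a2)).trans
      ((hη.eLpNorm_two_pathIntegral₂_sub_le hψ' hψ).trans (mul_le_mul_right ?_ 2))
    have e1 : (fun p => ψ' p - ψ p) = fun p =>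
        ((-(fun p => φ k p - ψ' p)) p + (φ k p - f p)) + (f p - ψ p) := by
      funext p; simp only [Pi.neg_apply]; ring
    rw [e1]
    have c1 : AEStronglyMeasurable (-(fun p => φ k p - ψ' p)) (ν.prod ν) :=
      (hm.sub hψ'.measurable).neg.aestronglyMeasurable
    have c2 : AEStronglyMeasurable (fun p => φ k p - f p) (ν.prod ν) :=
      hm.aestronglyMeasurable.sub hf.1
    refine (eLpNorm_add_le (c1.add c2) (hf.1.sub hψ.measurable.aestronglyMeasurable)
      one_le_two).trans (add_le_add ((eLpNorm_add_le c1 c2 one_le_two).trans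
        (add_le_add ?_ hk1.le)) le_rfl)
    rw [eLpNorm_neg]; exact hle2
  rw [hsplit]
  refine (eLpNorm_add_le ((hFm.1.sub a0).add (a0.sub a1)) (a1.sub a2) le_rfl).trans
    ((add_le_add ((eLpNorm_add_le (hFm.1.sub a0) (a0.sub a1) le_rfl).trans
      (add_le_add b1 b2)) b3).trans (le_of_eq ?_))
  have h9 : (ε : ℝ≥0∞) = 9 * (ε / 9) := (ENNReal.mul_div_cancel (by simp) (by simp)).symm
  conv_rhs => rw [h9]
  ring

theorem IsPoissonProcess.poissonIntegral₂_ae_eq_zero (hη : IsPoissonProcess η ν P)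
    {f : Z × Z → ℝ} (hf : f =ᵐ[ν.prod ν] 0) : poissonIntegral₂ P ν η f =ᵐ[P] 0 := by
  have hf2 : MemLp f 2 (ν.prod ν) := (memLp_congr_ae hf).2 MemLp.zero
  -- The indicator of an empty rectangle serves as the zero step function.
  have h0 : IsStepFun ν ((∅ ×ˢ ∅ : Set (Z × Z)).indicator 1) :=
    isStepFun_indicator .empty .empty (by simp) (by simp)
  have h1 := hη.eLpNorm_poissonIntegral₂_sub_le hf2 h0
  have h2 : eLpNorm (fun p => f p - (∅ ×ˢ ∅ : Set (Z × Z)).indicator 1 p) 2 (ν.prod ν) = 0 := by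
    rw [eLpNorm_congr_ae (g := 0)]
    · simp
    · filter_upwards [hf] with p hp
      simp [hp]
  rw [h2, mul_zero, nonpos_iff_eq_zero] at h1
  have h3 : ∀ ω, pathIntegral₂ ν (η ω) ((∅ ×ˢ ∅ : Set (Z × Z)).indicator 1) = 0 := fun ω => by
    simp [pathIntegral₂]
  simp only [h3, sub_zero] at h1
  exact (eLpNorm_eq_zero_iff (hη.isPoissonIntegral₂ hf2).1.1 one_ne_zero).1 h1

end Extension

/-! ### Contractions of kernels, and vanishing of the limit kernel. -/

section Kernels

theorem tendsto_zero_of_tendsto_sq {ι : Type*} {l : Filter ι} {x : ι → ℝ≥0∞}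
    (h : Tendsto (fun n => x n ^ 2) l (𝓝 0)) : Tendsto x l (𝓝 0) := by
  have h1 := h.ennrpow_const (2⁻¹ : ℝ)
  rw [ENNReal.zero_rpow_of_pos (by norm_num)] at h1
  refine h1.congr fun n => ?_
  rw [← ENNReal.rpow_natCast, ← ENNReal.rpow_mul]
  norm_num

theorem enorm_integral_mul_le {α : Type*} [MeasurableSpace α] {μ : Measure α} {f g : α → ℝ}
    (hf : AEStronglyMeasurable f μ) (hg : AEStronglyMeasurable g μ) :
    ‖∫ x, f x * g x ∂μ‖ₑ ≤ eLpNorm f 2 μ * eLpNorm g 2 μ := by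
  refine (enorm_integral_le_lintegral_enorm _).trans ?_
  have h := eLpNorm_smul_le_mul_eLpNorm (p := 2) (q := 2) (r := 1) hg hf
  rw [eLpNorm_one_eq_lintegral_enorm] at h
  exact h

theorem sq_lintegral_le {α : Type*} [MeasurableSpace α] {μ : Measure α} {S : Set α}
    {f : α → ℝ≥0∞} (hf : AEMeasurable f (μ.restrict S)) :
    (∫⁻ x in S, f x ∂μ) ^ 2 ≤ μ S * ∫⁻ x in S, f x ^ 2 ∂μ := by
  have h := ENNReal.lintegral_mul_le_Lp_mul_Lq (μ.restrict S) Real.HolderConjugate.two_two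
    (aemeasurable_const (b := (1 : ℝ≥0∞))) hf
  have h2 := pow_le_pow_left' h 2
  rw [mul_pow, ← ENNReal.rpow_natCast (_ ^ _), ← ENNReal.rpow_mul,
    ← ENNReal.rpow_natCast (_ ^ _), ← ENNReal.rpow_mul] at h2
  simpa using h2

variable {Z : Type*} [MeasurableSpace Z] {ν : Measure Z} [SigmaFinite ν]

theorem MemLp.prod_restrict_right {f : Z × Z → ℝ} (hf : MemLp f 2 (ν.prod ν)) (S : Set Z) :
    MemLp f 2 (ν.prod (ν.restrict S)) := by
  have h := hf.restrict (Set.univ ×ˢ S)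
  rwa [← Measure.prod_restrict, Measure.restrict_univ] at h

theorem ae_memLp_section {f : Z × Z → ℝ} (hf : MemLp f 2 (ν.prod ν)) :
    ∀ᵐ z ∂ν, MemLp (fun x => f (z, x)) 2 ν := by
  filter_upwards [hf.1.prodMk_left, hf.integrable_sq.prod_right_ae] with z h1 h2
  exact (memLp_two_iff_integrable_sq h1).2 h2

/-- The section integral over a set `S`. -/
noncomputable def sectionIntegral (ν : Measure Z) (S : Set Z) (f : Z × Z → ℝ) (z : Z) : ℝ :=
  ∫ x in S, f (z, x) ∂ν

theorem aestronglyMeasurable_sectionIntegral {f : Z × Z → ℝ} (hf : MemLp f 2 (ν.prod ν))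
    (S : Set Z) : AEStronglyMeasurable (sectionIntegral ν S f) ν :=
  (MemLp.prod_restrict_right hf S).1.integral_prod_right'

theorem enorm_star₂₁_ae {f : Z × Z → ℝ} (hf : MemLp f 2 (ν.prod ν)) :
    ∀ᵐ x ∂ν, ‖star₂₁ ν f f x‖ₑ = ∫⁻ z, ‖f (z, x)‖ₑ ^ 2 ∂ν := by
  have h1 := hf.integrable_sq.prod_left_ae
  filter_upwards [h1] with x hx
  have h0 : 0 ≤ ∫ z, f (z, x) ^ 2 ∂ν := integral_nonneg fun z => sq_nonneg _
  have h2 : star₂₁ ν f f x = ∫ z, f (z, x) ^ 2 ∂ν := by simp only [star₂₁, sq]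
  rw [h2, Real.enorm_of_nonneg h0,
    ofReal_integral_eq_lintegral_ofReal hx (.of_forall fun z => sq_nonneg _)]
  refine lintegral_congr fun z => ?_
  rw [← enorm_pow, Real.enorm_of_nonneg (sq_nonneg _)]

theorem aestronglyMeasurable_star₂₁ {f : Z × Z → ℝ} (hf : MemLp f 2 (ν.prod ν)) :
    AEStronglyMeasurable (star₂₁ ν f f) ν := by
  have h := hf.integrable_sq.integral_prod_right.aestronglyMeasurable
  have e : star₂₁ ν f f = fun y => ∫ x, f (x, y) ^ 2 ∂ν := by
    funext y; simp only [star₂₁, sq]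
  rw [e]; exact h

/-- Cauchy-Schwarz twice: inside the section over `S`, and, after exchanging the integrals, to bound
the integral of `star₂₁ ν f f` over `S` by its `L²` norm. -/
theorem eLpNorm_sectionIntegral_sq_le {f : Z × Z → ℝ} (hf : MemLp f 2 (ν.prod ν)) (S : Set Z) :
    eLpNorm (sectionIntegral ν S f) 2 ν ^ 2 ≤
      ν S * (eLpNorm (star₂₁ ν f f) 2 ν * ν S ^ (2⁻¹ : ℝ)) := by
  rw [eLpNorm_two_sq]
  have h1 : ∀ᵐ z ∂ν, ‖sectionIntegral ν S f z‖ₑ ^ 2 ≤ ν S * ∫⁻ x in S, ‖f (z, x)‖ₑ ^ 2 ∂ν := by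
    filter_upwards [ae_memLp_section hf] with z hz
    exact (pow_le_pow_left' (enorm_integral_le_lintegral_enorm _) 2).trans
      (sq_lintegral_le hz.1.enorm.restrict)
  have hm : AEMeasurable (fun p : Z × Z => ‖f p‖ₑ ^ 2) (ν.prod (ν.restrict S)) :=
    (MemLp.prod_restrict_right hf S).1.enorm.pow_const 2
  refine (lintegral_mono_ae h1).trans ?_
  rw [lintegral_const_mul'' _ hm.lintegral_prod_right']
  refine mul_le_mul_right ?_ _
  rw [lintegral_lintegral_swap (f := fun z x => ‖f (z, x)‖ₑ ^ 2) hm]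
  have h2 : ∫⁻ x in S, ∫⁻ z, ‖f (z, x)‖ₑ ^ 2 ∂ν ∂ν = eLpNorm (star₂₁ ν f f) 1 (ν.restrict S) := by
    rw [eLpNorm_one_eq_lintegral_enorm]
    refine lintegral_congr_ae (ae_restrict_of_ae ?_)
    filter_upwards [enorm_star₂₁_ae hf] with x hx
    exact hx.symm
  rw [h2]
  refine (eLpNorm_le_eLpNorm_mul_rpow_measure_univ one_le_two
    (aestronglyMeasurable_star₂₁ hf).restrict).trans ?_
  rw [Measure.restrict_apply_univ]
  refine mul_le_mul' (eLpNorm_mono_measure _ Measure.restrict_le_self) (le_of_eq ?_)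
  congr 1
  norm_num

theorem tendsto_eLpNorm_sectionIntegral {g : ℕ → Z × Z → ℝ} (hg : ∀ n, MemLp (g n) 2 (ν.prod ν))
    (hKR : Tendsto (fun n => eLpNorm (star₂₁ ν (g n) (g n)) 2 ν) atTop (𝓝 0))
    {S : Set Z} (hS : ν S < ∞) :
    Tendsto (fun n => eLpNorm (sectionIntegral ν S (g n)) 2 ν) atTop (𝓝 0) := by
  refine tendsto_zero_of_tendsto_sq (tendsto_of_tendsto_of_tendsto_of_le_of_le
    tendsto_const_nhds ?_ (fun _ => zero_le) fun n => eLpNorm_sectionIntegral_sq_le (hg n) S)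
  have hr : ν S ^ (2⁻¹ : ℝ) ≠ ∞ := ENNReal.rpow_ne_top_of_nonneg (by norm_num) hS.ne
  have h1 := ENNReal.Tendsto.mul_const (b := ν S ^ (2⁻¹ : ℝ)) hKR (Or.inr hr)
  simpa using ENNReal.Tendsto.const_mul (a := ν S) h1 (Or.inr hS.ne)

/-- The section integrates the second variable whereas (KW) concerns the first. The relation `f' (z,
x) = 2 f (z, x) - f' (x, z)` converts one into the other. -/
theorem sectionIntegral_ae_eq_of_symm {f f' : Z × Z → ℝ} (hf : MemLp f 2 (ν.prod ν))
    (hf' : MemLp f' 2 (ν.prod ν))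
    (hsymm : (fun p => (f' p + f' p.swap) / 2) =ᵐ[ν.prod ν] f) {S : Set Z}
    (hSm : MeasurableSet S) (hS : ν S < ∞) :
    sectionIntegral ν S f' =ᵐ[ν]
      fun z => 2 * sectionIntegral ν S f z - star₁₁' ν f' (S.indicator 1) z := by
  have hsw : MemLp (fun p => f' p.swap) 2 (ν.prod ν) :=
    hf'.comp_measurePreserving Measure.measurePreserving_swap
  have : IsFiniteMeasure (ν.restrict S) := ⟨by simpa using hS⟩
  filter_upwards [Measure.ae_ae_of_ae_prod hsymm, ae_memLp_section hf, ae_memLp_section hsw]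
    with z hz h1 h2
  have i1 : Integrable (fun x => f (z, x)) (ν.restrict S) := (h1.restrict S).integrable one_le_two
  have i2 : Integrable (fun x => f' (x, z)) (ν.restrict S) := (h2.restrict S).integrable one_le_two
  have e1 : star₁₁' ν f' (S.indicator 1) z = ∫ x in S, f' (x, z) ∂ν := by
    rw [star₁₁', ← integral_indicator hSm]
    refine integral_congr_ae (.of_forall fun x => ?_)
    by_cases hx : x ∈ S <;> simp [hx]
  rw [e1, sectionIntegral, sectionIntegral, ← integral_const_mul,
    ← integral_sub (i1.const_mul 2) i2]
  refine integral_congr_ae (ae_restrict_of_ae ?_)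
  filter_upwards [hz] with x hx
  simp only [Prod.swap_prod_mk] at hx
  rw [← hx]; ring

/-- Justifies Fubini for the contraction: since `S` and `T` have finite measure, both factors are
square integrable on the triple product. -/
theorem integrable_mul_sections {f f' : Z × Z → ℝ} (hf : MemLp f 2 (ν.prod ν))
    (hf' : MemLp f' 2 (ν.prod ν)) {S T : Set Z} (hS : ν S < ∞) (hT : ν T < ∞) :
    Integrable (fun q : (Z × Z) × Z => f (q.2, q.1.1) * f' (q.2, q.1.2))
      (((ν.restrict S).prod (ν.restrict T)).prod ν) := by
  have : IsFiniteMeasure (ν.restrict S) := ⟨by simpa using hS⟩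
  have : IsFiniteMeasure (ν.restrict T) := ⟨by simpa using hT⟩
  have a1 : MeasurePreserving (fun q : (Z × Z) × Z => ((q.2, q.1.1), q.1.2))
      (((ν.restrict S).prod (ν.restrict T)).prod ν)
      ((ν.prod (ν.restrict S)).prod (ν.restrict T)) :=
    ((measurePreserving_prodAssoc ν (ν.restrict S) (ν.restrict T)).symm).comp
      Measure.measurePreserving_swap
  have a2 : MeasurePreserving (fun q : (Z × Z) × Z => ((q.2, q.1.2), q.1.1))
      (((ν.restrict S).prod (ν.restrict T)).prod ν)
      ((ν.prod (ν.restrict T)).prod (ν.restrict S)) :=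
    (((measurePreserving_prodAssoc ν (ν.restrict T) (ν.restrict S)).symm).comp
      Measure.measurePreserving_swap).comp
      (Measure.measurePreserving_swap.prod (MeasurePreserving.id ν))
  have m1 := ((MemLp.prod_restrict_right hf S).comp_fst (ν.restrict T)).comp_measurePreserving a1
  have m2 := ((MemLp.prod_restrict_right hf' T).comp_fst (ν.restrict S)).comp_measurePreserving a2
  exact m1.integrable_mul m2

theorem setIntegral_star₁₁ {f f' : Z × Z → ℝ} (hf : MemLp f 2 (ν.prod ν))
    (hf' : MemLp f' 2 (ν.prod ν)) {S T : Set Z} (hS : ν S < ∞) (hT : ν T < ∞) :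
    IntegrableOn (star₁₁ ν f f') (S ×ˢ T) (ν.prod ν) ∧
    ∫ p in S ×ˢ T, star₁₁ ν f f' p ∂(ν.prod ν) =
      ∫ z, sectionIntegral ν S f z * sectionIntegral ν T f' z ∂ν := by
  have h := integrable_mul_sections hf hf' hS hT
  refine ⟨?_, ?_⟩
  · rw [IntegrableOn, ← Measure.prod_restrict]
    exact h.integral_prod_left
  · rw [← Measure.prod_restrict]
    have h1 := integral_integral_swap (f := fun (p : Z × Z) z => f (z, p.1) * f' (z, p.2)) h
    refine h1.trans (integral_congr_ae (.of_forall fun z => ?_))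
    exact integral_prod_mul (fun x => f (z, x)) (fun y => f' (z, y))

/-- Under the hypotheses of the limit theorem the limit of the contractions vanishes. -/
theorem ae_eq_zero_of_tendsto_star₁₁ {g g' : ℕ → Z × Z → ℝ}
    (hg : ∀ n, MemLp (g n) 2 (ν.prod ν)) (hg' : ∀ n, MemLp (g' n) 2 (ν.prod ν))
    (hg'_symm : ∀ n, (fun p => (g' n p + g' n p.swap) / 2) =ᵐ[ν.prod ν] g n)
    {g₂ : Z × Z → ℝ} (hg₂ : MemLp g₂ 2 (ν.prod ν))
    (hKS₂ : Tendsto (fun n => eLpNorm (fun p => star₁₁ ν (g n) (g' n) p - g₂ p) 2 (ν.prod ν))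
      atTop (𝓝 0))
    (hKW : ∀ h : Z → ℝ, MemLp h 2 ν →
      Tendsto (fun n => eLpNorm (star₁₁' ν (g' n) h) 2 ν) atTop (𝓝 0))
    (hKR : Tendsto (fun n => eLpNorm (star₂₁ ν (g n) (g n)) 2 ν) atTop (𝓝 0)) :
    g₂ =ᵐ[ν.prod ν] 0 := by
  refine ae_eq_zero_of_forall_setIntegral_prod hg₂ fun S T hSm hTm hS hT => ?_
  have tA := tendsto_eLpNorm_sectionIntegral hg hKR hS
  have tA' := tendsto_eLpNorm_sectionIntegral hg hKR hT
  have tW := hKW (T.indicator 1) ((memLp_indicator_const 2 hTm (1 : ℝ) (Or.inr hT.ne)))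
  have hB : ∀ n, eLpNorm (sectionIntegral ν T (g' n)) 2 ν ≤
      2 * eLpNorm (sectionIntegral ν T (g n)) 2 ν +
        eLpNorm (star₁₁' ν (g' n) (T.indicator 1)) 2 ν := by
    intro n
    have e := sectionIntegral_ae_eq_of_symm (hg n) (hg' n) (hg'_symm n) hTm hT
    have m1 := aestronglyMeasurable_sectionIntegral (hg n) T
    have m2 : AEStronglyMeasurable (star₁₁' ν (g' n) (T.indicator 1)) ν := by
      refine ((m1.const_mul 2).sub (aestronglyMeasurable_sectionIntegral (hg' n) T)).congr ?_
      filter_upwards [e] with z hz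
      rw [Pi.sub_apply, hz]; ring
    rw [eLpNorm_congr_ae e]
    refine (eLpNorm_sub_le (m1.const_mul 2) m2 one_le_two).trans (add_le_add ?_ le_rfl)
    have := eLpNorm_const_smul_le (c := (2 : ℝ)) (f := sectionIntegral ν T (g n)) (p := 2) (μ := ν)
    refine this.trans (le_of_eq ?_)
    rw [Real.enorm_of_nonneg zero_le_two]; norm_num
  have tB : Tendsto (fun n => eLpNorm (sectionIntegral ν T (g' n)) 2 ν) atTop (𝓝 0) := by
    refine tendsto_of_tendsto_of_tendsto_of_le_of_le tendsto_const_nhds ?_ (fun _ => zero_le) hB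
    simpa using (ENNReal.Tendsto.const_mul (a := 2) tA' (Or.inr (by simp))).add tW
  set K : ℝ≥0∞ := (ν.prod ν) (S ×ˢ T) ^ (2⁻¹ : ℝ) with hK
  have hST : (ν.prod ν) (S ×ˢ T) < ∞ := by
    rw [Measure.prod_prod]; exact ENNReal.mul_lt_top hS hT
  have hKtop : K ≠ ∞ := ENNReal.rpow_ne_top_of_nonneg (by norm_num) hST.ne
  have : IsFiniteMeasure ((ν.prod ν).restrict (S ×ˢ T)) := ⟨by simpa using hST⟩
  have hi₂ : IntegrableOn g₂ (S ×ˢ T) (ν.prod ν) := (hg₂.restrict _).integrable one_le_two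
  -- The left side does not depend on `n`, while on the right the contraction error and the two
  -- section norms all tend to zero.
  have hle : ∀ n, ‖∫ p in S ×ˢ T, g₂ p ∂(ν.prod ν)‖ₑ ≤
      eLpNorm (fun p => star₁₁ ν (g n) (g' n) p - g₂ p) 2 (ν.prod ν) * K +
      eLpNorm (sectionIntegral ν S (g n)) 2 ν * eLpNorm (sectionIntegral ν T (g' n)) 2 ν := by
    intro n
    obtain ⟨h1, h2⟩ := setIntegral_star₁₁ (hg n) (hg' n) hS hT
    have h3 : ∫ p in S ×ˢ T, g₂ p ∂(ν.prod ν) =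
        -∫ p in S ×ˢ T, (star₁₁ ν (g n) (g' n) p - g₂ p) ∂(ν.prod ν) +
        ∫ z, sectionIntegral ν S (g n) z * sectionIntegral ν T (g' n) z ∂ν := by
      rw [integral_sub h1 hi₂, h2]; ring
    rw [h3]
    refine (enorm_add_le _ _).trans (add_le_add ?_ (enorm_integral_mul_le
      (aestronglyMeasurable_sectionIntegral (hg n) S)
      (aestronglyMeasurable_sectionIntegral (hg' n) T)))
    rw [enorm_neg]
    refine (enorm_integral_le_lintegral_enorm _).trans ?_
    rw [← eLpNorm_one_eq_lintegral_enorm]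
    refine (eLpNorm_le_eLpNorm_mul_rpow_measure_univ one_le_two (h1.sub hi₂).1).trans ?_
    rw [Measure.restrict_apply_univ]
    refine mul_le_mul' (eLpNorm_mono_measure _ Measure.restrict_le_self) (le_of_eq ?_)
    rw [hK]; congr 1; norm_num
  have hlim : Tendsto (fun n => eLpNorm (fun p => star₁₁ ν (g n) (g' n) p - g₂ p) 2 (ν.prod ν) * K +
      eLpNorm (sectionIntegral ν S (g n)) 2 ν * eLpNorm (sectionIntegral ν T (g' n)) 2 ν)
      atTop (𝓝 0) := by
    have h1 := ENNReal.Tendsto.mul_const (b := K) hKS₂ (Or.inr hKtop)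
    have h2 := ENNReal.Tendsto.mul tA (Or.inr ENNReal.zero_ne_top) tB (Or.inr ENNReal.zero_ne_top)
    simpa using h1.add h2
  have := ge_of_tendsto' hlim hle
  rwa [nonpos_iff_eq_zero, enorm_eq_zero] at this

/-- The squared norm of a kernel is its scalar product with any kernel whose symmetrization it
is. -/
theorem integral_mul_eq_integral_sq {f f' : Z × Z → ℝ} (hf : MemLp f 2 (ν.prod ν))
    (hf' : MemLp f' 2 (ν.prod ν)) (hs : (fun p => f p.swap) =ᵐ[ν.prod ν] f)
    (hsymm : (fun p => (f' p + f' p.swap) / 2) =ᵐ[ν.prod ν] f) :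
    ∫ p, f p * f' p ∂(ν.prod ν) = ∫ p, f p ^ 2 ∂(ν.prod ν) := by
  have hsw : MemLp (fun p => f' p.swap) 2 (ν.prod ν) :=
    hf'.comp_measurePreserving Measure.measurePreserving_swap
  have h1 : ∫ p, f p * f' p.swap ∂(ν.prod ν) = ∫ p, f p * f' p ∂(ν.prod ν) := by
    rw [← (Measure.measurePreserving_swap (μ := ν) (ν := ν)).integral_comp
      MeasurableEquiv.prodComm.measurableEmbedding (fun p => f p * f' p)]
    refine integral_congr_ae ?_
    filter_upwards [hs] with p hp
    rw [hp]
  have h2 : ∫ p, f p ^ 2 ∂(ν.prod ν) =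
      ∫ p, (f p * f' p / 2 + f p * f' p.swap / 2) ∂(ν.prod ν) := by
    refine integral_congr_ae ?_
    filter_upwards [hsymm] with p hp
    rw [sq]; nth_rw 2 [← hp]; ring
  have i1 : Integrable (fun p => f p * f' p) (ν.prod ν) := hf.integrable_mul hf'
  have i2 : Integrable (fun p => f p * f' p.swap) (ν.prod ν) := hf.integrable_mul hsw
  rw [h2, integral_add (i1.div_const 2) (i2.div_const 2),
    integral_div, integral_div, h1]
  ring

end Kernels

/-! ### From kernels to graphs on finitely many cells. -/

section Edges

theorem ennreal_add_sq_le (a b : ℝ≥0∞) : (a + b) ^ 2 ≤ 2 * a ^ 2 + 2 * b ^ 2 := by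
  have h := ENNReal.rpow_add_le_mul_rpow_add_rpow a b (p := 2) (by norm_num)
  rw [← mul_add]
  norm_num at h
  exact h

variable {Z : Type*} [MeasurableSpace Z] {ν : Measure Z}

/-- The integral of the squared degrees of a weighted graph. -/
noncomputable def degreeEnergy (ν : Measure Z) (f : Z × Z → ℝ) : ℝ≥0∞ :=
  ∫⁻ x, (∫⁻ z, ‖f (z, x)‖ₑ ∂ν) ^ 2 ∂ν

theorem degreeEnergy_mono {f f' : Z × Z → ℝ} (h : ∀ p, ‖f p‖ₑ ≤ ‖f' p‖ₑ) :
    degreeEnergy ν f ≤ degreeEnergy ν f' :=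
  lintegral_mono fun _ => pow_le_pow_left' (lintegral_mono fun _ => h _) 2

theorem aestronglyMeasurable_section_left [SFinite ν] {f : Z × Z → ℝ}
    (hf : AEStronglyMeasurable f (ν.prod ν)) :
    ∀ᵐ x ∂ν, AEStronglyMeasurable (fun z => f (z, x)) ν :=
  hf.prod_swap.prodMk_left

theorem degreeEnergy_le_two_mul_add [SFinite ν] {f f' : Z × Z → ℝ}
    (hf : AEStronglyMeasurable f (ν.prod ν)) :
    degreeEnergy ν f' ≤ 2 * degreeEnergy ν f + 2 * degreeEnergy ν (fun p => f p - f' p) := by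
  have hm : AEMeasurable (fun x => 2 * (∫⁻ z, ‖f (z, x)‖ₑ ∂ν) ^ 2) ν :=
    (hf.enorm.lintegral_prod_left'.pow_const 2).const_mul 2
  rw [degreeEnergy, degreeEnergy, degreeEnergy, ← lintegral_const_mul' 2 _ (by simp),
    ← lintegral_const_mul' 2 _ (by simp), ← lintegral_add_left' hm]
  refine lintegral_mono_ae ?_
  filter_upwards [aestronglyMeasurable_section_left hf] with x hx
  refine le_trans (pow_le_pow_left' ?_ 2) (ennreal_add_sq_le _ _)
  rw [← lintegral_add_left' hx.enorm]
  refine lintegral_mono fun z => ?_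
  have h := enorm_sub_le (a := f (z, x)) (b := f (z, x) - f' (z, x))
  rwa [sub_sub_cancel] at h

/-- The degree is an `L¹` norm of a section, which the `L²` norm controls only over a set of finite
measure; hence the support condition. -/
theorem degreeEnergy_le_mul_eLpNorm_sq [SFinite ν] {f : Z × Z → ℝ}
    (hf : AEStronglyMeasurable f (ν.prod ν)) {S : Set Z} (hS : MeasurableSet S)
    (hfS : ∀ p ∉ S ×ˢ S, f p = 0) :
    degreeEnergy ν f ≤ ν S * eLpNorm f 2 (ν.prod ν) ^ 2 := by
  rw [eLpNorm_two_sq, lintegral_prod_symm _ (hf.enorm.pow_const 2), degreeEnergy,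
    ← lintegral_const_mul'' _ (hf.enorm.pow_const 2).lintegral_prod_left']
  refine lintegral_mono_ae ?_
  filter_upwards [aestronglyMeasurable_section_left hf] with x hx
  have h1 : ∫⁻ z, ‖f (z, x)‖ₑ ∂ν = ∫⁻ z in S, ‖f (z, x)‖ₑ ∂ν := by
    rw [← lintegral_indicator hS]
    refine lintegral_congr fun z => ?_
    by_cases hz : z ∈ S
    · simp [hz]
    · simp [hz, hfS (z, x) (fun h => hz h.1)]
  rw [h1]
  exact (sq_lintegral_le hx.enorm.restrict).trans
    (mul_le_mul_right (setLIntegral_le_lintegral _ _) _)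

/-- The indicator of the set where a kernel is closer to `1 / 2` than to `0`. -/
noncomputable def edgeIndicator (f : Z × Z → ℝ) : Z × Z → ℝ := {p | 1 / 4 < f p}.indicator 1

theorem edgeIndicator_eq {Z : Type*} (f : Z × Z → ℝ) (p : Z × Z) :
    edgeIndicator f p = 0 ∨ edgeIndicator f p = 1 := by
  by_cases h : p ∈ {p | 1 / 4 < f p}
  · right; rw [edgeIndicator, Set.indicator_of_mem h]; rfl
  · left; rw [edgeIndicator, Set.indicator_of_notMem h]

theorem aestronglyMeasurable_edgeIndicator {f : Z × Z → ℝ}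
    (hf : AEStronglyMeasurable f (ν.prod ν)) :
    AEStronglyMeasurable (edgeIndicator f) (ν.prod ν) :=
  (aestronglyMeasurable_const (b := (1 : ℝ))).indicator₀
    (nullMeasurableSet_lt aemeasurable_const hf.aemeasurable)

theorem enorm_edgeIndicator_le {Z : Type*} (f : Z × Z → ℝ) (p : Z × Z) :
    ‖edgeIndicator f p‖ₑ ≤ 16 * ‖f p‖ₑ ^ 2 := by
  by_cases h : p ∈ {p | 1 / 4 < f p}
  · rw [edgeIndicator, Set.indicator_of_mem h, ← enorm_pow, Real.enorm_of_nonneg (sq_nonneg _),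
      show (16 : ℝ≥0∞) = ENNReal.ofReal 16 by norm_num, ← ENNReal.ofReal_mul (by norm_num)]
    simp only [Pi.one_apply, enorm_one]
    rw [ENNReal.one_le_ofReal]
    have : 1 / 4 < f p := h
    nlinarith
  · rw [edgeIndicator, Set.indicator_of_notMem h]; simp

theorem memLp_edgeIndicator {f : Z × Z → ℝ} (hf : MemLp f 2 (ν.prod ν)) :
    MemLp (edgeIndicator f) 2 (ν.prod ν) := by
  refine hf.of_le_mul (c := 4) (aestronglyMeasurable_edgeIndicator hf.1) (.of_forall fun p => ?_)
  by_cases h : p ∈ {p | 1 / 4 < f p}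
  · rw [edgeIndicator, Set.indicator_of_mem h]
    have : 1 / 4 < f p := h
    simp only [Pi.one_apply, norm_one, Real.norm_eq_abs]
    linarith [le_abs_self (f p)]
  · rw [edgeIndicator, Set.indicator_of_notMem h, norm_zero]; positivity

/-- The threshold `1 / 4` is the midpoint of `0` and `1 / 2`. The left side measures the distance of
`f p` to the nearer of these two values; the distance to the other one is at least `1 / 4`, whence
the factor `16`. -/
theorem eLpNorm_sub_half_edgeIndicator_sq_le (f : Z × Z → ℝ) :
    eLpNorm (fun p => f p - edgeIndicator f p / 2) 2 (ν.prod ν) ^ 2 ≤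
      16 * ∫⁻ p, ENNReal.ofReal (f p ^ 2 * (f p - 1 / 2) ^ 2) ∂(ν.prod ν) := by
  rw [eLpNorm_two_sq, ← lintegral_const_mul' _ _ (by simp)]
  refine lintegral_mono fun p => ?_
  rw [← enorm_pow, Real.enorm_of_nonneg (sq_nonneg _),
    show (16 : ℝ≥0∞) = ENNReal.ofReal 16 by norm_num, ← ENNReal.ofReal_mul (by norm_num)]
  refine ENNReal.ofReal_le_ofReal ?_
  by_cases h : p ∈ {p | 1 / 4 < f p}
  · rw [edgeIndicator, Set.indicator_of_mem h]
    have h1 : 1 / 4 < f p := h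
    have h2 : 1 ≤ 16 * f p ^ 2 := by nlinarith
    simp only [Pi.one_apply]
    nlinarith [mul_le_mul_of_nonneg_right h2 (sq_nonneg (f p - 1 / 2))]
  · rw [edgeIndicator, Set.indicator_of_notMem h]
    have h1 : f p ≤ 1 / 4 := not_lt.1 h
    have h2 : 1 ≤ 16 * (f p - 1 / 2) ^ 2 := by nlinarith
    nlinarith [mul_le_mul_of_nonneg_right h2 (sq_nonneg (f p))]

/-- Pointwise the edge indicator is at most `16 f²`, so the degree of `x` is at most `16` times
`star₂₁ ν f f x`. This is how (KR⋆) makes the graphs sparse. -/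
theorem degreeEnergy_edgeIndicator_le [SigmaFinite ν] {f : Z × Z → ℝ}
    (hf : MemLp f 2 (ν.prod ν)) :
    degreeEnergy ν (edgeIndicator f) ≤ 256 * eLpNorm (star₂₁ ν f f) 2 ν ^ 2 := by
  rw [eLpNorm_two_sq, ← lintegral_const_mul' _ _ (by simp), degreeEnergy]
  refine lintegral_mono_ae ?_
  filter_upwards [enorm_star₂₁_ae hf] with x hx
  rw [hx, show (256 : ℝ≥0∞) = 16 ^ 2 by norm_num, ← mul_pow,
    ← lintegral_const_mul' _ _ (by simp)]
  exact pow_le_pow_left' (lintegral_mono fun z => enorm_edgeIndicator_le f _) 2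

/-- The graph obtained from a weighted graph by keeping the edges of weight more than `1 / 2` in
both directions. -/
noncomputable def roundKernel {κ : Type*} (a : κ → κ → ℝ) (k l : κ) : ℝ :=
  if 1 / 2 < a k l ∧ 1 / 2 < a l k then 1 else 0

theorem roundKernel_symm {κ : Type*} (a : κ → κ → ℝ) (k l : κ) :
    roundKernel a k l = roundKernel a l k := by
  simp only [roundKernel, and_comm]

theorem roundKernel_eq {κ : Type*} (a : κ → κ → ℝ) (k l : κ) :
    roundKernel a k l = 0 ∨ roundKernel a k l = 1 := by
  rw [roundKernel]; split_ifs <;> simp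

/-- Where rounding gives the wrong value, one of the two weights is at distance at least `1 / 2`
from `e`. -/
theorem abs_sub_roundKernel_le {κ : Type*} (a : κ → κ → ℝ) (k l : κ) {e : ℝ}
    (he : e = 0 ∨ e = 1) :
    |e - roundKernel a k l| ≤ 2 * |e - a k l| + 2 * |e - a l k| := by
  rw [roundKernel]
  have h1 := abs_nonneg (e - a k l)
  have h2 := abs_nonneg (e - a l k)
  split_ifs with h
  · rcases he with rfl | rfl
    · have := neg_le_abs (0 - a k l)
      norm_num
      norm_num at this
      linarith [h.1, abs_nonneg (a l k)]
    · simp only [sub_self, abs_zero]; linarith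
  · rcases he with rfl | rfl
    · simp only [sub_self, abs_zero]; linarith
    · rw [not_and_or, not_lt, not_lt] at h
      have h3 := le_abs_self (1 - a k l)
      have h4 := le_abs_self (1 - a l k)
      norm_num
      rcases h with h | h <;> linarith

theorem IsStep.roundKernel {κ : Type*} {c : Z → κ} {a : κ → κ → ℝ} (h : IsStep ν c a) :
    IsStep ν c (roundKernel a) := by
  refine ⟨h.measurableSet, fun k l hkl => h.lt_top k l fun h0 => hkl ?_⟩
  rw [PoissonMixture.roundKernel, if_neg]
  rw [h0]; norm_num

theorem eLpNorm_sub_roundKernel_le [SigmaFinite ν] {κ : Type*} [Fintype κ] {c : Z → κ}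
    {a : κ → κ → ℝ} (h : IsStep ν c a) {f : Z × Z → ℝ} (hf : AEStronglyMeasurable f (ν.prod ν))
    (hf01 : ∀ p, f p = 0 ∨ f p = 1) (hs : (fun p => f p.swap) =ᵐ[ν.prod ν] f) :
    eLpNorm (fun p => f p - stepFun c (roundKernel a) p) 2 (ν.prod ν) ≤
      4 * eLpNorm (fun p => f p - stepFun c a p) 2 (ν.prod ν) := by
  obtain ⟨u, hu⟩ : ∃ u : Z × Z → ℝ, u = fun p => f p - stepFun c a p := ⟨_, rfl⟩
  have hum : AEStronglyMeasurable u (ν.prod ν) := by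
    rw [hu]; exact hf.sub h.measurable.aestronglyMeasurable
  have hsw := Measure.measurePreserving_swap (μ := ν) (ν := ν)
  have hus : AEStronglyMeasurable (fun p : Z × Z => u p.swap) (ν.prod ν) :=
    hum.comp_measurePreserving hsw
  have h1 : ∀ᵐ p ∂(ν.prod ν), ‖f p - stepFun c (roundKernel a) p‖ ≤
      ‖2 * ‖u p‖ + 2 * ‖u p.swap‖‖ := by
    filter_upwards [hs] with p hp
    have h2 := abs_sub_roundKernel_le a (c p.1) (c p.2) (hf01 p)
    refine le_trans ?_ (le_abs_self _)
    simp only [hu, Real.norm_eq_abs, stepFun, hp]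
    exact h2
  have h3 : ∀ v : Z × Z → ℝ, eLpNorm (fun p => 2 * ‖v p‖) 2 (ν.prod ν) =
      2 * eLpNorm v 2 (ν.prod ν) := by
    intro v
    have h4 := eLpNorm_const_smul (2 : ℝ) (fun p => ‖v p‖) 2 (ν.prod ν)
    rw [eLpNorm_norm, Real.enorm_of_nonneg zero_le_two] at h4
    rw [show ENNReal.ofReal 2 = 2 by norm_num] at h4
    exact h4
  have h5 : eLpNorm (fun p : Z × Z => u p.swap) 2 (ν.prod ν) = eLpNorm u 2 (ν.prod ν) :=
    eLpNorm_comp_measurePreserving hum hsw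
  have h6 : eLpNorm (fun p => 2 * ‖u p‖ + 2 * ‖u p.swap‖) 2 (ν.prod ν) ≤
      eLpNorm (fun p => 2 * ‖u p‖) 2 (ν.prod ν) +
        eLpNorm (fun p => 2 * ‖u p.swap‖) 2 (ν.prod ν) :=
    eLpNorm_add_le (hum.norm.const_mul 2) (hus.norm.const_mul 2) one_le_two
  rw [h3, h3 (fun p => u p.swap), h5, ← add_mul] at h6
  rw [← hu]
  refine (eLpNorm_mono_ae h1).trans (h6.trans (le_of_eq ?_))
  norm_num

/-- The graph is cut to a square of finite measure, approximated there by a step function and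
rounded to a symmetric kernel with values `0` and `1`. All errors but the tail live on the square,
where `L²` closeness also controls the degree energy. -/
theorem exists_graph_approx [SigmaFinite ν] {f : Z × Z → ℝ} (hf : MemLp f 2 (ν.prod ν))
    (hf01 : ∀ p, f p = 0 ∨ f p = 1) (hs : (fun p => f p.swap) =ᵐ[ν.prod ν] f)
    {δ : ℝ≥0∞} (hδ : δ ≠ 0) :
    ∃ (κ : Type) (_ : Fintype κ) (c : Z → κ) (b : κ → κ → ℝ), IsStep ν c b ∧
      (∀ k l, b k l = b l k) ∧ (∀ k l, b k l = 0 ∨ b k l = 1) ∧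
      eLpNorm (fun p => f p - stepFun c b p) 2 (ν.prod ν) ≤ δ ∧
      degreeEnergy ν (stepFun c b) ≤ 2 * degreeEnergy ν f + δ := by
  have hδ2 : 0 < δ / 2 := ENNReal.half_pos hδ
  have t2 := tendsto_eLpNorm_indicator_compl_spanningSets (q := 2) two_ne_zero
    (by simpa using hf)
  obtain ⟨m, hm⟩ := (t2.eventually (gt_mem_nhds hδ2)).exists
  set S := spanningSets ν m
  have hS : MeasurableSet S := measurableSet_spanningSets ν m
  have hSf : ν S < ∞ := measure_spanningSets_lt_top ν m
  -- Rounding multiplies the error by `4`. The bound `δ / 8` gives `4ε ≤ δ / 2` for the norm; the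
  -- other two give `2 ν(S) (4ε)² = 32 ν(S) ε² ≤ δ` for the degree energy.
  set ε : ℝ≥0∞ := min 1 (min (δ / 8) (δ / (32 * (ν S + 1)))) with hε
  have hε0 : ε ≠ 0 := by
    have h1 : δ / 8 ≠ 0 := (ENNReal.div_pos hδ (by simp)).ne'
    have h2 : δ / (32 * (ν S + 1)) ≠ 0 :=
      (ENNReal.div_pos hδ (ENNReal.mul_ne_top (by simp) (by simp [hSf.ne]))).ne'
    simp [hε, h1, h2]
  obtain ⟨ψ, ⟨κ, _, c, a, h, rfl⟩, hψS, hle⟩ := exists_isStepFun_eLpNorm_indicator_sub_le hS hSf hf hε0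
  set f' := (S ×ˢ S).indicator f with hf'
  have hf'm : AEStronglyMeasurable f' (ν.prod ν) := hf.1.indicator (hS.prod hS)
  have hf'01 : ∀ p, f' p = 0 ∨ f' p = 1 := fun p => by
    by_cases hp : p ∈ S ×ˢ S
    · rw [hf', Set.indicator_of_mem hp]; exact hf01 p
    · left; rw [hf', Set.indicator_of_notMem hp]
  have hf's : (fun p => f' p.swap) =ᵐ[ν.prod ν] f' := by
    filter_upwards [hs] with p hp
    have hiff : p.swap ∈ S ×ˢ S ↔ p ∈ S ×ˢ S := by simp [and_comm]
    by_cases hpS : p ∈ S ×ˢ S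
    · rw [hf', Set.indicator_of_mem hpS, Set.indicator_of_mem (hiff.2 hpS), hp]
    · rw [hf', Set.indicator_of_notMem hpS, Set.indicator_of_notMem (fun h => hpS (hiff.1 h))]
  have hb := h.roundKernel
  have hr : eLpNorm (fun p => f' p - stepFun c (roundKernel a) p) 2 (ν.prod ν) ≤ 4 * ε :=
    (eLpNorm_sub_roundKernel_le h hf'm hf'01 hf's).trans (mul_le_mul_right hle _)
  refine ⟨κ, inferInstance, c, roundKernel a, hb, roundKernel_symm a, roundKernel_eq a, ?_, ?_⟩
  · have e : (fun p => f p - stepFun c (roundKernel a) p) =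
        (S ×ˢ S)ᶜ.indicator f + fun p => f' p - stepFun c (roundKernel a) p := by
      funext p
      rw [Pi.add_apply, hf']
      by_cases hp : p ∈ S ×ˢ S <;> simp [hp, -Set.mem_prod, sub_eq_add_neg]
    rw [e]
    refine (eLpNorm_add_le (hf.1.indicator (hS.prod hS).compl)
      (hf'm.sub hb.measurable.aestronglyMeasurable) one_le_two).trans ?_
    have h4 : 4 * ε ≤ δ / 2 := by
      calc 4 * ε ≤ 4 * (δ / 8) :=
            mul_le_mul_right ((min_le_right _ _).trans (min_le_left _ _)) _
        _ = δ / 2 := by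
            rw [show (8 : ℝ≥0∞) = 4 * 2 by norm_num, ← mul_div_assoc,
              ENNReal.mul_div_mul_left _ _ (by simp) (by simp)]
    exact (add_le_add hm.le (hr.trans h4)).trans (ENNReal.add_halves δ).le
  · refine (degreeEnergy_le_two_mul_add hf'm).trans ?_
    refine add_le_add (mul_le_mul_right (degreeEnergy_mono fun p => ?_) _) ?_
    · by_cases hp : p ∈ S ×ˢ S
      · rw [hf', Set.indicator_of_mem hp]
      · rw [hf', Set.indicator_of_notMem hp]; simp
    · have hrS : ∀ p ∉ S ×ˢ S, f' p - stepFun c (roundKernel a) p = 0 := by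
        intro p hp
        have h0 : a (c p.1) (c p.2) = 0 := hψS p hp
        rw [hf', Set.indicator_of_notMem hp]
        simp only [stepFun, roundKernel, h0]
        norm_num
      have h5 := degreeEnergy_le_mul_eLpNorm_sq
        (hf'm.sub hb.measurable.aestronglyMeasurable) hS hrS
      have hε1 : ε ≤ 1 := min_le_left _ _
      have hε2 : 32 * (ν S + 1) * ε ≤ δ :=
        (mul_le_mul_right ((min_le_right _ _).trans (min_le_right _ _)) _).trans
          ENNReal.mul_div_le
      calc 2 * degreeEnergy ν (fun p => f' p - stepFun c (roundKernel a) p)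
          ≤ 2 * (ν S * (4 * ε) ^ 2) := by
            refine mul_le_mul_right (h5.trans (mul_le_mul_right (pow_le_pow_left' hr 2) _)) _
        _ = 32 * ν S * (ε * ε) := by ring
        _ ≤ 32 * (ν S + 1) * (ε * 1) := by gcongr; exact le_self_add
        _ ≤ δ := by rwa [mul_one]

variable {κ : Type*} [Fintype κ] {c : Z → κ} {b : κ → κ → ℝ}

theorem lintegral_comp_fintype (hc : ∀ k, MeasurableSet (c ⁻¹' {k})) (F : κ → ℝ≥0∞) :
    ∫⁻ x, F (c x) ∂ν = ∑ k, F k * ν (c ⁻¹' {k}) := by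
  classical
  have e : ∀ x, F (c x) = ∑ k, F k * (c ⁻¹' {k}).indicator 1 x := by
    intro x
    rw [Finset.sum_eq_single (c x)]
    · simp
    · intro k _ hk
      simp [Ne.symm hk]
    · simp
  simp only [e]
  rw [lintegral_finsetSum _ fun k _ => (measurable_one.indicator (hc k)).const_mul _]
  refine Finset.sum_congr rfl fun k _ => ?_
  rw [lintegral_const_mul _ (measurable_one.indicator (hc k)), lintegral_indicator_one (hc k)]

theorem ofReal_cellMean_le {κ : Type*} {c : Z → κ} (k : κ) : ENNReal.ofReal (cellMean ν c k) ≤ ν (c ⁻¹' {k}) := by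
  rw [ENNReal.ofReal_coe_nnreal, cellMean]
  exact ENNReal.coe_toNNReal_le_self

/-- Only an inequality, since cells of infinite measure have mean zero on the left. -/
theorem ofReal_sum_degreeMean_sq_le (hc : ∀ k, MeasurableSet (c ⁻¹' {k}))
    (hs : ∀ k l, b k l = b l k) (hb : ∀ k l, b k l = 0 ∨ b k l = 1) :
    ENNReal.ofReal (∑ k, cellMean ν c k * degreeMean (cellMean ν c) b k ^ 2) ≤
      degreeEnergy ν (stepFun c b) := by
  have hb0 : ∀ k l, 0 ≤ b k l := fun k l => by rcases hb k l with h | h <;> simp [h]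
  have hd0 : ∀ k, 0 ≤ degreeMean (cellMean ν c) b k := fun k =>
    Finset.sum_nonneg fun l _ => mul_nonneg (hb0 k l) (NNReal.coe_nonneg (cellMean ν c l))
  have hpd : ∀ k ∈ Finset.univ,
      0 ≤ (cellMean ν c k : ℝ) * degreeMean (cellMean ν c) b k ^ 2 := fun k _ =>
    mul_nonneg (NNReal.coe_nonneg (cellMean ν c k)) (sq_nonneg _)
  have hbp : ∀ k, ∀ l ∈ Finset.univ, 0 ≤ b k l * (cellMean ν c l : ℝ) := fun k l _ =>
    mul_nonneg (hb0 k l) (NNReal.coe_nonneg (cellMean ν c l))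
  have e : ∀ x, ∫⁻ z, ‖stepFun c b (z, x)‖ₑ ∂ν = ∑ l, ‖b l (c x)‖ₑ * ν (c ⁻¹' {l}) := fun x =>
    lintegral_comp_fintype hc (fun l => ‖b l (c x)‖ₑ)
  rw [degreeEnergy]
  simp only [e]
  rw [lintegral_comp_fintype hc (fun k => (∑ l, ‖b l k‖ₑ * ν (c ⁻¹' {l})) ^ 2),
    ENNReal.ofReal_sum_of_nonneg hpd]
  refine Finset.sum_le_sum fun k _ => ?_
  rw [ENNReal.ofReal_mul (NNReal.coe_nonneg (cellMean ν c k)), mul_comm, ENNReal.ofReal_pow (hd0 k)]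
  refine mul_le_mul' (pow_le_pow_left' ?_ 2) (ofReal_cellMean_le k)
  rw [degreeMean, ENNReal.ofReal_sum_of_nonneg (hbp k)]
  refine Finset.sum_le_sum fun l _ => ?_
  rw [ENNReal.ofReal_mul (hb0 k l), hs k l, Real.enorm_of_nonneg (hb0 l k)]
  exact mul_le_mul_right (ofReal_cellMean_le l) _

/-- A kernel with values `0` and `1` equals its square. In this form the edge mean does not depend
on the partition and is stable under `L²` approximation. -/
theorem edgeMean_eq_integral_sq [SigmaFinite ν] (h : IsStep ν c b) (hb : ∀ k l, b k l = 0 ∨ b k l = 1) :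
    edgeMean (cellMean ν c) b = (∫ p, stepFun c b p ^ 2 ∂(ν.prod ν)) / 2 := by
  rw [h.integral_sq, edgeMean]
  congr 1
  refine Finset.sum_congr rfl fun k _ => Finset.sum_congr rfl fun l _ => ?_
  rcases hb k l with h | h <;> simp [h]

theorem tendsto_integral_sq_of_tendsto_eLpNorm_sub {α : Type*} [MeasurableSpace α] {μ : Measure α}
    {f f' : ℕ → α → ℝ} (hf : ∀ n, MemLp (f n) 2 μ) (hf' : ∀ n, MemLp (f' n) 2 μ)
    (h : Tendsto (fun n => eLpNorm (fun x => f n x - f' n x) 2 μ) atTop (𝓝 0)) {r : ℝ}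
    (hr : Tendsto (fun n => ∫ x, f n x ^ 2 ∂μ) atTop (𝓝 r)) :
    Tendsto (fun n => ∫ x, f' n x ^ 2 ∂μ) atTop (𝓝 r) := by
  have hsq : ∀ {u : α → ℝ}, MemLp u 2 μ → (eLpNorm u 2 μ).toReal ^ 2 = ∫ x, u x ^ 2 ∂μ := by
    intro u hu
    rw [← ENNReal.toReal_pow, eLpNorm_two_sq_eq_integral hu.integrable_sq,
      ENNReal.toReal_ofReal (integral_nonneg fun x => sq_nonneg _)]
  have hsub : ∀ n, MemLp (fun x => f n x - f' n x) 2 μ := fun n => (hf n).sub (hf' n)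
  have h0 : Tendsto (fun n => (eLpNorm (fun x => f n x - f' n x) 2 μ).toReal) atTop (𝓝 0) :=
    (ENNReal.tendsto_toReal ENNReal.zero_ne_top).comp h
  have h1 : Tendsto (fun n => (eLpNorm (f n) 2 μ).toReal) atTop (𝓝 √r) := by
    refine ((Real.continuous_sqrt.tendsto r).comp hr).congr fun n => ?_
    rw [Function.comp_apply, ← hsq (hf n), Real.sqrt_sq ENNReal.toReal_nonneg]
  have hle : ∀ n, dist (eLpNorm (f n) 2 μ).toReal (eLpNorm (f' n) 2 μ).toReal ≤
      (eLpNorm (fun x => f n x - f' n x) 2 μ).toReal := by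
    intro n
    have e1 : f n = f' n + fun x => f n x - f' n x := by funext x; simp
    have e2 : f' n = f n - fun x => f n x - f' n x := by funext x; simp
    have a1 := ENNReal.toReal_mono (ENNReal.add_ne_top.2 ⟨(hf' n).2.ne, (hsub n).2.ne⟩)
      (eLpNorm_add_le (hf' n).1 (hsub n).1 one_le_two)
    have a2 := ENNReal.toReal_mono (ENNReal.add_ne_top.2 ⟨(hf n).2.ne, (hsub n).2.ne⟩)
      (eLpNorm_sub_le (hf n).1 (hsub n).1 one_le_two)
    rw [← e1, ENNReal.toReal_add (hf' n).2.ne (hsub n).2.ne] at a1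
    rw [← e2, ENNReal.toReal_add (hf n).2.ne (hsub n).2.ne] at a2
    rw [Real.dist_eq, abs_le]
    constructor <;> linarith
  have hr0 : 0 ≤ r := ge_of_tendsto' hr fun n => integral_nonneg fun x => sq_nonneg _
  have h2 : Tendsto (fun n => (eLpNorm (f' n) 2 μ).toReal) atTop (𝓝 √r) :=
    (tendsto_iff_of_dist (squeeze_zero (fun _ => dist_nonneg) hle h0)).1 h1
  have h3 := h2.pow 2
  rw [Real.sq_sqrt hr0] at h3
  exact h3.congr fun n => hsq (hf' n)

/-- The kernels of the limit theorem are asymptotically half the indicators of graphs with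
vanishing degree energy. -/
theorem exists_graph_sequence [SigmaFinite ν] {g : ℕ → Z × Z → ℝ}
    (hg : ∀ n, MemLp (g n) 2 (ν.prod ν)) (hs : ∀ n, (fun p => g n p.swap) =ᵐ[ν.prod ν] g n)
    {r : ℝ} (hr : Tendsto (fun n => ∫ p, g n p ^ 2 ∂(ν.prod ν)) atTop (𝓝 r))
    (hKR : Tendsto (fun n => eLpNorm (star₂₁ ν (g n) (g n)) 2 ν) atTop (𝓝 0))
    (hKP : Tendsto
      (fun n => ∫⁻ p, ENNReal.ofReal ((g n p) ^ 2 * (g n p - 1 / 2) ^ 2) ∂(ν.prod ν))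
      atTop (𝓝 0)) :
    ∃ (κ : ℕ → Type) (_ : ∀ n, Fintype (κ n)) (c : ∀ n, Z → κ n) (b : ∀ n, κ n → κ n → ℝ),
      (∀ n, IsStep ν (c n) (b n)) ∧ (∀ n k l, b n k l = b n l k) ∧
      (∀ n k l, b n k l = 0 ∨ b n k l = 1) ∧
      Tendsto (fun n => eLpNorm (fun p => g n p - stepFun (c n) (fun k l => b n k l / 2) p) 2
        (ν.prod ν)) atTop (𝓝 0) ∧
      Tendsto (fun n => degreeEnergy ν (stepFun (c n) (b n))) atTop (𝓝 0) ∧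
      Tendsto (fun n => edgeMean (cellMean ν (c n)) (b n)) atTop (𝓝 (2 * r)) := by
  have hsE : ∀ n, (fun p => edgeIndicator (g n) p.swap) =ᵐ[ν.prod ν] edgeIndicator (g n) := by
    intro n
    filter_upwards [hs n] with p hp
    simp only [edgeIndicator, Set.indicator, Set.mem_ofPred_eq, hp, Pi.one_apply]
  have hδ0 : ∀ n : ℕ, ((n : ℝ≥0∞) + 1)⁻¹ ≠ 0 := fun n => by simp
  have hδ : Tendsto (fun n : ℕ => ((n : ℝ≥0∞) + 1)⁻¹) atTop (𝓝 0) := by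
    have := (tendsto_add_atTop_iff_nat 1).2 ENNReal.tendsto_inv_nat_nhds_zero
    simpa using this
  have hex := fun n => exists_graph_approx (memLp_edgeIndicator (hg n))
    (edgeIndicator_eq (g n)) (hsE n) (hδ0 n)
  choose κ hκ c b hb hbs hb01 hle hD using hex
  have hhalf : ∀ n, IsStep ν (c n) (fun k l => b n k l / 2) := fun n =>
    (hb n).comp (fun t => t / 2) (by simp)
  have t1 : Tendsto (fun n => eLpNorm (fun p => g n p - edgeIndicator (g n) p / 2) 2 (ν.prod ν))
      atTop (𝓝 0) := by
    refine tendsto_zero_of_tendsto_sq (tendsto_of_tendsto_of_tendsto_of_le_of_le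
      tendsto_const_nhds ?_ (fun _ => zero_le) fun n => eLpNorm_sub_half_edgeIndicator_sq_le (g n))
    simpa using ENNReal.Tendsto.const_mul (a := 16) hKP (Or.inr (by simp))
  have t2 : Tendsto (fun n => eLpNorm (fun p => g n p - stepFun (c n) (fun k l => b n k l / 2) p) 2
      (ν.prod ν)) atTop (𝓝 0) := by
    refine tendsto_of_tendsto_of_tendsto_of_le_of_le
      (h := fun n => eLpNorm (fun p => g n p - edgeIndicator (g n) p / 2) 2 (ν.prod ν) +
        ((n : ℝ≥0∞) + 1)⁻¹)
      tendsto_const_nhds (by simpa using t1.add hδ) (fun _ => zero_le) fun n => ?_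
    have hE := aestronglyMeasurable_edgeIndicator (hg n).1
    have e : (fun p => g n p - stepFun (c n) (fun k l => b n k l / 2) p) =
        (fun p => g n p - edgeIndicator (g n) p / 2) +
          fun p => (edgeIndicator (g n) p - stepFun (c n) (b n) p) / 2 := by
      funext p; simp only [stepFun, Pi.add_apply]; ring
    have m1 : AEStronglyMeasurable (fun p => g n p - edgeIndicator (g n) p / 2) (ν.prod ν) := by
      simp only [div_eq_inv_mul]
      exact (hg n).1.sub (hE.const_mul 2⁻¹)
    have m2 : AEStronglyMeasurable
        (fun p => (edgeIndicator (g n) p - stepFun (c n) (b n) p) / 2) (ν.prod ν) := by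
      simp only [div_eq_inv_mul]
      exact (hE.sub (hb n).measurable.aestronglyMeasurable).const_mul 2⁻¹
    dsimp only
    rw [e]
    refine (eLpNorm_add_le m1 m2 one_le_two).trans (add_le_add le_rfl (le_trans ?_ (hle n)))
    refine eLpNorm_mono fun p => ?_
    rw [norm_div, Real.norm_two]
    linarith [norm_nonneg (edgeIndicator (g n) p - stepFun (c n) (b n) p)]
  refine ⟨κ, hκ, c, b, hb, hbs, hb01, t2, ?_, ?_⟩
  · refine tendsto_of_tendsto_of_tendsto_of_le_of_le tendsto_const_nhds
      (h := fun n => 2 * (256 * eLpNorm (star₂₁ ν (g n) (g n)) 2 ν ^ 2) + ((n : ℝ≥0∞) + 1)⁻¹)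
      ?_ (fun _ => zero_le) fun n => (hD n).trans (add_le_add
        (mul_le_mul_right (degreeEnergy_edgeIndicator_le (hg n)) _) le_rfl)
    have a1 : Tendsto (fun n => eLpNorm (star₂₁ ν (g n) (g n)) 2 ν ^ 2) atTop (𝓝 0) := by
      have := ENNReal.Tendsto.pow (n := 2) hKR
      simpa using this
    have a2 := ENNReal.Tendsto.const_mul (a := 2)
      (ENNReal.Tendsto.const_mul (a := 256) a1 (Or.inr (by simp))) (Or.inr (by simp))
    simpa using a2.add hδ
  -- The edge mean is `∫ b² / 2 = 2 ∫ (b / 2)²`, and `‖b / 2‖²` has the same limit `r` as `‖g n‖²`.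
  · have h1 := (tendsto_integral_sq_of_tendsto_eLpNorm_sub hg (fun n => (hhalf n).memLp_two) t2
      hr).const_mul 2
    refine h1.congr fun n => ?_
    rw [edgeMean_eq_integral_sq (hb n) (hb01 n), ← integral_const_mul, ← integral_div]
    refine integral_congr_ae (.of_forall fun p => ?_)
    simp only [stepFun]; ring

end Edges

/-! ### Asymptotic independence and mixing convergence. -/

section Mixing

variable {Ω Z : Type*} [MeasurableSpace Ω] [MeasurableSpace Z] {P : Measure Ω}
  {ν : Measure Z} {η : Ω → Measure Z}

/-- The counts of a finite partition only see its finitely many cells of finite measure, hence a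
region of finite total measure. A sparse graph has few edges with an end in it. -/
theorem measure_setOf_cell_lt_top {κ' : Type*} [Fintype κ'] (ν : Measure Z) (c' : Z → κ') :
    ν {z | ν (c' ⁻¹' {c' z}) < ∞} < ∞ := by
  refine lt_of_le_of_lt (measure_mono fun z hz => ?_) (measure_biUnion_lt_top
    (s := {k | ν (c' ⁻¹' {k}) < ∞}) (f := fun k => c' ⁻¹' {k}) (Set.toFinite _) fun k hk => hk)
  exact Set.mem_biUnion (x := c' z) hz rfl

/-- The count of a cell of a partition in terms of the counts of a finer partition. -/
noncomputable def coarsen {κ κ' : Type*} [Fintype κ] (ν : Measure Z) (c' : Z → κ')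
    (x : κ × κ' → ℕ) (k' : κ') : ℕ :=
  open Classical in if ν (c' ⁻¹' {k'}) < ∞ then ∑ k, x (k, k') else 0

theorem IsPoissonProcess.ae_coarsen_cellCount {κ κ' : Type*} [Fintype κ] [Fintype κ']
    (hη : IsPoissonProcess η ν P) {c : Z → κ} {c' : Z → κ'}
    (hc : ∀ k, MeasurableSet (c ⁻¹' {k})) (hc' : ∀ k, MeasurableSet (c' ⁻¹' {k})) :
    ∀ᵐ ω ∂P, coarsen ν c' (cellCount ν (fun z => (c z, c' z)) (η ω)) = cellCount ν c' (η ω) := by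
  have hpre : ∀ k : κ × κ', (fun z => (c z, c' z)) ⁻¹' {k} = c ⁻¹' {k.1} ∩ c' ⁻¹' {k.2} := by
    intro k; ext z; simp [Prod.ext_iff]
  have hc'' : ∀ k, MeasurableSet ((fun z => (c z, c' z)) ⁻¹' {k}) := fun k => by
    rw [hpre]; exact (hc _).inter (hc' _)
  filter_upwards [hη.ae_cellCount hc', hη.ae_cellCount hc''] with ω h1 h2
  funext k'
  by_cases hk' : ν (c' ⁻¹' {k'}) < ∞
  · rw [coarsen, if_pos hk']
    have e : c' ⁻¹' {k'} = ⋃ k ∈ Finset.univ, (fun z => (c z, c' z)) ⁻¹' {(k, k')} := by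
      ext z; simp
    have h3 : η ω (c' ⁻¹' {k'}) = ∑ k, η ω ((fun z => (c z, c' z)) ⁻¹' {(k, k')}) := by
      rw [e, measure_biUnion_finset _ fun k _ => hc'' _]
      intro k _ l _ hkl
      refine Disjoint.preimage _ (Set.disjoint_singleton.2 fun h => hkl ?_)
      exact congrArg Prod.fst h
    rw [h1 k' hk', Finset.sum_congr rfl fun k _ => h2 (k, k') ?_] at h3
    · exact_mod_cast h3.symm
    · rw [hpre]; exact (measure_mono Set.inter_subset_right).trans_lt hk'
  · rw [coarsen, cellCount, if_neg hk', if_neg hk']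

/-- A point in a cell of infinite measure is invisible to the coarse counts. This supplies the
exceptional set `T` of `norm_integral_exp_charlierPoly_sub_le`. -/
theorem coarsen_add_single {κ κ' : Type*} [Fintype κ] [DecidableEq κ] [DecidableEq κ']
    {c' : Z → κ'} {k : κ × κ'} (hk : ¬ ν (c' ⁻¹' {k.2}) < ∞) (x : κ × κ' → ℕ) :
    coarsen ν c' (x + Pi.single k 1) = coarsen ν c' x := by
  funext k'
  by_cases hk' : ν (c' ⁻¹' {k'}) < ∞
  · rw [coarsen, coarsen, if_pos hk', if_pos hk']
    refine Finset.sum_congr rfl fun l _ => ?_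
    have : (l, k') ≠ k := fun h => hk (by rw [← h]; exact hk')
    rw [Pi.add_apply, Pi.single_eq_of_ne this, add_zero]
  · rw [coarsen, coarsen, if_neg hk', if_neg hk']

theorem sum_cellMean_le {κ : Type*} {c : Z → κ} (hc : ∀ k, MeasurableSet (c ⁻¹' {k}))
    {T : Finset κ} {B : Set Z} (hB : ν B < ∞) (hT : ∀ k ∈ T, c ⁻¹' {k} ⊆ B) :
    ∑ k ∈ T, (cellMean ν c k : ℝ) ≤ (ν B).toReal := by
  have h1 : ∀ k ∈ T, (cellMean ν c k : ℝ) = (ν (c ⁻¹' {k})).toReal := fun k _ => rfl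
  rw [Finset.sum_congr rfl h1, ← ENNReal.toReal_sum fun k hk =>
    ((measure_mono (hT k hk)).trans_lt hB).ne, ← measure_biUnion_finset _ fun k _ => hc k]
  · exact ENNReal.toReal_mono hB.ne (measure_mono (Set.iUnion₂_subset hT))
  · intro k _ l _ hkl
    exact Disjoint.preimage _ (Set.disjoint_singleton.2 hkl)

variable [IsProbabilityMeasure P] [SigmaFinite ν]

/-- The limit characteristic function. -/
noncomputable def limitChar (m t : ℝ) : ℂ :=
  Complex.exp ((m : ℂ) * (Complex.exp (Complex.I * t) - 1 - Complex.I * t))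

/-- Asymptotic independence, in quantitative form, of the double integral of a sparse graph and the
counts of a fixed partition. -/
theorem IsPoissonProcess.norm_integral_exp_mul_sub_le {κ κ' : Type*} [Fintype κ] [Fintype κ']
    (hη : IsPoissonProcess η ν P) {c : Z → κ} {b : κ → κ → ℝ} (h : IsStep ν c b)
    (hs : ∀ k l, b k l = b l k) (hb : ∀ k l, b k l = 0 ∨ b k l = 1)
    (hD : degreeEnergy ν (stepFun c b) ≠ ∞) {c' : Z → κ'}
    (hc' : ∀ k, MeasurableSet (c' ⁻¹' {k})) {H : (κ' → ℕ) → ℂ} {C : ℝ} (hH : ∀ x, ‖H x‖ ≤ C)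
    (t : ℝ) :
    ‖∫ ω, Complex.exp (Complex.I * ((t * pathIntegral₂ ν (η ω)
        (stepFun c (fun k l => b k l / 2)) : ℝ) : ℂ)) * H (cellCount ν c' (η ω)) ∂P -
      limitChar (edgeMean (cellMean ν c) b) t * ∫ ω, H (cellCount ν c' (η ω)) ∂P‖ ≤
      C * |t| * √(degreeEnergy ν (stepFun c b)).toReal +
      (C * |t| * (degreeEnergy ν (stepFun c b)).toReal +
        2 * C * (√(ν {z | ν (c' ⁻¹' {c' z}) < ∞}).toReal *
          √(degreeEnergy ν (stepFun c b)).toReal)) *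
        Real.exp (2 * edgeMean (cellMean ν c) b) * |t| := by
  classical
  have h'' := h.refine_left hc'
  have hs'' : ∀ k l : κ × κ', b k.1 l.1 = b l.1 k.1 := fun k l => hs _ _
  have hb'' : ∀ k l : κ × κ', b k.1 l.1 = 0 ∨ b k.1 l.1 = 1 := fun k l => hb _ _
  have hhalf : IsStep ν (fun z => (c z, c' z)) (fun k l : κ × κ' => b k.1 l.1 / 2) :=
    h''.comp (fun t => t / 2) (by simp)
  -- In the common refinement of the two partitions, the graph integral and the test functional are
  -- functions of the same independent counts.
  obtain ⟨c'', hc''⟩ : ∃ c'' : Z → κ × κ', c'' = fun z => (c z, c' z) := ⟨_, rfl⟩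
  rw [← hc''] at h'' hhalf
  have hC : 0 ≤ C := (norm_nonneg _).trans (hH 0)
  have e1 : stepFun c'' (fun k l : κ × κ' => b k.1 l.1) = stepFun c b := by rw [hc'']; rfl
  have e2 : stepFun c'' (fun k l : κ × κ' => b k.1 l.1 / 2) =
    stepFun c (fun k l => b k l / 2) := by rw [hc'']; rfl
  have hpath := hη.ae_pathIntegral₂_stepFun hhalf
  rw [e2] at hpath
  have hcoar := hη.ae_coarsen_cellCount h.measurableSet hc'
  rw [← hc''] at hcoar
  have hedge : edgeMean (cellMean ν c'') (fun k l : κ × κ' => b k.1 l.1) =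
      edgeMean (cellMean ν c) b := by
    rw [edgeMean_eq_integral_sq h'' hb'', edgeMean_eq_integral_sq h hb, e1]
  have hdeg := ofReal_sum_degreeMean_sq_le (ν := ν) h''.measurableSet hs'' hb''
  rw [e1] at hdeg
  set D := (degreeEnergy ν (stepFun c b)).toReal with hDdef
  have hdeg' : ∑ k, cellMean ν c'' k *
      degreeMean (cellMean ν c'') (fun k l : κ × κ' => b k.1 l.1) k ^ 2 ≤ D :=
    (ENNReal.ofReal_le_iff_le_toReal hD).1 hdeg
  set T : Finset (κ × κ') := Finset.univ.filter fun k => ν (c' ⁻¹' {k.2}) < ∞ with hT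
  set B := (ν {z | ν (c' ⁻¹' {c' z}) < ∞}).toReal with hB
  have hTB : ∑ k ∈ T, (cellMean ν c'' k : ℝ) ≤ B := by
    refine sum_cellMean_le h''.measurableSet (measure_setOf_cell_lt_top ν c') fun k hk z hz => ?_
    have hz' : (c z, c' z) = k := by rw [hc''] at hz; exact hz
    have hk' := (Finset.mem_filter.1 hk).2
    rw [← hz'] at hk'
    exact hk'
  -- Cauchy-Schwarz with the weights `√p`: however many cells `T` contains, their total mass is at
  -- most `B`.
  have hTd : ∑ k ∈ T, cellMean ν c'' k *
      degreeMean (cellMean ν c'') (fun k l : κ × κ' => b k.1 l.1) k ≤ √B * √D := by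
    have h1 := Real.sum_mul_le_sqrt_mul_sqrt T (fun k => √(cellMean ν c'' k : ℝ))
      (fun k => √(cellMean ν c'' k : ℝ) *
        degreeMean (cellMean ν c'') (fun k l : κ × κ' => b k.1 l.1) k)
    simp only [← mul_assoc, mul_pow, Real.mul_self_sqrt (NNReal.coe_nonneg _),
      Real.sq_sqrt (NNReal.coe_nonneg _)] at h1
    refine h1.trans (mul_le_mul (Real.sqrt_le_sqrt hTB) (Real.sqrt_le_sqrt (le_trans ?_ hdeg'))
      (Real.sqrt_nonneg _) (Real.sqrt_nonneg _))
    exact Finset.sum_le_univ_sum_of_nonneg fun k =>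
      mul_nonneg (NNReal.coe_nonneg _) (sq_nonneg _)
  have key := norm_integral_exp_charlierPoly_sub_le (p := cellMean ν c'') hs'' hb''
    (h := fun x => H (coarsen ν c' x)) (C := C) (fun x => hH _) (T := T)
    (fun k hk x => by
      have hk' : ¬ ν (c' ⁻¹' {k.2}) < ∞ := fun h => hk (Finset.mem_filter.2 ⟨Finset.mem_univ _, h⟩)
      rw [coarsen_add_single hk']) t
  rw [hedge, ← hη.integral_comp_cellCount h''.measurableSet,
    ← hη.integral_comp_cellCount h''.measurableSet] at key
  have i1 : ∫ ω, Complex.exp (Complex.I * ((t * pathIntegral₂ ν (η ω)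
        (stepFun c (fun k l => b k l / 2)) : ℝ) : ℂ)) * H (cellCount ν c' (η ω)) ∂P =
      ∫ ω, Complex.exp (Complex.I * ((t * charlierPoly (cellMean ν c'')
        (fun k l : κ × κ' => b k.1 l.1 / 2) (cellCount ν c'' (η ω)) : ℝ) : ℂ)) *
          H (coarsen ν c' (cellCount ν c'' (η ω))) ∂P := by
    refine integral_congr_ae ?_
    filter_upwards [hpath, hcoar] with ω h1 h2
    rw [h1, h2]
  have i2 : ∫ ω, H (cellCount ν c' (η ω)) ∂P =
      ∫ ω, H (coarsen ν c' (cellCount ν c'' (η ω))) ∂P := by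
    refine integral_congr_ae ?_
    filter_upwards [hcoar] with ω h2
    rw [h2]
  rw [i1, i2]
  refine key.trans ?_
  gcongr

/-- Rényi's argument: the convergence holds trivially on the orthogonal complement of the `v n`, by
linearity on their span, and on the closure of the span by boundedness. -/
theorem tendsto_inner_of_tendsto_inner_self {E : Type*} [NormedAddCommGroup E]
    [InnerProductSpace ℂ E] [CompleteSpace E] {v : ℕ → E} {C : ℝ} (hC : ∀ n, ‖v n‖ ≤ C)
    (h : ∀ m, Tendsto (fun n => inner ℂ (v m) (v n)) atTop (𝓝 0)) (y : E) :
    Tendsto (fun n => inner ℂ y (v n)) atTop (𝓝 0) := by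
  set K := (Submodule.span ℂ (Set.range v)).topologicalClosure with hK
  have hC0 : 0 ≤ C := (norm_nonneg _).trans (hC 0)
  have : CompleteSpace K := (Submodule.isClosed_topologicalClosure _).completeSpace_coe
  obtain ⟨k, hk, z, hz, rfl⟩ := Submodule.exists_add_mem_mem_orthogonal (K := K) y
  have hv : ∀ n, v n ∈ K := fun n =>
    Submodule.le_topologicalClosure _ (Submodule.subset_span ⟨n, rfl⟩)
  have hz0 : ∀ n, inner ℂ z (v n) = 0 := fun n => Submodule.inner_left_of_mem_orthogonal (hv n) hz
  simp only [inner_add_left, hz0, add_zero]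
  have hspan : ∀ s ∈ Submodule.span ℂ (Set.range v),
      Tendsto (fun n => inner ℂ s (v n)) atTop (𝓝 0) := by
    intro s hs
    induction hs using Submodule.span_induction with
    | mem x hx => obtain ⟨m, rfl⟩ := hx; exact h m
    | zero => simp
    | add x y _ _ hx hy => simpa only [inner_add_left, add_zero] using hx.add hy
    | smul a x _ hx => simpa only [inner_smul_left, mul_zero] using hx.const_mul _
  rw [Metric.tendsto_atTop]
  intro ε hε
  have hk' : k ∈ closure (Submodule.span ℂ (Set.range v) : Set E) := hk
  obtain ⟨s, hs, hks⟩ := Metric.mem_closure_iff.1 hk' (ε / (2 * (C + 1))) (by positivity)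
  obtain ⟨n₀, hn₀⟩ := Metric.tendsto_atTop.1 (hspan s hs) (ε / 2) (by positivity)
  refine ⟨n₀, fun n hn => ?_⟩
  have h1 := hn₀ n hn
  rw [dist_zero_right] at h1 ⊢
  have h2 : inner ℂ k (v n) = inner ℂ (k - s) (v n) + inner ℂ s (v n) := by
    rw [← inner_add_left, sub_add_cancel]
  rw [h2]
  have h3 : ‖inner ℂ (k - s) (v n)‖ ≤ ε / (2 * (C + 1)) * C := by
    refine (norm_inner_le_norm _ _).trans (mul_le_mul ?_ (hC n) (norm_nonneg _) (by positivity))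
    rw [← dist_eq_norm]; exact hks.le
  have h4 : ε / (2 * (C + 1)) * C ≤ ε / 2 := by
    rw [div_mul_eq_mul_div, div_le_div_iff₀ (by positivity) (by norm_num)]
    nlinarith
  linarith [norm_add_le (inner ℂ (k - s) (v n)) (inner ℂ s (v n))]

theorem continuous_limitChar (t : ℝ) : Continuous fun m => limitChar m t := by
  unfold limitChar; fun_prop

variable {κ : ℕ → Type} [∀ n, Fintype (κ n)] {c : ∀ n, Z → κ n} {b : ∀ n, κ n → κ n → ℝ} {m : ℝ}

theorem IsPoissonProcess.tendsto_integral_exp_mul_cellCount (hη : IsPoissonProcess η ν P)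
    (h : ∀ n, IsStep ν (c n) (b n)) (hs : ∀ n k l, b n k l = b n l k)
    (hb : ∀ n k l, b n k l = 0 ∨ b n k l = 1)
    (hD : Tendsto (fun n => degreeEnergy ν (stepFun (c n) (b n))) atTop (𝓝 0))
    (hE : Tendsto (fun n => edgeMean (cellMean ν (c n)) (b n)) atTop (𝓝 m))
    {κ' : Type*} [Fintype κ'] {c' : Z → κ'} (hc' : ∀ k, MeasurableSet (c' ⁻¹' {k}))
    {H : (κ' → ℕ) → ℂ} {C : ℝ} (hH : ∀ x, ‖H x‖ ≤ C) (t : ℝ) :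
    Tendsto (fun n => ∫ ω, Complex.exp (Complex.I * ((t * pathIntegral₂ ν (η ω)
        (stepFun (c n) (fun k l => b n k l / 2)) : ℝ) : ℂ)) * H (cellCount ν c' (η ω)) ∂P)
      atTop (𝓝 (limitChar m t * ∫ ω, H (cellCount ν c' (η ω)) ∂P)) := by
  have hlim : Tendsto (fun n => limitChar (edgeMean (cellMean ν (c n)) (b n)) t *
      ∫ ω, H (cellCount ν c' (η ω)) ∂P) atTop
      (𝓝 (limitChar m t * ∫ ω, H (cellCount ν c' (η ω)) ∂P)) :=
    (((continuous_limitChar t).tendsto m).comp hE).mul_const _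
  have hD' : Tendsto (fun n => (degreeEnergy ν (stepFun (c n) (b n))).toReal) atTop (𝓝 0) :=
    (ENNReal.tendsto_toReal ENNReal.zero_ne_top).comp hD
  have hDs : Tendsto (fun n => √(degreeEnergy ν (stepFun (c n) (b n))).toReal) atTop (𝓝 0) := by
    have := (Real.continuous_sqrt.tendsto 0).comp hD'
    rwa [Real.sqrt_zero] at this
  have hdiff : Tendsto (fun n => (∫ ω, Complex.exp (Complex.I * ((t * pathIntegral₂ ν (η ω)
        (stepFun (c n) (fun k l => b n k l / 2)) : ℝ) : ℂ)) * H (cellCount ν c' (η ω)) ∂P) -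
      limitChar (edgeMean (cellMean ν (c n)) (b n)) t * ∫ ω, H (cellCount ν c' (η ω)) ∂P)
      atTop (𝓝 0) := by
    have hfin : ∀ᶠ n in atTop, degreeEnergy ν (stepFun (c n) (b n)) < ∞ :=
      hD.eventually (gt_mem_nhds ENNReal.zero_lt_top)
    refine squeeze_zero_norm' (hfin.mono fun n hn =>
      hη.norm_integral_exp_mul_sub_le (h n) (hs n) (hb n) hn.ne hc' hH t) ?_
    have hexp : Tendsto (fun n => Real.exp (2 * edgeMean (cellMean ν (c n)) (b n))) atTop
        (𝓝 (Real.exp (2 * m))) := (Real.continuous_exp.tendsto _).comp (hE.const_mul 2)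
    have h1 := (hDs.const_mul (C * |t|)).add ((((hD'.const_mul (C * |t|)).add
      ((hDs.const_mul √(ν {z | ν (c' ⁻¹' {c' z}) < ∞}).toReal).const_mul (2 * C))).mul
        hexp).mul_const |t|)
    simpa using h1
  simpa using hdiff.add hlim

/-- Mixing convergence of the double integrals of sparse graphs to the compensated Poisson law. -/
theorem IsPoissonProcess.tendsto_integral_exp_mul (hη : IsPoissonProcess η ν P)
    (h : ∀ n, IsStep ν (c n) (b n)) (hs : ∀ n k l, b n k l = b n l k)
    (hb : ∀ n k l, b n k l = 0 ∨ b n k l = 1)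
    (hD : Tendsto (fun n => degreeEnergy ν (stepFun (c n) (b n))) atTop (𝓝 0))
    (hE : Tendsto (fun n => edgeMean (cellMean ν (c n)) (b n)) atTop (𝓝 m)) (t : ℝ)
    {Y : Ω → ℂ} (hY : MemLp Y 2 P) :
    Tendsto (fun n => ∫ ω, Complex.exp (Complex.I * ((t * pathIntegral₂ ν (η ω)
        (stepFun (c n) (fun k l => b n k l / 2)) : ℝ) : ℂ)) * Y ω ∂P)
      atTop (𝓝 (limitChar m t * ∫ ω, Y ω ∂P)) := by
  classical
  have hhalf : ∀ n, IsStep ν (c n) (fun k l => b n k l / 2) := fun n =>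
    (h n).comp (fun t => t / 2) (by simp)
  set e : ℕ → Ω → ℂ := fun n ω => Complex.exp (Complex.I * ((t * pathIntegral₂ ν (η ω)
    (stepFun (c n) (fun k l => b n k l / 2)) : ℝ) : ℂ)) with he
  set θ := limitChar m t with hθ
  have hem : ∀ n, AEStronglyMeasurable (e n) P := fun n => by
    have h1 := (hη.memLp_pathIntegral₂_stepFun (hhalf n)).1.1
    have h2 : Continuous fun x : ℝ => Complex.exp (Complex.I * ((t * x : ℝ) : ℂ)) := by fun_prop
    exact h2.comp_aestronglyMeasurable h1
  have hVb : ∀ n ω, ‖e n ω - θ‖ ≤ 1 + ‖θ‖ := fun n ω =>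
    (norm_sub_le _ _).trans (add_le_add (norm_exp_I_mul_ofReal _).le le_rfl)
  have hVm : ∀ n, AEStronglyMeasurable (fun ω => e n ω - θ) P := fun n =>
    (hem n).sub aestronglyMeasurable_const
  have hV : ∀ n, MemLp (fun ω => e n ω - θ) 2 P := fun n =>
    MemLp.of_bound (hVm n) _ (.of_forall (hVb n))
  have hinner : ∀ {u w : Ω → ℂ} (hu : MemLp u 2 P) (hw : MemLp w 2 P),
      inner ℂ (hu.toLp u) (hw.toLp w) = ∫ ω, w ω * (starRingEnd ℂ) (u ω) ∂P := by
    intro u w hu hw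
    rw [L2.inner_def]
    refine integral_congr_ae ?_
    filter_upwards [hu.coeFn_toLp, hw.coeFn_toLp] with ω h1 h2
    rw [h1, h2, RCLike.inner_apply]
  have hsplit : ∀ {w : Ω → ℂ}, Integrable w P → ∀ n,
      ∫ ω, (e n ω - θ) * w ω ∂P = ∫ ω, e n ω * w ω ∂P - θ * ∫ ω, w ω ∂P := by
    intro w hw n
    have i1 : Integrable (fun ω => e n ω * w ω) P :=
      hw.bdd_mul (hem n) (c := 1) (.of_forall fun ω => (norm_exp_I_mul_ofReal _).le)
    rw [← integral_const_mul, ← integral_sub i1 (hw.const_mul θ)]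
    exact integral_congr_ae (.of_forall fun ω => by ring)
  -- For fixed `j` the `j`-th variable is a bounded function of the counts of the partition `c j`,
  -- hence an admissible test functional as `n → ∞`.
  have hself : ∀ j, Tendsto (fun n => inner ℂ ((hV j).toLp _) ((hV n).toLp _)) atTop (𝓝 0) := by
    intro j
    set H : (κ j → ℕ) → ℂ := fun x => (starRingEnd ℂ) (Complex.exp (Complex.I *
      ((t * charlierPoly (cellMean ν (c j)) (fun k l => b j k l / 2) x : ℝ) : ℂ)) - θ) with hHdef
    have hHb : ∀ x, ‖H x‖ ≤ 1 + ‖θ‖ := fun x => by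
      rw [hHdef, RCLike.norm_conj]
      exact (norm_sub_le _ _).trans (add_le_add (norm_exp_I_mul_ofReal _).le le_rfl)
    have hHae : (fun ω => H (cellCount ν (c j) (η ω))) =ᵐ[P]
        fun ω => (starRingEnd ℂ) (e j ω - θ) := by
      filter_upwards [hη.ae_pathIntegral₂_stepFun (hhalf j)] with ω hω
      simp only [hHdef, he, hω]
    have hHi : Integrable (fun ω => H (cellCount ν (c j) (η ω))) P := by
      refine Integrable.congr ?_ hHae.symm
      exact (((hV j).star).integrable one_le_two)
    have h1 := hη.tendsto_integral_exp_mul_cellCount h hs hb hD hE (h j).measurableSet hHb t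
    have h2 := h1.sub_const (θ * ∫ ω, H (cellCount ν (c j) (η ω)) ∂P)
    rw [sub_self] at h2
    refine h2.congr fun n => ?_
    rw [hinner, ← hsplit hHi n]
    refine integral_congr_ae ?_
    filter_upwards [hHae] with ω hω
    rw [hω]
  have hnorm : ∀ n, ‖(hV n).toLp _‖ ≤ 1 + ‖θ‖ := by
    intro n
    rw [Lp.norm_toLp]
    have h1 := eLpNorm_le_of_ae_bound (p := 2) (μ := P) (.of_forall (hVb n))
    rw [measure_univ, ENNReal.one_rpow, one_mul] at h1
    exact ENNReal.toReal_le_of_le_ofReal (by positivity) h1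
  -- The inner product is conjugate linear in its first argument, hence the conjugate of `Y`.
  have hfin := tendsto_inner_of_tendsto_inner_self hnorm hself (hY.star.toLp _)
  have h2 := hfin.add_const (θ * ∫ ω, Y ω ∂P)
  rw [zero_add] at h2
  refine h2.congr fun n => ?_
  rw [hinner]
  have h3 : ∫ ω, (e n ω - θ) * (starRingEnd ℂ) ((star Y) ω) ∂P = ∫ ω, (e n ω - θ) * Y ω ∂P := by
    refine integral_congr_ae (.of_forall fun ω => ?_)
    simp
  rw [h3, hsplit (hY.integrable one_le_two) n, sub_add_cancel]

end Mixing

/-! ### Joint characteristic functions and the limit law. -/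

section StableLimit

variable {Ω Z : Type*} [MeasurableSpace Ω] [MeasurableSpace Z] {P : Measure Ω}

theorem charFun_map_toLp_prod {X Y : Ω → ℝ} (hX : AEMeasurable X P) (hY : AEMeasurable Y P)
    (t : WithLp 2 (ℝ × ℝ)) :
    charFun (P.map fun ω => WithLp.toLp 2 (X ω, Y ω)) t =
      ∫ ω, Complex.exp (Complex.I * ((t.fst * X ω : ℝ) : ℂ)) *
        Complex.exp (Complex.I * ((t.snd * Y ω : ℝ) : ℂ)) ∂P := by
  have hm : AEMeasurable (fun ω => WithLp.toLp 2 (X ω, Y ω)) P :=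
    (WithLp.prod_continuous_toLp 2 ℝ ℝ).measurable.comp_aemeasurable (hX.prodMk hY)
  have hc : Continuous fun x : WithLp 2 (ℝ × ℝ) =>
      Complex.exp (((inner ℝ x t : ℝ) : ℂ) * Complex.I) := by fun_prop
  rw [charFun_apply, integral_map hm hc.aestronglyMeasurable]
  refine integral_congr_ae (.of_forall fun ω => ?_)
  simp only [WithLp.prod_inner_apply, ← Complex.exp_add]
  congr 1
  simp
  ring

/-- Lévy's continuity theorem is applied in the Euclidean plane, whose inner product defines the
characteristic function; the continuous identification with `ℝ × ℝ` carries the convergence back. -/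
theorem tendstoInDistribution_prodMk [IsProbabilityMeasure P] {X : ℕ → Ω → ℝ} {X' Y : Ω → ℝ}
    (hX : ∀ n, AEMeasurable (X n) P) (hX' : AEMeasurable X' P) (hY : AEMeasurable Y P)
    (h : ∀ s u : ℝ, Tendsto (fun n => ∫ ω, Complex.exp (Complex.I * ((s * X n ω : ℝ) : ℂ)) *
        Complex.exp (Complex.I * ((u * Y ω : ℝ) : ℂ)) ∂P) atTop
      (𝓝 (∫ ω, Complex.exp (Complex.I * ((s * X' ω : ℝ) : ℂ)) *
        Complex.exp (Complex.I * ((u * Y ω : ℝ) : ℂ)) ∂P))) :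
    TendstoInDistribution (fun n ω => (X n ω, Y ω)) atTop (fun ω => (X' ω, Y ω))
      (fun _ => P) P := by
  have hto := WithLp.prod_continuous_toLp 2 ℝ ℝ
  have hof := WithLp.prod_continuous_ofLp 2 ℝ ℝ
  have hm : ∀ {U : Ω → ℝ}, AEMeasurable U P →
      AEMeasurable (fun ω => WithLp.toLp 2 (U ω, Y ω)) P := fun hU =>
    hto.measurable.comp_aemeasurable (hU.prodMk hY)
  let μ : ℕ → ProbabilityMeasure (WithLp 2 (ℝ × ℝ)) := fun n =>
    ⟨P.map fun ω => WithLp.toLp 2 (X n ω, Y ω), Measure.isProbabilityMeasure_map (hm (hX n))⟩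
  let μ₀ : ProbabilityMeasure (WithLp 2 (ℝ × ℝ)) :=
    ⟨P.map fun ω => WithLp.toLp 2 (X' ω, Y ω), Measure.isProbabilityMeasure_map (hm hX')⟩
  have hμ : Tendsto μ atTop (𝓝 μ₀) := by
    refine ProbabilityMeasure.tendsto_iff_tendsto_charFun.2 fun t => ?_
    have h1 := h t.fst t.snd
    rw [← charFun_map_toLp_prod hX' hY t] at h1
    exact h1.congr fun n => (charFun_map_toLp_prod (hX n) hY t).symm
  have hmap : ∀ {U : Ω → ℝ}, AEMeasurable U P →
      (P.map fun ω => WithLp.toLp 2 (U ω, Y ω)).map WithLp.ofLp = P.map fun ω => (U ω, Y ω) :=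
    fun hU => AEMeasurable.map_map_of_aemeasurable hof.measurable.aemeasurable (hm hU)
  refine ⟨fun n => (hX n).prodMk hY, hX'.prodMk hY, ?_⟩
  have h2 := ProbabilityMeasure.tendsto_map_of_tendsto_of_continuous μ μ₀ hμ hof
  rw [show μ₀.map hof.measurable.aemeasurable =
    ⟨P.map fun ω => (X' ω, Y ω), Measure.isProbabilityMeasure_map (hX'.prodMk hY)⟩ from
      Subtype.ext (hmap hX')] at h2
  exact h2.congr fun n => Subtype.ext (hmap (hX n))

variable {N : Ω → Measure ℝ}

theorem integral_exp_poisson (hN : IsPoissonProcess N (volume.restrict (Set.Ici (0 : ℝ))) P)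
    {m : ℝ} (hm : 0 ≤ m) (t : ℝ) :
    ∫ ω, Complex.exp (Complex.I * ((t * ((N ω (Set.Icc 0 m)).toReal - m) : ℝ) : ℂ)) ∂P =
      limitChar m t := by
  have hB : volume.restrict (Set.Ici (0 : ℝ)) (Set.Icc 0 m) = ENNReal.ofReal m := by
    rw [Measure.restrict_apply measurableSet_Icc,
      Set.inter_eq_left.2 Set.Icc_subset_Ici_self, Real.volume_Icc, sub_zero]
  have hmeas : Measurable fun ω => N ω (Set.Icc 0 m) :=
    (Measure.measurable_coe measurableSet_Icc).comp hN.measurable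
  have hlaw := hN.law (Set.Icc 0 m) measurableSet_Icc (by rw [hB]; exact ENNReal.ofReal_lt_top)
  rw [hB] at hlaw
  have hmap : P.map (fun ω => (N ω (Set.Icc 0 m)).toReal) =
      (poissonMeasure (ENNReal.ofReal m).toNNReal).map (fun k : ℕ => (k : ℝ)) := by
    have h1 := congrArg (Measure.map ENNReal.toReal) hlaw
    rw [Measure.map_map ENNReal.measurable_toReal hmeas,
      Measure.map_map ENNReal.measurable_toReal (measurable_of_countable _)] at h1
    exact h1
  have hchar := charFun_map_cast_poissonMeasure (ENNReal.ofReal m).toNNReal t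
  have h2 : charFun (P.map fun ω => (N ω (Set.Icc 0 m)).toReal) t =
      ∫ ω, Complex.exp (t * (N ω (Set.Icc 0 m)).toReal * Complex.I) ∂P := by
    rw [charFun_apply_real, integral_map hmeas.ennreal_toReal.aemeasurable]
    exact (Continuous.aestronglyMeasurable (by fun_prop))
  rw [hmap] at h2
  have hr : (((ENNReal.ofReal m).toNNReal : ℝ) : ℂ) = m := by
    rw [show ((ENNReal.ofReal m).toNNReal : ℝ) = m from ENNReal.toReal_ofReal hm]
  have h3 : ∀ ω, Complex.exp (Complex.I * ((t * ((N ω (Set.Icc 0 m)).toReal - m) : ℝ) : ℂ)) =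
      Complex.exp (t * (N ω (Set.Icc 0 m)).toReal * Complex.I) *
        Complex.exp (-(m * (Complex.I * t))) := fun ω => by
    rw [← Complex.exp_add]; congr 1; push_cast; ring
  simp only [h3]
  rw [integral_mul_const, ← h2, hchar, hr, limitChar, ← Complex.exp_add]
  congr 1
  rw [mul_comm (t : ℂ) Complex.I]
  ring

theorem norm_exp_sub_exp_le (x y : ℝ) :
    ‖Complex.exp (Complex.I * (x : ℂ)) - Complex.exp (Complex.I * (y : ℂ))‖ ≤ |x - y| := by
  have e : Complex.exp (Complex.I * (x : ℂ)) - Complex.exp (Complex.I * (y : ℂ)) =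
      Complex.exp (Complex.I * (y : ℂ)) * (Complex.exp (Complex.I * ((x - y : ℝ) : ℂ)) - 1) := by
    rw [mul_sub, ← Complex.exp_add, mul_one]
    congr 2; push_cast; ring
  rw [e, norm_mul, norm_exp_I_mul_ofReal, one_mul]
  exact Real.norm_exp_I_mul_ofReal_sub_one_le

/-- The map `x ↦ e^{itx}` is `|t|`-Lipschitz, so `L¹`-close sequences share their limits against
bounded test variables. -/
theorem tendsto_integral_exp_mul_of_tendsto_eLpNorm_sub [IsProbabilityMeasure P]
    {X X' : ℕ → Ω → ℝ} {Y : Ω → ℂ}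
    (hX : ∀ n, MemLp (X n) 1 P) (hX' : ∀ n, MemLp (X' n) 1 P)
    (hY : AEStronglyMeasurable Y P) (hYb : ∀ ω, ‖Y ω‖ ≤ 1)
    (h : Tendsto (fun n => eLpNorm (fun ω => X n ω - X' n ω) 1 P) atTop (𝓝 0)) (t : ℝ) {z : ℂ}
    (hz : Tendsto (fun n => ∫ ω, Complex.exp (Complex.I * ((t * X' n ω : ℝ) : ℂ)) * Y ω ∂P)
      atTop (𝓝 z)) :
    Tendsto (fun n => ∫ ω, Complex.exp (Complex.I * ((t * X n ω : ℝ) : ℂ)) * Y ω ∂P)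
      atTop (𝓝 z) := by
  have hYi : Integrable Y P :=
    (MemLp.of_bound hY 1 (.of_forall hYb) : MemLp Y 1 P).integrable le_rfl
  have hc : Continuous fun x : ℝ => Complex.exp (Complex.I * ((t * x : ℝ) : ℂ)) := by fun_prop
  have hi : ∀ {U : Ω → ℝ}, MemLp U 1 P →
      Integrable (fun ω => Complex.exp (Complex.I * ((t * U ω : ℝ) : ℂ)) * Y ω) P := fun hU =>
    hYi.bdd_mul (hc.comp_aestronglyMeasurable hU.1) (c := 1)
      (.of_forall fun ω => (norm_exp_I_mul_ofReal _).le)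
  have hlim : Tendsto (fun n => |t| * ∫ ω, |X n ω - X' n ω| ∂P) atTop (𝓝 0) := by
    have h1 := ((ENNReal.tendsto_toReal ENNReal.zero_ne_top).comp h).const_mul |t|
    rw [ENNReal.toReal_zero, mul_zero] at h1
    refine h1.congr fun n => ?_
    have hm : AEStronglyMeasurable (fun ω => X n ω - X' n ω) P := (hX n).1.sub (hX' n).1
    rw [Function.comp_apply, eLpNorm_one_eq_lintegral_enorm, ← integral_norm_eq_lintegral_enorm hm]
    rfl
  have hdiff : Tendsto (fun n => (∫ ω, Complex.exp (Complex.I * ((t * X n ω : ℝ) : ℂ)) * Y ω ∂P) -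
      ∫ ω, Complex.exp (Complex.I * ((t * X' n ω : ℝ) : ℂ)) * Y ω ∂P) atTop (𝓝 0) := by
    refine squeeze_zero_norm (fun n => ?_) hlim
    have hsub : Integrable (fun ω => X n ω - X' n ω) P :=
      ((hX n).integrable le_rfl).sub ((hX' n).integrable le_rfl)
    rw [← integral_sub (hi (hX n)) (hi (hX' n)), ← integral_const_mul]
    refine norm_integral_le_of_norm_le (hsub.abs.const_mul |t|) (.of_forall fun ω => ?_)
    rw [← sub_mul, norm_mul]
    have h1 := norm_exp_sub_exp_le (t * X n ω) (t * X' n ω)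
    rw [← mul_sub, abs_mul] at h1
    exact (mul_le_of_le_one_right (norm_nonneg _) (hYb ω)).trans h1
  simpa using hdiff.add hz

end StableLimit

end PoissonMixture

/-! ### The limit theorem. -/

theorem mainTheorem9 {Ω Z : Type*} [MeasurableSpace Ω] [MeasurableSpace Z]
    (P : Measure Ω) [IsProbabilityMeasure P] (ν : Measure Z) [SigmaFinite ν]
    (η : Ω → Measure Z) (hη : PoissonMixture.IsPoissonProcess η ν P)
    -- a Poisson process on the half-line, independent of `η`, that realises the limit law
    (N : Ω → Measure ℝ)
    (hN : PoissonMixture.IsPoissonProcess N (volume.restrict (Set.Ici (0 : ℝ))) P)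
    (hNη : IndepFun η N P)
    (g g' : ℕ → Z × Z → ℝ)
    (hg : ∀ n, MemLp (g n) 2 (ν.prod ν))
    (hg_symm : ∀ n, (fun p => g n p.swap) =ᵐ[ν.prod ν] g n)
    (hg' : ∀ n, MemLp (g' n) 2 (ν.prod ν))
    (hg'_symm : ∀ n, (fun p => (g' n p + g' n p.swap) / 2) =ᵐ[ν.prod ν] g n)
    (g₂ : Z × Z → ℝ) (hg₂ : MemLp g₂ 2 (ν.prod ν)) (g₀ : ℝ)
    -- (KS)
    (hKS₂ : Tendsto
      (fun n => eLpNorm (fun p => PoissonMixture.star₁₁ ν (g n) (g' n) p - g₂ p) 2 (ν.prod ν))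
      atTop (𝓝 0))
    (hKS₀ : Tendsto (fun n => ∫ p, g n p * g' n p ∂(ν.prod ν)) atTop (𝓝 g₀))
    -- (KW)
    (hKW : ∀ h : Z → ℝ, MemLp h 2 ν →
      Tendsto (fun n => eLpNorm (PoissonMixture.star₁₁' ν (g' n) h) 2 ν) atTop (𝓝 0))
    -- (KR⋆)
    (hKR : Tendsto (fun n => eLpNorm (PoissonMixture.star₂₁ ν (g n) (g n)) 2 ν) atTop (𝓝 0))
    -- (KP₄)
    (hKP : Tendsto
      (fun n => ∫⁻ p, ENNReal.ofReal ((g n p) ^ 2 * (g n p - 1 / 2) ^ 2) ∂(ν.prod ν))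
      atTop (𝓝 0))
    (M : Ω → ℝ)
    (hM : M = fun ω => 2 * (PoissonMixture.poissonIntegral₂ P ν η g₂ ω + g₀))
    (hM_nonneg : ∀ᵐ ω ∂P, 0 ≤ M ω) :
    PoissonMixture.StablyTendsto (PoissonMixture.sigmaAlgebra η) P
      (fun n => PoissonMixture.poissonIntegral₂ P ν η (g n))
      (PoissonMixture.poissonMixture N M) := by
  have hg₂0 := PoissonMixture.ae_eq_zero_of_tendsto_star₁₁ hg hg' hg'_symm hg₂ hKS₂ hKW hKR
  -- The random part of `M` vanishes with its kernel, so the limit is a plain compensated Poisson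
  -- variable.
  have hMae : ∀ᵐ ω ∂P, M ω = 2 * g₀ := by
    filter_upwards [hη.poissonIntegral₂_ae_eq_zero hg₂0] with ω hω
    rw [hM]; simp only [hω, Pi.zero_apply, zero_add]
  have hg₀ : 0 ≤ 2 * g₀ := by
    obtain ⟨ω, h1, h2⟩ := (hMae.and hM_nonneg).exists
    rwa [h1] at h2
  have hsq : Tendsto (fun n => ∫ p, g n p ^ 2 ∂(ν.prod ν)) atTop (𝓝 g₀) :=
    hKS₀.congr fun n =>
      PoissonMixture.integral_mul_eq_integral_sq (hg n) (hg' n) (hg_symm n) (hg'_symm n)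
  obtain ⟨κ, _, c, b, hb, hbs, hb01, hgb, hD, hE⟩ :=
    PoissonMixture.exists_graph_sequence hg hg_symm hsq hKR hKP
  have hstep : ∀ n, PoissonMixture.IsStepFun ν
      (PoissonMixture.stepFun (c n) (fun k l => b n k l / 2)) := fun n =>
    ⟨κ n, inferInstance, c n, _, (hb n).comp (fun t => t / 2) (by simp), rfl⟩
  have hF : ∀ n, MemLp (PoissonMixture.poissonIntegral₂ P ν η (g n)) 2 P := fun n =>
    (hη.isPoissonIntegral₂ (hg n)).1
  have hJ := fun n => hη.memLp_pathIntegral₂ (hstep n)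
  have hFJ : Tendsto (fun n => eLpNorm (fun ω => PoissonMixture.poissonIntegral₂ P ν η (g n) ω -
      PoissonMixture.pathIntegral₂ ν (η ω)
        (PoissonMixture.stepFun (c n) (fun k l => b n k l / 2))) 1 P) atTop (𝓝 0) := by
    refine tendsto_of_tendsto_of_tendsto_of_le_of_le tendsto_const_nhds ?_ (fun _ => zero_le)
      fun n => hη.eLpNorm_poissonIntegral₂_sub_le (hg n) (hstep n)
    simpa using ENNReal.Tendsto.const_mul (a := 2) hgb (Or.inr (by simp))
  have hNm : Measurable fun ω => (N ω (Set.Icc 0 (2 * g₀))).toReal - 2 * g₀ :=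
    ((Measure.measurable_coe measurableSet_Icc).comp hN.measurable).ennreal_toReal.sub_const _
  have hlim : PoissonMixture.poissonMixture N M =ᵐ[P]
      fun ω => (N ω (Set.Icc 0 (2 * g₀))).toReal - 2 * g₀ := by
    filter_upwards [hMae] with ω hω
    rw [PoissonMixture.poissonMixture, hω]
  intro Y hYW _
  have hY : Measurable Y := hYW.mono hη.measurable.comap_le le_rfl
  refine PoissonMixture.tendstoInDistribution_prodMk (fun n => (hF n).1.aemeasurable)
    (hNm.aemeasurable.congr hlim.symm) hY.aemeasurable fun s u => ?_
  have hφ : Measurable fun y : ℝ => Complex.exp (Complex.I * ((u * y : ℝ) : ℂ)) :=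
    Continuous.measurable (by fun_prop)
  have hYm : AEStronglyMeasurable (fun ω => Complex.exp (Complex.I * ((u * Y ω : ℝ) : ℂ))) P :=
    (hφ.comp hY).aestronglyMeasurable
  have hYb : ∀ ω, ‖Complex.exp (Complex.I * ((u * Y ω : ℝ) : ℂ))‖ ≤ 1 := fun ω =>
    (PoissonMixture.norm_exp_I_mul_ofReal _).le
  have key := PoissonMixture.tendsto_integral_exp_mul_of_tendsto_eLpNorm_sub
    (fun n => (hF n).mono_exponent one_le_two) (fun n => (hJ n).mono_exponent one_le_two)
    hYm hYb hFJ s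
    (hη.tendsto_integral_exp_mul hb hbs hb01 hD hE s (MemLp.of_bound hYm 1 (.of_forall hYb)))
  have hlimit : ∫ ω, Complex.exp (Complex.I * ((s * PoissonMixture.poissonMixture N M ω : ℝ) : ℂ)) *
      Complex.exp (Complex.I * ((u * Y ω : ℝ) : ℂ)) ∂P =
      PoissonMixture.limitChar (2 * g₀) s *
        ∫ ω, Complex.exp (Complex.I * ((u * Y ω : ℝ) : ℂ)) ∂P := by
    -- Being measurable with respect to `η`, the variable `Y` is a function of `η`; independence of
    -- `N` factorises the expectation.
    obtain ⟨Y', hY', rfl⟩ := hYW.exists_eq_measurable_comp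
    have hψ : Measurable fun μ : Measure ℝ =>
        Complex.exp (Complex.I * ((s * ((μ (Set.Icc 0 (2 * g₀))).toReal - 2 * g₀) : ℝ) : ℂ)) :=
      (Continuous.measurable (by fun_prop :
        Continuous fun x : ℝ => Complex.exp (Complex.I * ((s * x : ℝ) : ℂ)))).comp
        ((Measure.measurable_coe measurableSet_Icc).ennreal_toReal.sub_const _)
    have hind := (hNη.comp (hφ.comp hY') hψ).symm
    rw [← PoissonMixture.integral_exp_poisson hN hg₀ s]
    have h1 := hind.integral_fun_mul_eq_mul_integral (hψ.comp hN.measurable).aestronglyMeasurable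
      ((hφ.comp hY').comp hη.measurable).aestronglyMeasurable
    refine Eq.trans (integral_congr_ae ?_) h1
    filter_upwards [hlim] with ω hω
    rw [hω]
    rfl
  rw [hlimit]
  exact key
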